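/- For an integer $q\ge 2$ let $f(x)=\sum_{k=1}^{\infty}q^{-k}\sin\bigl(2^{q^{k}}x\bigr)$, $F(x)=1+\int_0^x f(t)\,dt$ (both are $2\pi$-periodic), and let $\omega=\{(r\cos\theta,r\sin\theta)\mid 0\le r<F(\theta),\ \theta\in\mathbb R\}\subset\mathbb R^2$. For $q$ large, $\omega$ is a bounded $C^1$ domain, and its outward unit normal at the boundary point with polar coordinates $(F(\theta),\theta)$ is $$n(\theta)=(F^2+f^2)^{-1/2}\bigl(F\cos\theta+f\sin\theta,\;F\sin\theta-f\cos\theta\bigr).$$ For $1\le p<\infty$ let $W^{s,p}(\omega)$ be the Sobolev--Slobodeckij space: $W^{0,p}=L^p$; for $0<s<1$ the norm is the sum of $\|u\|_{L^p(\omega)}$ and $\bigl(\int_\omega\int_\omega |u(y)-u(x)|^p\,|y-x|^{-2-sp}\,dx\,dy\bigr)^{1/p}$; and $u\in W^{s+1,p}$ if and only if $u$ and its weak gradient are in $W^{s,p}$. The trace on $\partial\omega$ of $u\in W^{s,p}(\omega)$, $s>\frac1p$, is the limit in $L^p(\partial\omega)$ of $\varphi_j|_{\partial\omega}$ for smooth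 $\varphi_j$ with $\varphi_j\to u$ in $W^{s,p}(\omega)$; it is regarded as a function of the polar angle $\theta$. There is $q_0$ such that for all integers $q\ge q_0$, all real $p\ge 1$, $\varepsilon>0$ and all $u\in W^{\frac1p+\varepsilon,p}(\omega;\mathbb C^2)$, the following holds. The trace $g=(g_1,g_2)$ of $u$ on $\partial\omega$ exists and is unique up to null sets. If its normal component $n_1g_1+n_2g_2$ vanishes almost everywhere on $\partial\omega$, then $g=0$ almost everywhere on $\partial\omega$. Likewise, if its tangential component $n_1g_2-n_2g_1$ vanishes almost everywhere on $\partial\omega$, then $g=0$ almost everywhere on $\partial\omega$. -/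

import Mathlib

open Real Set Filter Topology MeasureTheory
open scoped ENNReal ContDiff

noncomputable section

/-- `v` is the weak partial derivative `∂ᵢ u` on the open set `Ω ⊆ ℝᵈ`. -/
def HasWeakPartial {d : ℕ} {V : Type*} [NormedAddCommGroup V] [NormedSpace ℝ V]
    (Ω : Set (EuclideanSpace ℝ (Fin d))) (i : Fin d) (u v : EuclideanSpace ℝ (Fin d) → V) : Prop :=
  LocallyIntegrableOn u Ω volume ∧ LocallyIntegrableOn v Ω volume ∧
    ∀ φ : EuclideanSpace ℝ (Fin d) → ℝ, ContDiff ℝ ∞ φ → HasCompactSupport φ → tsupport φ ⊆ Ω →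
      ∫ x in Ω, (fderiv ℝ φ x (EuclideanSpace.single i 1)) • u x = - ∫ x in Ω, φ x • v x

/-- The Slobodeckij seminorm `(∫_Ω ∫_Ω |u(y) - u(x)|ᵖ / |y - x|^(d + σ p) dx dy)^(1/p)`,
for `0 < σ < 1`. -/
def slobodeckijSeminorm {d : ℕ} {V : Type*} [NormedAddCommGroup V]
    (Ω : Set (EuclideanSpace ℝ (Fin d))) (σ p : ℝ) (u : EuclideanSpace ℝ (Fin d) → V) : ℝ≥0∞ :=
  (∫⁻ y in Ω, ∫⁻ x in Ω, ‖u y - u x‖ₑ ^ p / ‖y - x‖ₑ ^ ((d : ℝ) + σ * p)) ^ (1 / p)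

/-- The norm of `W^{m+σ,p}(Ω)` for `m ∈ ℕ` and `0 ≤ σ < 1`, by recursion on `m`:
`‖u‖_{σ,p} = ‖u‖_{Lᵖ} + |u|_{σ,p}` (without the seminorm if `σ = 0`) and
`‖u‖_{s+1,p} = ‖u‖_{s,p} + ∑ᵢ ‖∂ᵢu‖_{s,p}`. The infimum runs over the (a.e. equal) representatives
of the weak derivative `∂ᵢu`; it is `∞` if `∂ᵢu` does not exist. -/
def sobolevNormAux {d : ℕ} {V : Type*} [NormedAddCommGroup V] [NormedSpace ℝ V]
    (Ω : Set (EuclideanSpace ℝ (Fin d))) (σ p : ℝ) :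
    ℕ → (EuclideanSpace ℝ (Fin d) → V) → ℝ≥0∞
  | 0, u => eLpNorm u (ENNReal.ofReal p) (volume.restrict Ω) +
      if σ = 0 then 0 else slobodeckijSeminorm Ω σ p u
  | m + 1, u => sobolevNormAux Ω σ p m u +
      ∑ i : Fin d, ⨅ (v : EuclideanSpace ℝ (Fin d) → V) (_ : HasWeakPartial Ω i u v),
        sobolevNormAux Ω σ p m v

/-- The norm of the Sobolev-Slobodeckij space `W^{s,p}(Ω)`, `s ≥ 0`, `1 ≤ p < ∞`, with values
in `[0, ∞]`. -/
def sobolevNorm {d : ℕ} {V : Type*} [NormedAddCommGroup V] [NormedSpace ℝ V]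
    (Ω : Set (EuclideanSpace ℝ (Fin d))) (s p : ℝ) (u : EuclideanSpace ℝ (Fin d) → V) : ℝ≥0∞ :=
  sobolevNormAux Ω (s - ⌊s⌋₊) p ⌊s⌋₊ u

/-- `u ∈ W^{s,p}(Ω; V)`. -/
def MemSobolev {d : ℕ} {V : Type*} [NormedAddCommGroup V] [NormedSpace ℝ V]
    (Ω : Set (EuclideanSpace ℝ (Fin d))) (s p : ℝ) (u : EuclideanSpace ℝ (Fin d) → V) : Prop :=
  AEStronglyMeasurable u (volume.restrict Ω) ∧ sobolevNorm Ω s p u < ⊤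

/-- The lacunary series `f(x) = ∑_{k ≥ 1} a_k sin(b_k x)` with `a_k = q^{-k}`, `b_k = 2^(q^k)`. -/
def lacunary (q : ℕ) (x : ℝ) : ℝ :=
  ∑' k : ℕ, ((q : ℝ) ^ (k + 1))⁻¹ * sin ((2 : ℝ) ^ (q ^ (k + 1)) * x)

/-- `F(x) = 1 + ∫₀ˣ f(t) dt`. -/
def radiusFun (q : ℕ) (x : ℝ) : ℝ := 1 + ∫ t in (0 : ℝ)..x, lacunary q t

/-- The domain `ω = {(r, θ) | r < F(θ)}` in polar coordinates. -/
def omegaDomain (q : ℕ) : Set (EuclideanSpace ℝ (Fin 2)) :=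
  {x | ∃ r θ : ℝ, 0 ≤ r ∧ r < radiusFun q θ ∧ x = !₂[r * cos θ, r * sin θ]}

/-- The point of `∂ω` with polar coordinates `(F(θ), θ)`. -/
def bdryPoint (q : ℕ) (θ : ℝ) : EuclideanSpace ℝ (Fin 2) :=
  !₂[radiusFun q θ * cos θ, radiusFun q θ * sin θ]

/-- The outward unit normal to `∂ω` at `bdryPoint q θ`: since `F' = f`, the tangent vector there is
`(f cos θ - F sin θ, f sin θ + F cos θ)`. -/
def bdryNormal (q : ℕ) (θ : ℝ) : EuclideanSpace ℝ (Fin 2) :=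
  (√(radiusFun q θ ^ 2 + lacunary q θ ^ 2))⁻¹ •
    !₂[radiusFun q θ * cos θ + lacunary q θ * sin θ,
       radiusFun q θ * sin θ - lacunary q θ * cos θ]

/-- The measure `dθ` on a period. The arc length `ds = (F² + f²)^(1/2) dθ` of `∂ω` has the same
null sets and, the density being bounded above and below, the same `Lᵖ` spaces. -/
def angleMeasure : Measure ℝ := volume.restrict (Ioc 0 (2 * π))

/-- `g`, a function of the polar angle, is the trace on `∂ω` of `u ∈ W^{s,p}(ω)`: the restriction
to `∂ω` of functions that are smooth up to the boundary is extended by continuity from the norm of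
`W^{s,p}(ω)` to the norm of `Lᵖ(∂ω)`. -/
def HasTrace {V : Type*} [NormedAddCommGroup V] [NormedSpace ℝ V] (q : ℕ) (s p : ℝ)
    (u : EuclideanSpace ℝ (Fin 2) → V) (g : ℝ → V) : Prop :=
  MemLp g (ENNReal.ofReal p) angleMeasure ∧
    ∃ φ : ℕ → EuclideanSpace ℝ (Fin 2) → V, (∀ n, ContDiff ℝ ∞ (φ n)) ∧
      Tendsto (fun n => sobolevNorm (omegaDomain q) s p (fun x => φ n x - u x)) atTop (𝓝 0) ∧
      Tendsto (fun n => eLpNorm (fun θ => φ n (bdryPoint q θ) - g θ) (ENNReal.ofReal p)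
        angleMeasure) atTop (𝓝 0)

end

theorem lacunary_coeff_eq {q : ℕ} (k : ℕ) :
    ((q : ℝ) ^ (k + 1))⁻¹ = (q : ℝ)⁻¹ * ((q : ℝ)⁻¹) ^ k := by
  rw [pow_succ, mul_inv, inv_pow, mul_comm]

theorem lacunary_hasSum_coeff {q : ℕ} (hq : 8 ≤ q) :
    HasSum (fun k : ℕ => ((q : ℝ) ^ (k + 1))⁻¹) (((q : ℝ) - 1)⁻¹) := by
  have h8 : (8 : ℝ) ≤ q := by exact_mod_cast hq
  have h1 : ((q : ℝ)⁻¹) < 1 := inv_lt_one_of_one_lt₀ (by linarith)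
  have h := (hasSum_geometric_of_lt_one (by positivity) h1).mul_left ((q : ℝ)⁻¹)
  have e : (q : ℝ)⁻¹ * (1 - (q : ℝ)⁻¹)⁻¹ = ((q : ℝ) - 1)⁻¹ := by
    have : (q : ℝ) - 1 ≠ 0 := by linarith
    have : (q : ℝ) ≠ 0 := by linarith
    field_simp
  rw [e] at h
  exact h.congr_fun (fun k => lacunary_coeff_eq k)

theorem lacunary_coeff_tsum_le {q : ℕ} (hq : 8 ≤ q) :
    ∑' k : ℕ, ((q : ℝ) ^ (k + 1))⁻¹ ≤ 1 / 7 := by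
  rw [(lacunary_hasSum_coeff hq).tsum_eq, one_div]
  have h8 : (8 : ℝ) ≤ q := by exact_mod_cast hq
  exact inv_anti₀ (by norm_num) (by linarith)

theorem lacunary_term_bound {q : ℕ} (k : ℕ) (x : ℝ) :
    ‖((q : ℝ) ^ (k + 1))⁻¹ * sin ((2 : ℝ) ^ (q ^ (k + 1)) * x)‖ ≤ ((q : ℝ) ^ (k + 1))⁻¹ := by
  rw [norm_mul, Real.norm_of_nonneg (by positivity : 0 ≤ ((q : ℝ) ^ (k + 1))⁻¹)]
  exact mul_le_of_le_one_right (by positivity) (abs_sin_le_one _)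

theorem lacunary_summable {q : ℕ} (hq : 8 ≤ q) (x : ℝ) :
    Summable fun k : ℕ => ((q : ℝ) ^ (k + 1))⁻¹ * sin ((2 : ℝ) ^ (q ^ (k + 1)) * x) :=
  .of_norm_bounded (lacunary_hasSum_coeff hq).summable fun k => lacunary_term_bound k x

theorem lacunary_continuous {q : ℕ} (hq : 8 ≤ q) : Continuous (lacunary q) :=
  continuous_tsum (fun k => by fun_prop) (lacunary_hasSum_coeff hq).summable lacunary_term_bound

theorem lacunary_abs_le {q : ℕ} (hq : 8 ≤ q) (x : ℝ) : |lacunary q x| ≤ 1 / 7 :=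
  (tsum_of_norm_bounded (lacunary_hasSum_coeff hq).summable.hasSum
    fun k => lacunary_term_bound k x).trans (lacunary_coeff_tsum_le hq)

theorem lacunary_neg (q : ℕ) (x : ℝ) : lacunary q (-x) = -lacunary q x := by
  simp only [lacunary, mul_neg, sin_neg, tsum_neg]

theorem lacunary_periodic (q : ℕ) : Function.Periodic (lacunary q) (2 * π) := by
  intro x
  refine tsum_congr fun k => ?_
  congr 1
  have : (2 : ℝ) ^ (q ^ (k + 1)) * (x + 2 * π)
      = (2 : ℝ) ^ (q ^ (k + 1)) * x + ((2 ^ (q ^ (k + 1)) : ℕ) : ℝ) * (2 * π) := by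
    push_cast; ring
  rw [this, sin_add_nat_mul_two_pi]

theorem radiusFun_hasDerivAt {q : ℕ} (hq : 8 ≤ q) (x : ℝ) :
    HasDerivAt (radiusFun q) (lacunary q x) x :=
  (intervalIntegral.integral_hasDerivAt_right
    ((lacunary_continuous hq).intervalIntegrable _ _)
    ((lacunary_continuous hq).stronglyMeasurableAtFilter _ _)
    (lacunary_continuous hq).continuousAt).const_add 1

theorem radiusFun_continuous {q : ℕ} (hq : 8 ≤ q) : Continuous (radiusFun q) :=
  continuous_iff_continuousAt.2 fun x => (radiusFun_hasDerivAt hq x).continuousAt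

theorem radiusFun_periodic {q : ℕ} (hq : 8 ≤ q) : Function.Periodic (radiusFun q) (2 * π) := by
  have hi : ∀ a b, IntervalIntegrable (lacunary q) volume a b :=
    fun a b => (lacunary_continuous hq).intervalIntegrable a b
  have h0 : ∫ t in (-π)..π, lacunary q t = 0 := by
    have h := intervalIntegral.integral_comp_neg (a := -π) (b := π) (lacunary q)
    simp only [lacunary_neg, intervalIntegral.integral_neg, neg_neg] at h
    linarith
  intro x
  have h1 := (lacunary_periodic q).intervalIntegral_add_eq x (-π)
  rw [show -π + 2 * π = π by ring, h0] at h1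
  unfold radiusFun
  rw [← intervalIntegral.integral_add_adjacent_intervals (hi 0 x) (hi x _), h1, add_zero]

theorem radiusFun_lipschitz {q : ℕ} (hq : 8 ≤ q) (x y : ℝ) :
    |radiusFun q y - radiusFun q x| ≤ 1 / 7 * |y - x| := by
  have := convex_univ.norm_image_sub_le_of_norm_hasDerivWithin_le (f := radiusFun q)
    (f' := lacunary q) (C := 1 / 7) (x := x) (y := y)
    (fun z _ => (radiusFun_hasDerivAt hq z).hasDerivWithinAt)
    (fun z _ => lacunary_abs_le hq z) (mem_univ _) (mem_univ _)
  simpa using this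

theorem radiusFun_mem_Icc {q : ℕ} (hq : 8 ≤ q) (x : ℝ) : radiusFun q x ∈ Icc (1 / 2) (3 / 2) := by
  obtain ⟨y, hy, hxy⟩ := (radiusFun_periodic hq).exists_mem_Ico (by positivity) x (-π)
  rw [hxy]
  have h0 : radiusFun q 0 = 1 := by simp [radiusFun]
  have h := radiusFun_lipschitz hq 0 y
  rw [h0, sub_zero] at h
  have hy' : |y| ≤ π := abs_le.2 ⟨hy.1, by linarith [hy.2]⟩
  have := abs_le.1 (h.trans (by linarith [pi_lt_d2] : _ ≤ (1 / 2 : ℝ)))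
  constructor <;> linarith

/-- Translation by a half-period of the `k`-th term kills the later terms, doubles the `k`-th one
and barely changes the earlier ones. -/
theorem lacunary_add_half_period {q : ℕ} (hq : 8 ≤ q) (k : ℕ) (x : ℝ) :
    |lacunary q (x + π / 2 ^ (q ^ (k + 1))) - lacunary q x
      + 2 * ((q : ℝ) ^ (k + 1))⁻¹ * sin ((2 : ℝ) ^ (q ^ (k + 1)) * x)|
      ≤ π * (2 ^ (q ^ k) / 2 ^ (q ^ (k + 1))) := by
  set h : ℝ := π / 2 ^ (q ^ (k + 1)) with hh
  set a : ℕ → ℝ := fun j => ((q : ℝ) ^ (j + 1))⁻¹ with ha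
  set N : ℕ → ℝ := fun j => (2 : ℝ) ^ (q ^ (j + 1)) with hN
  have q1 : 1 ≤ q := by omega
  have hNh : N k * h = π := by simp only [hN, hh]; field_simp
  have hs1 := lacunary_summable hq (x + h)
  have hs2 := lacunary_summable hq x
  have hs3 : Summable fun j => if j = k then 2 * a k * sin (N k * x) else 0 :=
    summable_of_ne_finset_zero (s := {k}) (by intro j hj; simp at hj; simp [hj])
  have e : lacunary q (x + h) - lacunary q x + 2 * a k * sin (N k * x)
      = ∑' j, (a j * sin (N j * (x + h)) - a j * sin (N j * x)
        + if j = k then 2 * a k * sin (N k * x) else 0) := by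
    rw [(hs1.sub hs2).tsum_add hs3, hs1.tsum_sub hs2, tsum_ite_eq]
    rfl
  change |lacunary q (x + h) - lacunary q x + 2 * a k * sin (N k * x)| ≤ _
  rw [e]
  have hb : ∀ j, ‖a j * sin (N j * (x + h)) - a j * sin (N j * x)
        + if j = k then 2 * a k * sin (N k * x) else 0‖ ≤ a j * (2 ^ (q ^ k) * h) := by
    intro j
    have haj : 0 ≤ a j := by positivity
    have hh0 : 0 ≤ h := by positivity
    rcases lt_trichotomy j k with hj | hj | hj
    · rw [if_neg hj.ne, add_zero, ← mul_sub, norm_mul, Real.norm_of_nonneg haj]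
      refine mul_le_mul_of_nonneg_left ?_ haj
      have h1 : |sin (N j * (x + h)) - sin (N j * x)| ≤ |N j * (x + h) - N j * x| := by
        have := Real.lipschitzWith_sin.dist_le_mul (N j * (x + h)) (N j * x)
        simpa [Real.dist_eq] using this
      refine h1.trans ?_
      have : N j * (x + h) - N j * x = N j * h := by ring
      rw [this, abs_of_nonneg (by positivity)]
      refine mul_le_mul_of_nonneg_right ?_ hh0
      exact pow_le_pow_right₀ (by norm_num) (Nat.pow_le_pow_right (by omega) (by omega))
    · subst hj
      rw [if_pos rfl, mul_add, hNh, sin_add_pi]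
      have : a j * -sin (N j * x) - a j * sin (N j * x) + 2 * a j * sin (N j * x) = 0 := by ring
      rw [this, norm_zero]
      positivity
    · have : N j * (x + h) = N j * x + ((2 ^ (q ^ (j + 1) - q ^ (k + 1) - 1) : ℕ) : ℝ) * (2 * π) := by
        have hlt : q ^ (k + 1) < q ^ (j + 1) := Nat.pow_lt_pow_right (by omega) (by omega)
        have : N j = 2 ^ (q ^ (j + 1) - q ^ (k + 1) - 1) * 2 * N k := by
          simp only [hN]
          rw [← pow_succ, ← pow_add]
          congr 1
          omega
        rw [mul_add]
        congr 1
        rw [this, mul_assoc, hNh]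
        push_cast
        ring
      rw [if_neg hj.ne', this, sin_add_nat_mul_two_pi]
      simp only [sub_self, add_zero, norm_zero]
      positivity
  have := tsum_of_norm_bounded
    (((lacunary_hasSum_coeff hq).summable.mul_right (2 ^ (q ^ k) * h)).hasSum) hb
  refine this.trans ?_
  rw [tsum_mul_right]
  calc _ ≤ 1 * (2 ^ (q ^ k) * h) := by
        refine mul_le_mul_of_nonneg_right ((lacunary_coeff_tsum_le hq).trans (by norm_num)) ?_
        positivity
    _ = _ := by rw [hh]; ring

section Sobolev

variable {d : ℕ} {V : Type*} [NormedAddCommGroup V] [NormedSpace ℝ V]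
  {Ω : Set (EuclideanSpace ℝ (Fin d))} {i : Fin d} {u u' v v' : EuclideanSpace ℝ (Fin d) → V}
  {σ p : ℝ}

theorem integrableOn_smul_of_tsupport_subset {φ : EuclideanSpace ℝ (Fin d) → ℝ}
    (hu : LocallyIntegrableOn u Ω volume) (hφ : Continuous φ) (hc : HasCompactSupport φ)
    (hs : tsupport φ ⊆ Ω) : IntegrableOn (fun x => φ x • u x) Ω volume := by
  have h1 : IntegrableOn (fun x => φ x • u x) (tsupport φ) volume :=
    (hu.integrableOn_compact_subset hs hc).continuousOn_smul hφ.continuousOn hc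
  have h2 : Integrable (fun x => φ x • u x) volume := by
    rwa [← integrableOn_iff_integrable_of_support_subset]
    intro x hx
    exact subset_tsupport _ (fun h => hx (by simp [h]))
  exact h2.integrableOn

theorem contDiff_fderiv_apply {φ : EuclideanSpace ℝ (Fin d) → V}
    (hφ : ContDiff ℝ ∞ φ) (w : EuclideanSpace ℝ (Fin d)) :
    ContDiff ℝ ∞ (fun x => fderiv ℝ φ x w) :=
  (hφ.fderiv_right (m := ∞) (by simp)).clm_apply contDiff_const

theorem HasWeakPartial.congr (h : HasWeakPartial Ω i u v) (hu : u =ᵐ[volume.restrict Ω] u')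
    (hv : v =ᵐ[volume.restrict Ω] v') : HasWeakPartial Ω i u' v' := by
  refine ⟨h.1.congr hu, h.2.1.congr hv, fun φ h1 h2 h3 => ?_⟩
  have e1 : ∫ x in Ω, (fderiv ℝ φ x (EuclideanSpace.single i 1)) • u' x
      = ∫ x in Ω, (fderiv ℝ φ x (EuclideanSpace.single i 1)) • u x :=
    integral_congr_ae (by filter_upwards [hu] with x hx; rw [hx])
  have e2 : ∫ x in Ω, φ x • v' x = ∫ x in Ω, φ x • v x :=
    integral_congr_ae (by filter_upwards [hv] with x hx; rw [hx])
  rw [e1, e2]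
  exact h.2.2 φ h1 h2 h3

theorem HasWeakPartial.const_smul (c : ℝ) (h : HasWeakPartial Ω i u v) :
    HasWeakPartial Ω i (fun x => c • u x) (fun x => c • v x) := by
  refine ⟨h.1.smul c, h.2.1.smul c, fun φ h1 h2 h3 => ?_⟩
  simp_rw [smul_comm _ c, integral_smul]
  rw [h.2.2 φ h1 h2 h3, smul_neg]

theorem HasWeakPartial.add (h : HasWeakPartial Ω i u v) (h' : HasWeakPartial Ω i u' v') :
    HasWeakPartial Ω i (fun x => u x + u' x) (fun x => v x + v' x) := by
  refine ⟨h.1.add h'.1, h.2.1.add h'.2.1, fun φ h1 h2 h3 => ?_⟩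
  have c1 : Continuous fun x => fderiv ℝ φ x (EuclideanSpace.single i 1) :=
    (contDiff_fderiv_apply h1 _).continuous
  have c2 : HasCompactSupport fun x => fderiv ℝ φ x (EuclideanSpace.single i 1) :=
    h2.mono' (subset_closure.trans (tsupport_fderiv_apply_subset ℝ _))
  have c3 := (tsupport_fderiv_apply_subset ℝ (f := φ) (EuclideanSpace.single i 1)).trans h3
  simp_rw [smul_add]
  rw [integral_add (integrableOn_smul_of_tsupport_subset h.1 c1 c2 c3)
      (integrableOn_smul_of_tsupport_subset h'.1 c1 c2 c3),
    integral_add (integrableOn_smul_of_tsupport_subset h.2.1 h1.continuous h2 h3)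
      (integrableOn_smul_of_tsupport_subset h'.2.1 h1.continuous h2 h3),
    h.2.2 φ h1 h2 h3, h'.2.2 φ h1 h2 h3, neg_add]

theorem HasWeakPartial.neg (h : HasWeakPartial Ω i u v) :
    HasWeakPartial Ω i (fun x => -u x) (fun x => -v x) := by
  simpa using h.const_smul (-1)

theorem HasWeakPartial.ae_unique [CompleteSpace V] (hΩ : IsOpen Ω) (h : HasWeakPartial Ω i u v)
    (h' : HasWeakPartial Ω i u v') : v =ᵐ[volume.restrict Ω] v' := by
  have hsub := h.2.1.sub h'.2.1
  have := hΩ.ae_eq_zero_of_integral_contDiff_smul_eq_zero hsub (fun φ h1 h2 h3 => by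
    have e : ∫ x, φ x • (v - v') x = ∫ x in Ω, φ x • (v - v') x := by
      rw [setIntegral_eq_integral_of_forall_compl_eq_zero]
      intro x hx
      rw [image_eq_zero_of_notMem_tsupport (fun hh => hx (h3 hh)), zero_smul]
    rw [e]
    simp_rw [Pi.sub_apply, smul_sub]
    rw [integral_sub (integrableOn_smul_of_tsupport_subset h.2.1 h1.continuous h2 h3)
      (integrableOn_smul_of_tsupport_subset h'.2.1 h1.continuous h2 h3), sub_eq_zero]
    exact neg_injective ((h.2.2 φ h1 h2 h3).symm.trans (h'.2.2 φ h1 h2 h3)))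
  rw [EventuallyEq, ae_restrict_iff' hΩ.measurableSet]
  filter_upwards [this] with x hx hxΩ
  exact sub_eq_zero.1 (hx hxΩ)

/-- The classical partial derivative is a weak one. -/
theorem hasWeakPartial_fderiv {φ : EuclideanSpace ℝ (Fin d) → V} (hφ : ContDiff ℝ ∞ φ)
    (Ω : Set (EuclideanSpace ℝ (Fin d))) (i : Fin d) :
    HasWeakPartial Ω i φ (fun x => fderiv ℝ φ x (EuclideanSpace.single i 1)) := by
  have c0 := (contDiff_fderiv_apply hφ (EuclideanSpace.single i 1)).continuous
  refine ⟨hφ.continuous.locallyIntegrable.locallyIntegrableOn _,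
    c0.locallyIntegrable.locallyIntegrableOn _, fun ψ h1 h2 h3 => ?_⟩
  have c1 : Continuous fun x => fderiv ℝ ψ x (EuclideanSpace.single i 1) :=
    (contDiff_fderiv_apply h1 _).continuous
  have c2 : HasCompactSupport fun x => fderiv ℝ ψ x (EuclideanSpace.single i 1) :=
    h2.mono' (subset_closure.trans (tsupport_fderiv_apply_subset ℝ _))
  have c3 := (tsupport_fderiv_apply_subset ℝ (f := ψ) (EuclideanSpace.single i 1)).trans h3
  rw [setIntegral_eq_integral_of_forall_compl_eq_zero (fun x hx => by
      rw [image_eq_zero_of_notMem_tsupport (fun hh => hx (c3 hh)), zero_smul]),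
    setIntegral_eq_integral_of_forall_compl_eq_zero (fun x hx => by
      rw [image_eq_zero_of_notMem_tsupport (fun hh => hx (h3 hh)), zero_smul])]
  rw [integral_smul_fderiv_eq_neg_fderiv_smul_of_integrable, neg_neg]
  · exact (c1.smul hφ.continuous).integrable_of_hasCompactSupport c2.smul_right
  · exact (h1.continuous.smul c0).integrable_of_hasCompactSupport h2.smul_right
  · exact (h1.continuous.smul hφ.continuous).integrable_of_hasCompactSupport h2.smul_right
  · exact fun x _ => h1.differentiable (by simp) x
  · exact fun x _ => hφ.differentiable (by simp) x

/-- The difference quotient whose `Lᵖ` norm is the Slobodeckij seminorm. -/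
noncomputable def slobodeckijQuotient (κ : ℝ) (u : EuclideanSpace ℝ (Fin d) → V)
    (z : EuclideanSpace ℝ (Fin d) × EuclideanSpace ℝ (Fin d)) : V :=
  (‖z.1 - z.2‖ ^ κ)⁻¹ • (u z.1 - u z.2)

theorem slobodeckijQuotient_aestronglyMeasurable (κ : ℝ)
    (hu : AEStronglyMeasurable u (volume.restrict Ω)) :
    AEStronglyMeasurable (slobodeckijQuotient κ u)
      ((volume.restrict Ω).prod (volume.restrict Ω)) := by
  refine AEStronglyMeasurable.smul ?_ (hu.comp_fst.sub hu.comp_snd)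
  refine Measurable.aestronglyMeasurable ?_
  fun_prop

theorem slobodeckijQuotient_enorm_rpow (hp : 0 < p)
    (z : EuclideanSpace ℝ (Fin d) × EuclideanSpace ℝ (Fin d)) :
    ‖slobodeckijQuotient (((d : ℝ) + σ * p) / p) u z‖ₑ ^ p
      = ‖u z.1 - u z.2‖ₑ ^ p / ‖z.1 - z.2‖ₑ ^ ((d : ℝ) + σ * p) := by
  by_cases hz : z.1 = z.2
  · simp [slobodeckijQuotient, hz, hp]
  have h0 : 0 < ‖z.1 - z.2‖ := norm_pos_iff.2 (sub_ne_zero.2 hz)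
  rw [slobodeckijQuotient, enorm_smul, ENNReal.mul_rpow_of_nonneg _ _ hp.le, ENNReal.div_eq_inv_mul]
  congr 1
  rw [enorm_inv (by positivity), ENNReal.inv_rpow]
  congr 1
  rw [Real.enorm_of_nonneg (by positivity), ← ENNReal.ofReal_rpow_of_pos h0, ← ENNReal.rpow_mul,
    div_mul_cancel₀ _ hp.ne', ofReal_norm]

theorem slobodeckijSeminorm_eq_eLpNorm (hp : 0 < p)
    (hu : AEStronglyMeasurable u (volume.restrict Ω)) :
    slobodeckijSeminorm Ω σ p u = eLpNorm (slobodeckijQuotient (((d : ℝ) + σ * p) / p) u)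
      (ENNReal.ofReal p) ((volume.restrict Ω).prod (volume.restrict Ω)) := by
  rw [eLpNorm_eq_lintegral_rpow_enorm_toReal (by simpa using hp) (by simp),
    ENNReal.toReal_ofReal hp.le, slobodeckijSeminorm, lintegral_prod]
  · simp_rw [slobodeckijQuotient_enorm_rpow hp]
  · exact (slobodeckijQuotient_aestronglyMeasurable _ hu).enorm.pow_const p

theorem sobolevNormAux_congr (m : ℕ) : ∀ {u u' : EuclideanSpace ℝ (Fin d) → V},
    u =ᵐ[volume.restrict Ω] u' → sobolevNormAux Ω σ p m u = sobolevNormAux Ω σ p m u' := by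
  induction m with
  | zero =>
    intro u u' h
    rw [sobolevNormAux, sobolevNormAux, eLpNorm_congr_ae h]
    congr 2
    rw [slobodeckijSeminorm, slobodeckijSeminorm]
    congr 1
    refine lintegral_congr_ae ?_
    filter_upwards [h] with y hy
    refine lintegral_congr_ae ?_
    filter_upwards [h] with x hx
    rw [hx, hy]
  | succ m ih =>
    intro u u' h
    rw [sobolevNormAux, sobolevNormAux, ih h]
    congr 1
    refine Finset.sum_congr rfl fun i _ => ?_
    refine iInf_congr fun v => iInf_congr_Prop ?_ fun _ => rfl
    exact ⟨fun hh => hh.congr h (ae_eq_refl v), fun hh => hh.congr h.symm (ae_eq_refl v)⟩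

theorem sobolevNormAux_succ_le (m : ℕ) {w : Fin d → EuclideanSpace ℝ (Fin d) → V}
    (hw : ∀ i, HasWeakPartial Ω i u (w i)) : sobolevNormAux Ω σ p (m + 1) u
      ≤ sobolevNormAux Ω σ p m u + ∑ i, sobolevNormAux Ω σ p m (w i) := by
  rw [sobolevNormAux]
  gcongr with i
  exact iInf₂_le _ (hw i)

theorem sobolevNormAux_succ [CompleteSpace V] (hΩ : IsOpen Ω) (m : ℕ)
    {w : Fin d → EuclideanSpace ℝ (Fin d) → V}
    (hw : ∀ i, HasWeakPartial Ω i u (w i)) : sobolevNormAux Ω σ p (m + 1) u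
      = sobolevNormAux Ω σ p m u + ∑ i, sobolevNormAux Ω σ p m (w i) := by
  refine (sobolevNormAux_succ_le m hw).antisymm ?_
  rw [sobolevNormAux]
  gcongr with i
  exact le_iInf₂ fun v hv => (sobolevNormAux_congr m ((hw i).ae_unique hΩ hv)).le

theorem exists_hasWeakPartial_of_sobolevNormAux_succ_lt_top {m : ℕ}
    (h : sobolevNormAux Ω σ p (m + 1) u < ⊤) :
    ∃ w : Fin d → EuclideanSpace ℝ (Fin d) → V, ∀ i, HasWeakPartial Ω i u (w i) ∧
      sobolevNormAux Ω σ p m (w i) < ⊤ := by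
  rw [sobolevNormAux, ENNReal.add_lt_top, ENNReal.sum_lt_top] at h
  have : ∀ i, ∃ w, HasWeakPartial Ω i u w ∧ sobolevNormAux Ω σ p m w < ⊤ := by
    intro i
    have := h.2 i (Finset.mem_univ i)
    simpa [iInf_lt_iff] using this
  choose w hw using this
  exact ⟨w, hw⟩

theorem sobolevNormAux_neg_le (m : ℕ) : ∀ u : EuclideanSpace ℝ (Fin d) → V,
    sobolevNormAux Ω σ p m (fun x => -u x) ≤ sobolevNormAux Ω σ p m u := by
  induction m with
  | zero =>
    intro u
    rw [sobolevNormAux, sobolevNormAux, slobodeckijSeminorm, slobodeckijSeminorm]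
    have e : ∀ y x, ‖-u y - -u x‖ₑ = ‖u y - u x‖ₑ := fun y x => by
      rw [← neg_sub', enorm_neg]
    have e2 : eLpNorm (fun x => -u x) (ENNReal.ofReal p) (volume.restrict Ω)
        = eLpNorm u (ENNReal.ofReal p) (volume.restrict Ω) := eLpNorm_neg u _ _
    simp_rw [e, e2]
    exact le_rfl
  | succ m ih =>
    intro u
    rw [sobolevNormAux, sobolevNormAux]
    refine add_le_add (ih u) (Finset.sum_le_sum fun i _ => ?_)
    refine le_iInf₂ fun v hv => ?_
    exact iInf₂_le_of_le (fun x => -v x) (HasWeakPartial.neg hv) (ih v)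

theorem sobolevNormAux_add_le [CompleteSpace V] (hΩ : IsOpen Ω) (hp : 1 ≤ p)
    (m : ℕ) : ∀ {u u' : EuclideanSpace ℝ (Fin d) → V},
    AEStronglyMeasurable u (volume.restrict Ω) → AEStronglyMeasurable u' (volume.restrict Ω) →
    sobolevNormAux Ω σ p m (fun x => u x + u' x)
      ≤ sobolevNormAux Ω σ p m u + sobolevNormAux Ω σ p m u' := by
  have hp1 : (1 : ℝ≥0∞) ≤ ENNReal.ofReal p := by simpa using hp
  induction m with
  | zero =>
    intro u u' hu hu'
    simp only [sobolevNormAux]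
    have h1 : eLpNorm (fun x => u x + u' x) (ENNReal.ofReal p) (volume.restrict Ω)
      ≤ _ := eLpNorm_add_le hu hu' hp1
    split_ifs with h
    · simpa using h1
    · have hp0 : 0 < p := by linarith
      rw [slobodeckijSeminorm_eq_eLpNorm hp0 hu, slobodeckijSeminorm_eq_eLpNorm hp0 hu',
        slobodeckijSeminorm_eq_eLpNorm hp0 (u := fun x => u x + u' x) (hu.add hu'), add_add_add_comm]
      refine add_le_add h1 ?_
      have := eLpNorm_add_le (slobodeckijQuotient_aestronglyMeasurable (((d : ℝ) + σ * p) / p) hu)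
        (slobodeckijQuotient_aestronglyMeasurable (((d : ℝ) + σ * p) / p) hu') hp1
      refine le_trans (le_of_eq ?_) this
      congr 1
      ext z
      simp only [slobodeckijQuotient, Pi.add_apply, ← smul_add]
      congr 1
      abel
  | succ m ih =>
    intro u u' hu hu'
    rcases eq_or_lt_of_le (le_top (a := sobolevNormAux Ω σ p (m + 1) u)) with ht | ht
    · simp [ht]
    rcases eq_or_lt_of_le (le_top (a := sobolevNormAux Ω σ p (m + 1) u')) with ht' | ht'
    · simp [ht']
    obtain ⟨w, hw⟩ := exists_hasWeakPartial_of_sobolevNormAux_succ_lt_top ht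
    obtain ⟨w', hw'⟩ := exists_hasWeakPartial_of_sobolevNormAux_succ_lt_top ht'
    rw [sobolevNormAux_succ hΩ m (fun i => (hw i).1), sobolevNormAux_succ hΩ m (fun i => (hw' i).1),
      add_add_add_comm, ← Finset.sum_add_distrib]
    refine (sobolevNormAux_succ_le m (fun i => (hw i).1.add (hw' i).1)).trans ?_
    gcongr with i
    · exact ih hu hu'
    · exact ih ((hw i).1.2.1.aestronglyMeasurable) ((hw' i).1.2.1.aestronglyMeasurable)

theorem eLpNorm_le_sobolevNormAux (m : ℕ) (u : EuclideanSpace ℝ (Fin d) → V) :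
    eLpNorm u (ENNReal.ofReal p) (volume.restrict Ω) ≤ sobolevNormAux Ω σ p m u := by
  induction m with
  | zero => exact le_self_add
  | succ m ih => exact ih.trans le_self_add

theorem sobolevNormAux_mono {m n : ℕ} (h : m ≤ n) (u : EuclideanSpace ℝ (Fin d) → V) :
    sobolevNormAux Ω σ p m u ≤ sobolevNormAux Ω σ p n u := by
  induction n, h using Nat.le_induction with
  | base => exact le_rfl
  | succ n _ ih => exact ih.trans le_self_add

end Sobolev

theorem eLpNorm_ofReal_exponent {X V : Type*} [MeasurableSpace X] [NormedAddCommGroup V] {p : ℝ}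
    (hp : 0 < p) (f : X → V) (μ : Measure X) :
    eLpNorm f (ENNReal.ofReal p) μ = (∫⁻ x, ‖f x‖ₑ ^ p ∂μ) ^ (1 / p) := by
  rw [eLpNorm_eq_lintegral_rpow_enorm_toReal (by simpa using hp) (by simp),
    ENNReal.toReal_ofReal hp.le]

theorem eLpNorm_ofReal_exponent_rpow {X V : Type*} [MeasurableSpace X] [NormedAddCommGroup V] {p : ℝ}
    (hp : 0 < p) (f : X → V) (μ : Measure X) :
    eLpNorm f (ENNReal.ofReal p) μ ^ p = ∫⁻ x, ‖f x‖ₑ ^ p ∂μ := by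
  rw [eLpNorm_ofReal_exponent hp, ← ENNReal.rpow_mul, one_div_mul_cancel hp.ne', ENNReal.rpow_one]

section Means

variable {E V Z : Type*} [NormedAddCommGroup E] [NormedSpace ℝ E] [FiniteDimensional ℝ E]
  [MeasurableSpace E] [BorelSpace E] {μ : Measure E} [μ.IsAddHaarMeasure]
  [NormedAddCommGroup V] [MeasurableSpace Z]

theorem map_smul_sub_eq {a : ℝ} (ha : a ≠ 0) (z : E) :
    Measure.map (fun x => a • x - z) μ
      = ENNReal.ofReal |(a ^ Module.finrank ℝ E)⁻¹| • μ := by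
  have h1 : (fun x => a • x - z) = (fun x => x - z) ∘ (fun x => a • x) := rfl
  rw [h1, ← Measure.map_map (by fun_prop) (by fun_prop), Measure.map_addHaar_smul μ ha,
    Measure.map_smul, (measurePreserving_sub_right μ z).map_eq]

theorem quasiMeasurePreserving_smul_sub {a : ℝ} (ha : a ≠ 0) (z : E) :
    Measure.QuasiMeasurePreserving (fun x => a • x - z) μ μ := by
  refine ⟨by fun_prop, ?_⟩
  rw [map_smul_sub_eq ha z]
  exact Measure.smul_absolutelyContinuous

theorem eLpNorm_comp_smul_sub_le {U : E → V} {p : ℝ} (hp : 1 ≤ p) (hU : AEStronglyMeasurable U μ)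
    {a : ℝ} (ha : 1 / 2 ≤ a) (z : E) :
    eLpNorm (fun x => U (a • x - z)) (ENNReal.ofReal p) μ
      ≤ (2 : ℝ≥0∞) ^ Module.finrank ℝ E * eLpNorm U (ENNReal.ofReal p) μ := by
  have ha0 : a ≠ 0 := by linarith
  have hm : Measurable (fun x : E => a • x - z) := by fun_prop
  have h1 : AEStronglyMeasurable U (Measure.map (fun x => a • x - z) μ) := by
    rw [map_smul_sub_eq ha0 z]
    exact hU.smul_measure _
  have h2 := eLpNorm_map_measure (p := ENNReal.ofReal p) h1 hm.aemeasurable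
  rw [map_smul_sub_eq ha0 z, eLpNorm_smul_measure_of_ne_top (by simp)] at h2
  change eLpNorm (U ∘ fun x => a • x - z) _ _ ≤ _
  rw [← h2, smul_eq_mul]
  gcongr
  have hb : |(a ^ Module.finrank ℝ E)⁻¹| ≤ 2 ^ Module.finrank ℝ E := by
    rw [abs_of_nonneg (by positivity), ← inv_pow]
    refine pow_le_pow_left₀ (by positivity) ?_ _
    rw [inv_le_comm₀ (by linarith) (by norm_num)]
    linarith
  have hb' : ENNReal.ofReal |(a ^ Module.finrank ℝ E)⁻¹| ≤ 2 ^ Module.finrank ℝ E := by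
    refine (ENNReal.ofReal_le_ofReal hb).trans ?_
    rw [ENNReal.ofReal_pow (by norm_num)]
    simp
  have hone : (1 : ℝ≥0∞) ≤ 2 ^ Module.finrank ℝ E := one_le_pow₀ (by norm_num)
  refine (ENNReal.rpow_le_rpow hb' (by positivity)).trans ?_
  refine (ENNReal.rpow_le_rpow_of_exponent_le hone ?_).trans (ENNReal.rpow_one _).le
  rw [ENNReal.toReal_div, ENNReal.toReal_ofReal (by linarith)]
  simpa using inv_le_one_of_one_le₀ hp

/-- Continuity of dilations and translations on `C_c`, in the `Lᵖ` norm. -/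
theorem exists_eLpNorm_comp_smul_sub_sub_le_of_hasCompactSupport {g : E → V} (p : ℝ≥0∞)
    (hg : Continuous g) (hc : HasCompactSupport g) {ε : ℝ≥0∞} (hε : ε ≠ 0) :
    ∃ η : ℝ, 0 < η ∧ η ≤ 1 / 2 ∧ ∀ (a : ℝ) (z : E), |a - 1| < η → ‖z‖ < η →
      eLpNorm (fun x => g (a • x - z) - g x) p μ ≤ ε := by
  obtain ⟨R, hR0, hR⟩ : ∃ R : ℝ, 0 ≤ R ∧ tsupport g ⊆ Metric.closedBall 0 R := by
    obtain ⟨R, hR⟩ := hc.isCompact.isBounded.subset_closedBall 0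
    exact ⟨max R 0, le_max_right _ _, hR.trans (Metric.closedBall_subset_closedBall (le_max_left _ _))⟩
  have huc := hc.uniformContinuous_of_continuous hg
  set K := Metric.closedBall (0 : E) (2 * R + 2) with hK
  have hKfin : μ K < ⊤ := measure_closedBall_lt_top
  set M := μ K ^ p.toReal⁻¹ with hM
  have hMfin : M ≠ ⊤ := (ENNReal.rpow_lt_top_of_nonneg (by positivity) hKfin.ne).ne
  obtain ⟨δ, hδ0, hδ⟩ : ∃ δ : ℝ, 0 < δ ∧ M * ENNReal.ofReal δ ≤ ε := by
    rcases eq_or_ne ε ⊤ with h | h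
    · exact ⟨1, one_pos, by simp [h]⟩
    have hpos : 0 < ε.toReal := ENNReal.toReal_pos hε h
    refine ⟨ε.toReal / (M.toReal + 1), by positivity, ?_⟩
    rw [← ENNReal.ofReal_toReal hMfin, ← ENNReal.ofReal_mul (by positivity),
      ENNReal.toReal_ofReal (by positivity)]
    refine (ENNReal.ofReal_le_ofReal ?_).trans (ENNReal.ofReal_toReal h).le
    rw [mul_div_assoc', div_le_iff₀ (by positivity)]
    nlinarith [ENNReal.toReal_nonneg (a := M)]
  obtain ⟨r, hr0, hr⟩ := Metric.uniformContinuous_iff.1 huc δ hδ0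
  refine ⟨min (1 / 2) (r / (2 * R + 4)), by positivity, min_le_left _ _, fun a z ha hz => ?_⟩
  have ha1 : |a - 1| < 1 / 2 := ha.trans_le (min_le_left _ _)
  have ha2 : |a - 1| < r / (2 * R + 4) := ha.trans_le (min_le_right _ _)
  have hz1 : ‖z‖ < 1 / 2 := hz.trans_le (min_le_left _ _)
  have hz2 : ‖z‖ < r / (2 * R + 4) := hz.trans_le (min_le_right _ _)
  have hsupp : ∀ x, x ∉ K → g (a • x - z) - g x = 0 := by
    intro x hx
    have hx' : 2 * R + 2 < ‖x‖ := by simpa [hK] using hx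
    have ha3 := abs_lt.1 ha1
    have e1 : g x = 0 := by
      refine image_eq_zero_of_notMem_tsupport fun h => ?_
      have := hR h
      simp only [Metric.mem_closedBall, dist_zero_right] at this
      linarith
    have e2 : g (a • x - z) = 0 := by
      refine image_eq_zero_of_notMem_tsupport fun h => ?_
      have := hR h
      simp only [Metric.mem_closedBall, dist_zero_right] at this
      have h3 := norm_sub_norm_le (a • x) z
      rw [norm_smul, Real.norm_of_nonneg (by linarith)] at h3
      nlinarith
    rw [e1, e2, sub_zero]
  have e : (fun x => g (a • x - z) - g x) = K.indicator (fun x => g (a • x - z) - g x) := by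
    ext x
    by_cases hx : x ∈ K
    · rw [indicator_of_mem hx]
    · rw [indicator_of_notMem hx, hsupp x hx]
  rw [e, eLpNorm_indicator_eq_eLpNorm_restrict measurableSet_closedBall]
  refine (eLpNorm_le_of_ae_bound (C := δ) ?_).trans ?_
  · refine (ae_restrict_iff' measurableSet_closedBall).2 (Eventually.of_forall fun x hx => ?_)
    have hx' : ‖x‖ ≤ 2 * R + 2 := by simpa [hK] using hx
    rw [← dist_eq_norm]
    refine (hr ?_).le
    rw [dist_eq_norm]
    have : a • x - z - x = (a - 1) • x - z := by rw [sub_smul, one_smul]; abel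
    rw [this]
    refine (norm_sub_le _ _).trans_lt ?_
    rw [norm_smul, Real.norm_eq_abs]
    calc |a - 1| * ‖x‖ + ‖z‖ ≤ |a - 1| * (2 * R + 2) + ‖z‖ := by gcongr
      _ < r / (2 * R + 4) * (2 * R + 2) + r / (2 * R + 4) := by
        have := mul_lt_mul_of_pos_right ha2 (by linarith : 0 < 2 * R + 2)
        linarith
      _ ≤ r := by
        rw [← mul_add_one, div_mul_eq_mul_div, div_le_iff₀ (by linarith)]
        nlinarith
  · rw [Measure.restrict_apply_univ]
    exact hδ

variable [NormedSpace ℝ V]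

/-- Continuity of dilations and translations in `Lᵖ`. -/
theorem exists_eLpNorm_comp_smul_sub_sub_le {U : E → V} {p : ℝ} (hp : 1 ≤ p)
    (hU : MemLp U (ENNReal.ofReal p) μ) {ε : ℝ≥0∞} (hε : ε ≠ 0) :
    ∃ η : ℝ, 0 < η ∧ η ≤ 1 / 2 ∧ ∀ (a : ℝ) (z : E), |a - 1| < η → ‖z‖ < η →
      eLpNorm (fun x => U (a • x - z) - U x) (ENNReal.ofReal p) μ ≤ ε := by
  have hp1 : (1 : ℝ≥0∞) ≤ ENNReal.ofReal p := by simpa using hp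
  set K : ℝ≥0∞ := (2 : ℝ≥0∞) ^ Module.finrank ℝ E + 2 with hK
  have hKt : K ≠ ⊤ := by simp [hK]
  have hK0 : K ≠ 0 := by simp [hK]
  have hεK : ε / K ≠ 0 := by simp [hε, hKt]
  obtain ⟨g, hgc, hgU, hg, hgm⟩ := hU.exists_hasCompactSupport_eLpNorm_sub_le (by simp) hεK
  obtain ⟨η, h0, h1, h⟩ := exists_eLpNorm_comp_smul_sub_sub_le_of_hasCompactSupport
    (μ := μ) (ENNReal.ofReal p) hg hgc hεK
  refine ⟨η, h0, h1, fun a z ha hz => ?_⟩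
  have ha2 : 1 / 2 ≤ a := by have := abs_lt.1 ha; linarith
  have hq := quasiMeasurePreserving_smul_sub (μ := μ) (by linarith : a ≠ 0) z
  have hd : AEStronglyMeasurable (U - g) μ := hU.1.sub hgm.1
  have hd' : AEStronglyMeasurable (fun x => (U - g) (a • x - z)) μ :=
    hd.comp_quasiMeasurePreserving hq
  have hg' : AEStronglyMeasurable (fun x => g (a • x - z) - g x) μ :=
    (Continuous.aestronglyMeasurable (by fun_prop)).sub hgm.1
  have e : (fun x => U (a • x - z) - U x)
      = ((fun x => (U - g) (a • x - z)) + fun x => g (a • x - z) - g x) - (U - g) := by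
    ext x
    simp only [Pi.sub_apply, Pi.add_apply]
    abel
  rw [e]
  calc _ ≤ _ := eLpNorm_sub_le (hd'.add hg') hd hp1
    _ ≤ _ := add_le_add_left (eLpNorm_add_le hd' hg' hp1) _
    _ ≤ (2 : ℝ≥0∞) ^ Module.finrank ℝ E * (ε / K) + ε / K + ε / K := by
      gcongr
      · exact (eLpNorm_comp_smul_sub_le hp hd ha2 z).trans (by gcongr)
      · exact h a z ha hz
    _ = K * (ε / K) := by rw [hK]; ring
    _ ≤ ε := ENNReal.mul_div_le

/-- Minkowski's inequality for means: the `Lᵖ` norm of a mean is at most the supremum of the `Lᵖ`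
norms. -/
theorem eLpNorm_integral_le_of_forall {X : Type*} [MeasurableSpace X] {μ : Measure X} [SFinite μ]
    {ν : Measure Z} [IsProbabilityMeasure ν] {W : X → Z → V} {p : ℝ} (hp : 1 ≤ p) {ε : ℝ≥0∞}
    (hε : ε ≠ ⊤) (hW : AEStronglyMeasurable (Function.uncurry W) (μ.prod ν))
    (h : ∀ᵐ z ∂ν, eLpNorm (fun x => W x z) (ENNReal.ofReal p) μ ≤ ε) :
    eLpNorm (fun x => ∫ z, W x z ∂ν) (ENNReal.ofReal p) μ ≤ ε ∧
      ∀ᵐ x ∂μ, Integrable (W x) ν := by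
  have hp0 : 0 < p := by linarith
  have hp1 : (1 : ℝ≥0∞) ≤ ENNReal.ofReal p := by simpa using hp
  have hm : AEMeasurable (Function.uncurry fun x z => ‖W x z‖ₑ ^ p) (μ.prod ν) :=
    hW.enorm.pow_const p
  have hI : ∫⁻ x, ∫⁻ z, ‖W x z‖ₑ ^ p ∂ν ∂μ ≤ ε ^ p := by
    rw [lintegral_lintegral_swap hm]
    calc _ ≤ ∫⁻ _, ε ^ p ∂ν := by
          refine lintegral_mono_ae ?_
          filter_upwards [h] with z hz
          have hz' := ENNReal.rpow_le_rpow hz hp0.le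
          rwa [eLpNorm_ofReal_exponent_rpow hp0] at hz'
      _ = ε ^ p := by simp
  have hm' : AEMeasurable (fun x => ∫⁻ z, ‖W x z‖ₑ ^ p ∂ν) μ := hm.lintegral_prod_right'
  have hfin : ∀ᵐ x ∂μ, ∫⁻ z, ‖W x z‖ₑ ^ p ∂ν < ⊤ :=
    ae_lt_top' hm' (hI.trans_lt (ENNReal.rpow_lt_top_of_nonneg hp0.le hε)).ne
  have hmem : ∀ᵐ x ∂μ, MemLp (W x) (ENNReal.ofReal p) ν := by
    filter_upwards [hfin, hW.prodMk_left] with x hx hx'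
    refine ⟨hx', ?_⟩
    rw [eLpNorm_ofReal_exponent hp0]
    exact ENNReal.rpow_lt_top_of_nonneg (by positivity) hx.ne
  refine ⟨?_, hmem.mono fun x hx => hx.integrable hp1⟩
  rw [eLpNorm_ofReal_exponent hp0]
  calc _ ≤ (ε ^ p) ^ (1 / p) := by
        refine ENNReal.rpow_le_rpow (le_trans ?_ hI) (by positivity)
        refine lintegral_mono_ae ?_
        filter_upwards [hmem] with x hx
        have h1 : ‖∫ z, W x z ∂ν‖ₑ ≤ eLpNorm (W x) 1 ν := by
          rw [eLpNorm_one_eq_lintegral_enorm]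
          exact enorm_integral_le_lintegral_enorm _
        have h2 := ENNReal.rpow_le_rpow
          (h1.trans (eLpNorm_le_eLpNorm_of_exponent_le hp1 hx.1)) hp0.le
        rwa [eLpNorm_ofReal_exponent_rpow hp0] at h2
    _ = ε := by rw [← ENNReal.rpow_mul, mul_one_div_cancel hp0.ne', ENNReal.rpow_one]

/-- Means of dilated and translated copies of `U ∈ Lᵖ` tend to `U`. -/
theorem tendsto_eLpNorm_mean_sub [NormedAddCommGroup Z] [NormedSpace ℝ Z] [CompleteSpace V]
    [BorelSpace Z] {U : E → V} {p : ℝ} (hp : 1 ≤ p)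
    (hU : MemLp U (ENNReal.ofReal p) μ) (J : Z →L[ℝ] E) {ν : ℕ → Measure Z}
    [∀ n, IsProbabilityMeasure (ν n)] {a c r : ℕ → ℝ} (ha : Tendsto a atTop (𝓝 1))
    (hc : Tendsto c atTop (𝓝 1)) (hr : Tendsto r atTop (𝓝 0))
    (hν : ∀ n, ∀ᵐ z ∂ν n, ‖z‖ ≤ r n) :
    Tendsto (fun n => eLpNorm (fun x => c n • ∫ z, U (a n • x - J z) ∂ν n - U x)
      (ENNReal.ofReal p) μ) atTop (𝓝 0) := by
  have hp1 : (1 : ℝ≥0∞) ≤ ENNReal.ofReal p := by simpa using hp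
  have key : Tendsto (fun n => eLpNorm (fun x => ∫ z, (U (a n • x - J z) - U x) ∂ν n)
      (ENNReal.ofReal p) μ) atTop (𝓝 0) ∧ ∀ᶠ n in atTop, a n ≠ 0 ∧
        ∀ᵐ x ∂μ, Integrable (fun z => U (a n • x - J z) - U x) (ν n) := by
    have main : ∀ ε : ℝ≥0∞, ε ≠ 0 → ε ≠ ⊤ → ∀ᶠ n in atTop, a n ≠ 0 ∧
        eLpNorm (fun x => ∫ z, (U (a n • x - J z) - U x) ∂ν n) (ENNReal.ofReal p) μ ≤ ε ∧
        ∀ᵐ x ∂μ, Integrable (fun z => U (a n • x - J z) - U x) (ν n) := by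
      intro ε hε hεt
      obtain ⟨η, h0, h1, h⟩ := exists_eLpNorm_comp_smul_sub_sub_le hp hU hε
      have hJ : Tendsto (fun n => ‖J‖ * r n) atTop (𝓝 0) := by simpa using hr.const_mul ‖J‖
      filter_upwards [ha (Metric.ball_mem_nhds 1 h0), hJ (Iio_mem_nhds h0)] with n hn hn'
      have hn1 : |a n - 1| < η := hn
      have hn2 : ‖J‖ * r n < η := hn'
      have han : a n ≠ 0 := by
        have := abs_lt.1 hn1
        linarith
      refine ⟨han, eLpNorm_integral_le_of_forall hp hεt ?_ ?_⟩
      · have hmap : Measurable fun q : E × Z => a n • q.1 - J q.2 := by fun_prop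
        have hq : Measure.QuasiMeasurePreserving (fun q : E × Z => a n • q.1 - J q.2)
            (μ.prod (ν n)) μ :=
          QuasiMeasurePreserving.prod_of_left hmap
            (Eventually.of_forall fun z => quasiMeasurePreserving_smul_sub han (J z))
        exact (hU.1.comp_quasiMeasurePreserving hq).sub hU.1.comp_fst
      · filter_upwards [hν n] with z hz
        refine h _ _ hn1 (((J.le_opNorm z).trans ?_).trans_lt hn2)
        gcongr
    refine ⟨?_, (main 1 one_ne_zero ENNReal.one_ne_top).mono fun n hn => ⟨hn.1, hn.2.2⟩⟩
    rw [ENNReal.tendsto_atTop_zero]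
    intro ε hε
    rcases eq_or_ne ε ⊤ with h | h
    · exact ⟨0, fun n _ => by simp [h]⟩
    obtain ⟨N, hN⟩ := eventually_atTop.1 (main ε hε.ne' h)
    exact ⟨N, fun n hn => (hN n hn).2.1⟩
  have hlim : Tendsto (fun n => ‖c n‖ₑ * eLpNorm (fun x => ∫ z, (U (a n • x - J z) - U x) ∂ν n)
      (ENNReal.ofReal p) μ + ‖c n - 1‖ₑ * eLpNorm U (ENNReal.ofReal p) μ) atTop (𝓝 0) := by
    have h1 : Tendsto (fun n => ‖c n‖ₑ) atTop (𝓝 1) := by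
      simpa using hc.enorm
    have h2 : Tendsto (fun n => ‖c n - 1‖ₑ) atTop (𝓝 0) := by
      simpa using (hc.sub_const 1).enorm
    have h3 := ENNReal.Tendsto.mul h1 (Or.inl one_ne_zero) key.1 (Or.inr ENNReal.one_ne_top)
    have h4 := ENNReal.Tendsto.mul_const (b := eLpNorm U (ENNReal.ofReal p) μ) h2
      (Or.inr hU.2.ne)
    simpa using h3.add h4
  refine tendsto_of_tendsto_of_tendsto_of_le_of_le' tendsto_const_nhds hlim
    (Eventually.of_forall fun _ => zero_le) ?_
  filter_upwards [key.2] with n hn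
  have e : (fun x => c n • ∫ z, U (a n • x - J z) ∂ν n - U x) =ᵐ[μ]
      (c n • fun x => ∫ z, (U (a n • x - J z) - U x) ∂ν n) + (c n - 1) • U := by
    filter_upwards [hn.2] with x hx
    have hi : Integrable (fun z => U (a n • x - J z)) (ν n) := by
      simpa [Pi.add_def] using hx.add (integrable_const (U x))
    simp only [Pi.add_apply, Pi.smul_apply]
    rw [integral_sub hi (integrable_const _), integral_const, probReal_univ, one_smul, smul_sub,
      sub_smul, one_smul]
    abel
  rw [eLpNorm_congr_ae e]
  have hmeas : AEStronglyMeasurable (fun x => ∫ z, (U (a n • x - J z) - U x) ∂ν n) μ := by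
    have hmap : Measurable fun q : E × Z => a n • q.1 - J q.2 := by fun_prop
    have hq : Measure.QuasiMeasurePreserving (fun q : E × Z => a n • q.1 - J q.2)
        (μ.prod (ν n)) μ :=
      QuasiMeasurePreserving.prod_of_left hmap
        (Eventually.of_forall fun z => quasiMeasurePreserving_smul_sub hn.1 (J z))
    exact ((hU.1.comp_quasiMeasurePreserving hq).sub hU.1.comp_fst).integral_prod_right'
  refine (eLpNorm_add_le (hmeas.const_smul _) (hU.1.const_smul _) hp1).trans ?_
  rw [eLpNorm_const_smul, eLpNorm_const_smul]

end Means

section Mollify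

variable {d : ℕ} {V : Type*} [NormedAddCommGroup V] [NormedSpace ℝ V]
  {Ω : Set (EuclideanSpace ℝ (Fin d))} {i : Fin d} {u v : EuclideanSpace ℝ (Fin d) → V}
  {σ p : ℝ}

/-- The mollification of the extension of `u` by zero outside `Ω`, dilated by the factor `a`. -/
noncomputable def mollify (Ω : Set (EuclideanSpace ℝ (Fin d))) (a : ℝ)
    (ψ : ContDiffBump (0 : EuclideanSpace ℝ (Fin d))) (u : EuclideanSpace ℝ (Fin d) → V)
    (x : EuclideanSpace ℝ (Fin d)) : V :=
  convolution (ψ.normed volume) (Ω.indicator u) (ContinuousLinearMap.lsmul ℝ ℝ) volume (a • x)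

theorem mollify_contDiff (hΩ : IsOpen Ω) (hu : IntegrableOn u Ω volume) (a : ℝ)
    (ψ : ContDiffBump (0 : EuclideanSpace ℝ (Fin d))) : ContDiff ℝ ∞ (mollify Ω a ψ u) := by
  have h1 : LocallyIntegrable (Ω.indicator u) volume :=
    (hu.integrable_indicator hΩ.measurableSet).locallyIntegrable
  have h2 := ψ.hasCompactSupport_normed.contDiff_convolution_left (n := ⊤)
    (ContinuousLinearMap.lsmul ℝ ℝ) (μ := volume) (ψ.contDiff_normed (μ := volume)) h1
  exact h2.comp (contDiff_const_smul a)

/-- The probability measure with density `ψ / ∫ ψ`. -/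
noncomputable def bumpMeasure (ψ : ContDiffBump (0 : EuclideanSpace ℝ (Fin d))) :
    Measure (EuclideanSpace ℝ (Fin d)) :=
  volume.withDensity fun z => ENNReal.ofReal (ψ.normed volume z)

theorem bumpMeasure_measurable_density (ψ : ContDiffBump (0 : EuclideanSpace ℝ (Fin d))) :
    Measurable fun z => ENNReal.ofReal (ψ.normed volume z) :=
  (ψ.continuous_normed (μ := volume)).measurable.ennreal_ofReal

instance bumpMeasure_isProbabilityMeasure (ψ : ContDiffBump (0 : EuclideanSpace ℝ (Fin d))) :
    IsProbabilityMeasure (bumpMeasure ψ) := by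
  refine ⟨?_⟩
  rw [bumpMeasure, withDensity_apply _ MeasurableSet.univ, Measure.restrict_univ,
    ← ofReal_integral_eq_lintegral_ofReal (ψ.integrable_normed)
      (Eventually.of_forall ψ.nonneg_normed), ψ.integral_normed, ENNReal.ofReal_one]

theorem integral_bumpMeasure (ψ : ContDiffBump (0 : EuclideanSpace ℝ (Fin d)))
    (g : EuclideanSpace ℝ (Fin d) → V) :
    ∫ z, g z ∂(bumpMeasure ψ) = ∫ z, ψ.normed volume z • g z := by
  rw [bumpMeasure, integral_withDensity_eq_integral_toReal_smul (bumpMeasure_measurable_density ψ)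
    (by simp)]
  simp_rw [ENNReal.toReal_ofReal (ψ.nonneg_normed _)]

theorem integrable_bumpMeasure (ψ : ContDiffBump (0 : EuclideanSpace ℝ (Fin d)))
    {g : EuclideanSpace ℝ (Fin d) → V} (hg : Integrable g volume) :
    Integrable g (bumpMeasure ψ) := by
  rw [bumpMeasure, integrable_withDensity_iff_integrable_smul' (bumpMeasure_measurable_density ψ)
    (by simp)]
  simp_rw [ENNReal.toReal_ofReal (ψ.nonneg_normed _)]
  exact hg.locallyIntegrable.integrable_smul_left_of_hasCompactSupport
    (ψ.continuous_normed) ψ.hasCompactSupport_normed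

theorem ae_bumpMeasure_norm_le (ψ : ContDiffBump (0 : EuclideanSpace ℝ (Fin d))) :
    ∀ᵐ z ∂(bumpMeasure ψ), ‖z‖ ≤ ψ.rOut := by
  rw [bumpMeasure, ae_withDensity_iff (bumpMeasure_measurable_density ψ)]
  refine Eventually.of_forall fun z hz => ?_
  by_contra hlt
  refine hz ?_
  have : z ∉ Function.support (ψ.normed volume) := by
    rw [ψ.support_normed_eq]
    simp only [Metric.mem_ball, dist_zero_right]
    linarith
  rw [Function.notMem_support.1 this, ENNReal.ofReal_zero]

theorem mollify_eq_integral (a : ℝ) (ψ : ContDiffBump (0 : EuclideanSpace ℝ (Fin d)))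
    (u : EuclideanSpace ℝ (Fin d) → V) (x : EuclideanSpace ℝ (Fin d)) :
    mollify Ω a ψ u x = ∫ z, Ω.indicator u (a • x - z) ∂(bumpMeasure ψ) := by
  rw [integral_bumpMeasure]
  rfl

theorem fderiv_mollify (hΩ : IsOpen Ω) (hu : IntegrableOn u Ω volume)
    (h : HasWeakPartial Ω i u v) {a : ℝ} {ψ : ContDiffBump (0 : EuclideanSpace ℝ (Fin d))}
    {x : EuclideanSpace ℝ (Fin d)} (hx : Metric.closedBall (a • x) ψ.rOut ⊆ Ω) :
    fderiv ℝ (mollify Ω a ψ u) x (EuclideanSpace.single i 1) = a • mollify Ω a ψ v x := by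
  set e : EuclideanSpace ℝ (Fin d) := EuclideanSpace.single i 1
  set ρ := ψ.normed volume with hρ
  have hρs : ContDiff ℝ ∞ ρ := ψ.contDiff_normed
  have hρc : HasCompactSupport ρ := ψ.hasCompactSupport_normed
  have hui : Integrable (Ω.indicator u) volume := hu.integrable_indicator hΩ.measurableSet
  have hd := hρc.hasFDerivAt_convolution_left (ContinuousLinearMap.lsmul ℝ ℝ)
    (μ := volume) (hρs.of_le (by simp)) hui.locallyIntegrable (a • x)
  have hd2 : HasFDerivAt (mollify Ω a ψ u) _ x :=
    hd.comp x ((hasFDerivAt_id x).const_smul a)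
  rw [hd2.fderiv]
  set φ : EuclideanSpace ℝ (Fin d) → ℝ := fun y => ρ (a • x - y) with hφ
  have hφs : ContDiff ℝ ∞ φ := hρs.comp (contDiff_const.sub contDiff_id)
  have hφt : tsupport φ ⊆ Metric.closedBall (a • x) ψ.rOut := by
    refine closure_minimal (fun y hy => ?_) Metric.isClosed_closedBall
    have : a • x - y ∈ Function.support ρ := hy
    rw [hρ, ψ.support_normed_eq] at this
    simp only [Metric.mem_ball, dist_zero_right] at this
    rw [Metric.mem_closedBall, dist_comm, dist_eq_norm]
    exact this.le
  have hφc : HasCompactSupport φ :=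
    (isCompact_closedBall _ _).of_isClosed_subset (isClosed_tsupport _) hφt
  have hw : ∫ y in Ω, fderiv ℝ φ y e • u y = -∫ y in Ω, φ y • v y :=
    h.2.2 φ hφs hφc (hφt.trans hx)
  have hφd : ∀ y, fderiv ℝ φ y e = -fderiv ℝ ρ (a • x - y) e := by
    intro y
    have h1 : HasFDerivAt φ _ y :=
      (hρs.differentiable (by simp) (a • x - y)).hasFDerivAt.comp y
        ((hasFDerivAt_const (a • x) y).sub (hasFDerivAt_id y))
    rw [h1.fderiv]
    simp
  have e1 : (convolution (fderiv ℝ ρ) (Ω.indicator u)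
      ((ContinuousLinearMap.lsmul ℝ ℝ).precompL (EuclideanSpace ℝ (Fin d))) volume (a • x)) e
      = ∫ y in Ω, fderiv ℝ ρ (a • x - y) e • u y := by
    have hint : ConvolutionExistsAt (fderiv ℝ ρ) (Ω.indicator u) (a • x)
        ((ContinuousLinearMap.lsmul ℝ ℝ).precompL (EuclideanSpace ℝ (Fin d))) volume :=
      (hρc.fderiv ℝ).convolutionExists_left _ (hρs.continuous_fderiv (by simp))
        hui.locallyIntegrable _
    rw [convolution_eq_swap, ContinuousLinearMap.integral_apply hint.integrable_swap,
      ← integral_indicator hΩ.measurableSet]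
    congr 1
    ext y
    by_cases hy : y ∈ Ω
    · simp [hy, ContinuousLinearMap.precompL_apply]
    · simp [hy]
  have e2 : mollify Ω a ψ v x = ∫ y in Ω, φ y • v y := by
    rw [mollify, convolution_eq_swap, ← integral_indicator hΩ.measurableSet]
    congr 1
    ext y
    by_cases hy : y ∈ Ω
    · simp [hy, hφ, hρ]
    · simp [hy]
  rw [e2]
  simp_rw [hφd, neg_smul, integral_neg] at hw
  have hw' := neg_injective hw
  rw [← hw', ← e1]
  simp

theorem hasWeakPartial_mollify (hΩ : IsOpen Ω) (hu : IntegrableOn u Ω volume)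
    (h : HasWeakPartial Ω i u v) {a : ℝ} {ψ : ContDiffBump (0 : EuclideanSpace ℝ (Fin d))}
    (hx : ∀ x ∈ Ω, Metric.closedBall (a • x) ψ.rOut ⊆ Ω) :
    HasWeakPartial Ω i (mollify Ω a ψ u) (fun x => a • mollify Ω a ψ v x) := by
  refine (hasWeakPartial_fderiv (mollify_contDiff hΩ hu a ψ) Ω i).congr (ae_eq_refl _) ?_
  refine (ae_restrict_iff' hΩ.measurableSet).2 (Eventually.of_forall fun x hxΩ => ?_)
  exact fderiv_mollify hΩ hu h (hx x hxΩ)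

variable [CompleteSpace V] {a : ℕ → ℝ} {ψ : ℕ → ContDiffBump (0 : EuclideanSpace ℝ (Fin d))}

theorem tendsto_eLpNorm_mollify_sub (hΩ : IsOpen Ω) (hp : 1 ≤ p)
    (hu : MemLp u (ENNReal.ofReal p) (volume.restrict Ω)) {c : ℕ → ℝ}
    (ha : Tendsto a atTop (𝓝 1)) (hψ : Tendsto (fun n => (ψ n).rOut) atTop (𝓝 0))
    (hc : Tendsto c atTop (𝓝 1)) :
    Tendsto (fun n => eLpNorm (fun x => c n • mollify Ω (a n) (ψ n) u x - u x)
      (ENNReal.ofReal p) (volume.restrict Ω)) atTop (𝓝 0) := by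
  have hU : MemLp (Ω.indicator u) (ENNReal.ofReal p) volume :=
    (memLp_indicator_iff_restrict hΩ.measurableSet).2 hu
  have := tendsto_eLpNorm_mean_sub hp hU (ContinuousLinearMap.id ℝ _)
    (ν := fun n => bumpMeasure (ψ n)) ha hc hψ (fun n => ae_bumpMeasure_norm_le (ψ n))
  refine tendsto_of_tendsto_of_tendsto_of_le_of_le tendsto_const_nhds this
    (fun _ => zero_le) fun n => ?_
  refine le_trans (le_of_eq ?_) (eLpNorm_restrict_le _ _ _ Ω)
  refine eLpNorm_congr_ae ?_
  refine (ae_restrict_iff' hΩ.measurableSet).2 (Eventually.of_forall fun x hx => ?_)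
  simp [mollify_eq_integral, hx]

theorem tendsto_slobodeckijSeminorm_mollify_sub (hΩ : IsOpen Ω) (hp : 1 ≤ p)
    (hu : AEStronglyMeasurable u (volume.restrict Ω)) (hui : IntegrableOn u Ω volume)
    (hs : slobodeckijSeminorm Ω σ p u < ⊤) {c : ℕ → ℝ}
    (ha0 : ∀ n, 0 < a n)
    (ha : Tendsto a atTop (𝓝 1)) (hψ : Tendsto (fun n => (ψ n).rOut) atTop (𝓝 0))
    (hc : Tendsto c atTop (𝓝 1))
    (hstar : ∀ n, ∀ x ∈ Ω, Metric.closedBall (a n • x) (ψ n).rOut ⊆ Ω) :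
    Tendsto (fun n => slobodeckijSeminorm Ω σ p
      (fun x => c n • mollify Ω (a n) (ψ n) u x - u x)) atTop (𝓝 0) := by
  have hp0 : 0 < p := by linarith
  set κ : ℝ := ((d : ℝ) + σ * p) / p with hκ
  set U := (Ω ×ˢ Ω).indicator (slobodeckijQuotient κ u) with hUdef
  have hm : MeasurableSet (Ω ×ˢ Ω) := hΩ.measurableSet.prod hΩ.measurableSet
  rw [slobodeckijSeminorm_eq_eLpNorm hp0 hu] at hs
  have hU : MemLp U (ENNReal.ofReal p) (volume.prod volume) := by
    rw [hUdef, memLp_indicator_iff_restrict hm, ← Measure.prod_restrict]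
    exact ⟨slobodeckijQuotient_aestronglyMeasurable _ hu, hs⟩
  have hcκ : Tendsto (fun n => c n * a n ^ κ) atTop (𝓝 1) := by
    have : Tendsto (fun n => a n ^ κ) atTop (𝓝 (1 ^ κ)) := ha.rpow_const (Or.inl one_ne_zero)
    simpa using hc.mul this
  have := tendsto_eLpNorm_mean_sub hp hU
    ((ContinuousLinearMap.id ℝ (EuclideanSpace ℝ (Fin d))).prod (ContinuousLinearMap.id ℝ _))
    (ν := fun n => bumpMeasure (ψ n)) ha hcκ hψ (fun n => ae_bumpMeasure_norm_le (ψ n))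
  refine tendsto_of_tendsto_of_tendsto_of_le_of_le tendsto_const_nhds this
    (fun _ => zero_le) fun n => ?_
  have hmol : AEStronglyMeasurable (fun x => c n • mollify Ω (a n) (ψ n) u x - u x)
      (volume.restrict Ω) :=
    (((mollify_contDiff hΩ hui (a n) (ψ n)).continuous.const_smul (c n)).aestronglyMeasurable).sub hu
  rw [slobodeckijSeminorm_eq_eLpNorm hp0 hmol, Measure.prod_restrict]
  refine le_trans (le_of_eq ?_) (eLpNorm_restrict_le _ _ _ (Ω ×ˢ Ω))
  refine eLpNorm_congr_ae ((ae_restrict_iff' hm).2 (Eventually.of_forall ?_))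
  rintro ⟨x, y⟩ ⟨hx, hy⟩
  simp only at hx hy
  have hmem : ∀ w ∈ Ω, ∀ᵐ z ∂(bumpMeasure (ψ n)), a n • w - z ∈ Ω := by
    intro w hw
    filter_upwards [ae_bumpMeasure_norm_le (ψ n)] with z hz
    refine hstar n w hw ?_
    simpa [dist_eq_norm] using hz
  have hint : ∀ w, Integrable (fun z => Ω.indicator u (a n • w - z)) (bumpMeasure (ψ n)) :=
    fun w => integrable_bumpMeasure _
      ((hui.integrable_indicator hΩ.measurableSet).comp_sub_left (a n • w))
  have e1 : ∫ z, U (a n • (x, y) - (z, z)) ∂(bumpMeasure (ψ n))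
      = (a n ^ κ)⁻¹ • (‖x - y‖ ^ κ)⁻¹ • (mollify Ω (a n) (ψ n) u x - mollify Ω (a n) (ψ n) u y) := by
    rw [mollify_eq_integral, mollify_eq_integral, ← integral_sub (hint x) (hint y),
      ← integral_smul, ← integral_smul]
    refine integral_congr_ae ?_
    filter_upwards [hmem x hx, hmem y hy] with z hzx hzy
    have hz : a n • (x, y) - (z, z) ∈ Ω ×ˢ Ω := ⟨hzx, hzy⟩
    rw [hUdef, indicator_of_mem hz, indicator_of_mem hzx, indicator_of_mem hzy,
      slobodeckijQuotient, smul_smul, ← mul_inv,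
      ← Real.mul_rpow (ha0 n).le (norm_nonneg _)]
    congr 3
    simp only [Prod.fst_sub, Prod.snd_sub, Prod.smul_fst, Prod.smul_snd, sub_sub_sub_cancel_right]
    rw [← smul_sub, norm_smul, Real.norm_of_nonneg (ha0 n).le]
  have hxy : (x, y) ∈ Ω ×ˢ Ω := ⟨hx, hy⟩
  have hak : (a n ^ κ) ≠ 0 := (Real.rpow_pos_of_pos (ha0 n) κ).ne'
  simp only [ContinuousLinearMap.prod_apply, ContinuousLinearMap.id_apply]
  rw [e1, hUdef, indicator_of_mem hxy, smul_smul, mul_assoc, mul_inv_cancel₀ hak, mul_one,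
    slobodeckijQuotient, slobodeckijQuotient, smul_comm (c n), ← smul_sub, smul_sub (c n)]
  congr 1
  abel

/-- On a bounded open set which is strictly star-shaped, smooth functions are dense in the
Sobolev-Slobodeckij spaces. -/
theorem tendsto_sobolevNormAux_mollify_sub (hΩ : IsOpen Ω) (hΩf : volume Ω ≠ ⊤) (hp : 1 ≤ p)
    (ha0 : ∀ n, 0 < a n)
    (ha : Tendsto a atTop (𝓝 1)) (hψ : Tendsto (fun n => (ψ n).rOut) atTop (𝓝 0))
    (hstar : ∀ n, ∀ x ∈ Ω, Metric.closedBall (a n • x) (ψ n).rOut ⊆ Ω) (m : ℕ) :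
    ∀ (u : EuclideanSpace ℝ (Fin d) → V) (c : ℕ → ℝ),
      AEStronglyMeasurable u (volume.restrict Ω) → sobolevNormAux Ω σ p m u < ⊤ →
      Tendsto c atTop (𝓝 1) → Tendsto (fun n => sobolevNormAux Ω σ p m
        (fun x => c n • mollify Ω (a n) (ψ n) u x - u x)) atTop (𝓝 0) := by
  have hp1 : (1 : ℝ≥0∞) ≤ ENNReal.ofReal p := by simpa using hp
  have : IsFiniteMeasure (volume.restrict Ω) := ⟨by simpa using hΩf.lt_top⟩
  have hmem : ∀ (m : ℕ) (u : EuclideanSpace ℝ (Fin d) → V),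
      AEStronglyMeasurable u (volume.restrict Ω) → sobolevNormAux Ω σ p m u < ⊤ →
      MemLp u (ENNReal.ofReal p) (volume.restrict Ω) :=
    fun m u hu h => ⟨hu, (eLpNorm_le_sobolevNormAux m u).trans_lt h⟩
  induction m with
  | zero =>
    intro u c hu h hc
    have hL := hmem 0 u hu h
    have h1 := tendsto_eLpNorm_mollify_sub hΩ hp hL ha hψ hc
    rw [sobolevNormAux] at h
    simp only [sobolevNormAux]
    split_ifs at h ⊢ with hσ
    · simpa using h1
    · have h2 := tendsto_slobodeckijSeminorm_mollify_sub hΩ hp hu (hL.integrable hp1)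
        (ENNReal.add_lt_top.1 h).2 ha0 ha hψ hc hstar
      simpa using h1.add h2
  | succ m ih =>
    intro u c hu h hc
    obtain ⟨w, hw⟩ := exists_hasWeakPartial_of_sobolevNormAux_succ_lt_top h
    have hui := (hmem (m + 1) u hu h).integrable hp1
    have hpart : ∀ n i, HasWeakPartial Ω i (fun x => c n • mollify Ω (a n) (ψ n) u x - u x)
        (fun x => (c n * a n) • mollify Ω (a n) (ψ n) (w i) x - w i x) := by
      intro n i
      have h1 := ((hasWeakPartial_mollify hΩ hui (hw i).1 (hstar n)).const_smul (c n)).add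
        (hw i).1.neg
      simpa only [smul_smul, ← sub_eq_add_neg] using h1
    have hlim : Tendsto (fun n => sobolevNormAux Ω σ p m
        (fun x => c n • mollify Ω (a n) (ψ n) u x - u x) + ∑ i, sobolevNormAux Ω σ p m
        (fun x => (c n * a n) • mollify Ω (a n) (ψ n) (w i) x - w i x)) atTop (𝓝 0) := by
      have h1 := ih u c hu ((sobolevNormAux_mono m.le_succ u).trans_lt h) hc
      have h2 := tendsto_finsetSum Finset.univ fun i (_ : i ∈ Finset.univ) =>
        ih (w i) (fun n => c n * a n) (hw i).1.2.1.aestronglyMeasurable (hw i).2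
          (by simpa using hc.mul ha)
      simpa using h1.add h2
    exact tendsto_of_tendsto_of_tendsto_of_le_of_le tendsto_const_nhds hlim
      (fun _ => zero_le) fun n => sobolevNormAux_succ_le m (hpart n)

end Mollify

theorem lintegral_angleMeasure_eq {k : ℝ → ℝ≥0∞} (hk : Function.Periodic k (2 * π)) (t : ℝ) :
    ∫⁻ θ, k θ ∂angleMeasure = ∫⁻ θ in Ioc t (t + 2 * π), k θ := by
  rw [angleMeasure]
  conv_lhs => rw [← zero_add (2 * π)]
  refine (isAddFundamentalDomain_Ioc two_pi_pos 0).setLIntegral_eq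
    (isAddFundamentalDomain_Ioc two_pi_pos t) k ?_
  rintro ⟨g, n, rfl⟩ x
  have := hk.zsmul n x
  rw [add_comm] at this
  exact this

theorem lintegral_angleMeasure_add {k : ℝ → ℝ≥0∞} (hk : Function.Periodic k (2 * π)) (t : ℝ) :
    ∫⁻ θ, k (θ + t) ∂angleMeasure = ∫⁻ θ, k θ ∂angleMeasure := by
  rw [lintegral_angleMeasure_eq hk t, angleMeasure, ← lintegral_indicator measurableSet_Ioc,
    ← lintegral_indicator measurableSet_Ioc,
    ← lintegral_add_right_eq_self (fun θ => (Ioc t (t + 2 * π)).indicator k θ) t]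
  congr 1
  ext θ
  have : θ ∈ Ioc 0 (2 * π) ↔ θ + t ∈ Ioc t (t + 2 * π) := by
    simp only [mem_Ioc]
    constructor <;> rintro ⟨h1, h2⟩ <;> constructor <;> linarith
  by_cases h : θ ∈ Ioc 0 (2 * π)
  · rw [indicator_of_mem h, indicator_of_mem (this.1 h)]
  · rw [indicator_of_notMem h, indicator_of_notMem (fun hh => h (this.2 hh))]

instance angleMeasure_isFiniteMeasure : IsFiniteMeasure angleMeasure := by
  unfold angleMeasure
  infer_instance

/-- The point of the plane with Cartesian coordinates `z`. -/
noncomputable def planePoint (z : ℝ × ℝ) : EuclideanSpace ℝ (Fin 2) := !₂[z.1, z.2]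

theorem planePoint_measurePreserving : MeasurePreserving planePoint volume volume :=
  (PiLp.volume_preserving_toLp (Fin 2)).comp (volume_preserving_finTwoArrow ℝ).symm

theorem planePoint_continuous : Continuous planePoint := by
  unfold planePoint
  fun_prop

/-- The point at radial distance `ρ` inside the boundary point with polar angle `θ`. -/
noncomputable def stripPoint (q : ℕ) (ρ θ : ℝ) : EuclideanSpace ℝ (Fin 2) :=
  !₂[(radiusFun q θ - ρ) * cos θ, (radiusFun q θ - ρ) * sin θ]

theorem stripPoint_zero (q : ℕ) (θ : ℝ) : stripPoint q 0 θ = bdryPoint q θ := by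
  simp [stripPoint, bdryPoint]

section Omega

variable {q : ℕ}

/-- The radial function of the domain, as a function on the plane. -/
noncomputable def planeRadius (q : ℕ) (x : EuclideanSpace ℝ (Fin 2)) : ℝ :=
  radiusFun q (Complex.arg ⟨x 0, x 1⟩)

theorem norm_complex_mk_eq (x : EuclideanSpace ℝ (Fin 2)) : ‖(⟨x 0, x 1⟩ : ℂ)‖ = ‖x‖ := by
  rw [EuclideanSpace.norm_eq, Complex.norm_eq_sqrt_sq_add_sq]
  simp

theorem radiusFun_eq_of_angle_eq (hq : 8 ≤ q) {θ θ' : ℝ} (h : (θ : Real.Angle) = θ') :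
    radiusFun q θ = radiusFun q θ' := by
  obtain ⟨k, hk⟩ := Real.Angle.angle_eq_iff_two_pi_dvd_sub.1 h
  have := (radiusFun_periodic hq).int_mul k θ'
  rw [← this]
  congr 1
  linarith

theorem mem_omegaDomain_iff (hq : 8 ≤ q) (x : EuclideanSpace ℝ (Fin 2)) :
    x ∈ omegaDomain q ↔ ‖x‖ < planeRadius q x := by
  constructor
  · rintro ⟨r, θ, h0, hr, rfl⟩
    rcases h0.eq_or_lt with h | h
    · subst h
      have := (radiusFun_mem_Icc hq (Complex.arg 0)).1
      have e : ‖(!₂[0 * cos θ, 0 * sin θ] : EuclideanSpace ℝ (Fin 2))‖ = 0 := by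
        rw [← norm_complex_mk_eq]
        simp [Complex.norm_eq_sqrt_sq_add_sq]
      rw [e]
      have := (radiusFun_mem_Icc hq
        (Complex.arg ⟨(!₂[0 * cos θ, 0 * sin θ] : EuclideanSpace ℝ (Fin 2)) 0,
          (!₂[0 * cos θ, 0 * sin θ] : EuclideanSpace ℝ (Fin 2)) 1⟩)).1
      unfold planeRadius
      linarith
    · have e : (⟨(!₂[r * cos θ, r * sin θ] : EuclideanSpace ℝ (Fin 2)) 0,
          (!₂[r * cos θ, r * sin θ] : EuclideanSpace ℝ (Fin 2)) 1⟩ : ℂ)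
          = r * (Complex.cos θ + Complex.sin θ * Complex.I) := by
        apply Complex.ext <;> simp [Complex.cos_ofReal_re, Complex.sin_ofReal_re]
      rw [← norm_complex_mk_eq, planeRadius, e]
      have h1 := Complex.arg_mul_cos_add_sin_mul_I_coe_angle h (θ : Real.Angle)
      rw [Real.Angle.cos_coe, Real.Angle.sin_coe, Complex.ofReal_cos, Complex.ofReal_sin] at h1
      rw [radiusFun_eq_of_angle_eq hq h1, norm_mul, Complex.norm_real, Real.norm_of_nonneg h0,
        Complex.norm_cos_add_sin_mul_I, mul_one]
      exact hr
  · intro h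
    refine ⟨‖x‖, Complex.arg ⟨x 0, x 1⟩, norm_nonneg _, h, ?_⟩
    have h1 := Complex.norm_mul_cos_arg ⟨x 0, x 1⟩
    have h2 := Complex.norm_mul_sin_arg ⟨x 0, x 1⟩
    rw [norm_complex_mk_eq] at h1 h2
    ext i
    fin_cases i
    · simpa using h1.symm
    · simpa using h2.symm

theorem planeRadius_continuousAt (hq : 8 ≤ q) {x : EuclideanSpace ℝ (Fin 2)} (hx : x ≠ 0) :
    ContinuousAt (planeRadius q) x := by
  set G : Real.Angle → ℝ := (radiusFun_periodic hq).lift with hG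
  have hGc : Continuous G :=
    continuous_coinduced_dom.2 (radiusFun_continuous hq)
  have e : planeRadius q = G ∘ ((fun z : ℂ => (Complex.arg z : Real.Angle)) ∘
      fun x : EuclideanSpace ℝ (Fin 2) => (⟨x 0, x 1⟩ : ℂ)) := by
    ext y
    exact ((radiusFun_periodic hq).lift_coe _).symm
  have hz : (⟨x 0, x 1⟩ : ℂ) ≠ 0 := by
    rw [← norm_ne_zero_iff, norm_complex_mk_eq]
    exact norm_ne_zero_iff.2 hx
  rw [e]
  refine hGc.continuousAt.comp (ContinuousAt.comp (Complex.continuousAt_arg_coe_angle hz) ?_)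
  refine Continuous.continuousAt ?_
  have : (fun x : EuclideanSpace ℝ (Fin 2) => (⟨x 0, x 1⟩ : ℂ))
      = fun x : EuclideanSpace ℝ (Fin 2) => ((x 0 : ℂ) + (x 1 : ℂ) * Complex.I) := by
    ext y
    apply Complex.ext <;> simp
  rw [this]
  fun_prop

theorem ball_subset_omegaDomain (hq : 8 ≤ q) : Metric.ball 0 (1 / 2) ⊆ omegaDomain q := by
  intro x hx
  rw [mem_omegaDomain_iff hq]
  have := (radiusFun_mem_Icc hq (Complex.arg ⟨x 0, x 1⟩)).1
  rw [mem_ball_zero_iff] at hx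
  exact hx.trans_le this

theorem omegaDomain_isOpen (hq : 8 ≤ q) : IsOpen (omegaDomain q) := by
  rw [isOpen_iff_mem_nhds]
  intro x hx
  rcases eq_or_ne x 0 with rfl | h0
  · exact mem_of_superset (Metric.ball_mem_nhds 0 (by norm_num)) (ball_subset_omegaDomain hq)
  · rw [mem_omegaDomain_iff hq] at hx
    filter_upwards [continuous_norm.continuousAt.eventually_lt (planeRadius_continuousAt hq h0) hx]
      with y hy
    exact (mem_omegaDomain_iff hq y).2 hy

theorem norm_le_of_mem_closure_omegaDomain (hq : 8 ≤ q) {x : EuclideanSpace ℝ (Fin 2)}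
    (hx : x ∈ closure (omegaDomain q)) : ‖x‖ ≤ planeRadius q x := by
  rcases eq_or_ne x 0 with rfl | h0
  · have := (radiusFun_mem_Icc hq (Complex.arg 
      ⟨(0 : EuclideanSpace ℝ (Fin 2)) 0, (0 : EuclideanSpace ℝ (Fin 2)) 1⟩)).1
    rw [norm_zero, planeRadius]
    linarith
  · by_contra! hlt
    have := (planeRadius_continuousAt hq h0).eventually_lt continuous_norm.continuousAt hlt
    obtain ⟨y, hy, hy'⟩ := mem_closure_iff_nhds.1 hx _ this
    rw [mem_omegaDomain_iff hq] at hy'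
    exact lt_asymm hy hy'

theorem omegaDomain_isBounded (hq : 8 ≤ q) : Bornology.IsBounded (omegaDomain q) := by
  refine (Metric.isBounded_closedBall (x := 0) (r := 3 / 2)).subset fun x hx => ?_
  rw [mem_omegaDomain_iff hq] at hx
  rw [mem_closedBall_zero_iff]
  exact hx.le.trans (radiusFun_mem_Icc hq _).2

theorem smul_mem_omegaDomain (hq : 8 ≤ q) {a : ℝ} (ha0 : 0 < a) (ha1 : a < 1)
    {x : EuclideanSpace ℝ (Fin 2)} (hx : x ∈ closure (omegaDomain q)) : a • x ∈ omegaDomain q := by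
  rw [mem_omegaDomain_iff hq]
  have h1 := norm_le_of_mem_closure_omegaDomain hq hx
  have h2 : planeRadius q (a • x) = planeRadius q x := by
    have e : (⟨(a • x) 0, (a • x) 1⟩ : ℂ) = a * ⟨x 0, x 1⟩ := by
      apply Complex.ext <;> simp
    rw [planeRadius, e, Complex.arg_real_mul _ ha0, planeRadius]
  have h3 : 0 < planeRadius q x := by
    have := (radiusFun_mem_Icc hq (Complex.arg ⟨x 0, x 1⟩)).1
    unfold planeRadius
    linarith
  rw [h2, norm_smul, Real.norm_of_nonneg ha0.le]
  nlinarith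

theorem exists_forall_closedBall_smul_subset_omegaDomain (hq : 8 ≤ q) {a : ℝ} (ha0 : 0 < a)
    (ha1 : a < 1) : ∃ δ > 0, ∀ x ∈ omegaDomain q, Metric.closedBall (a • x) δ ⊆ omegaDomain q := by
  have hK : IsCompact ((fun x : EuclideanSpace ℝ (Fin 2) => a • x) '' closure (omegaDomain q)) :=
    (omegaDomain_isBounded hq).isCompact_closure.image (by fun_prop)
  obtain ⟨δ, hδ, h⟩ := hK.exists_cthickening_subset_open (omegaDomain_isOpen hq) (by
    rintro _ ⟨x, hx, rfl⟩
    exact smul_mem_omegaDomain hq ha0 ha1 hx)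
  refine ⟨δ, hδ, fun x hx => ?_⟩
  exact (Metric.closedBall_subset_cthickening (mem_image_of_mem _ (subset_closure hx)) δ).trans h

theorem volume_omegaDomain_ne_top (hq : 8 ≤ q) : volume (omegaDomain q) ≠ ⊤ :=
  (omegaDomain_isBounded hq).measure_lt_top.ne

/-- Functions which are smooth on the whole plane are dense in `W^{s,p}(ω)`. -/
theorem exists_contDiff_tendsto_sobolevNorm (hq : 8 ≤ q) {V : Type*} [NormedAddCommGroup V]
    [NormedSpace ℝ V] [CompleteSpace V] {s p : ℝ} (hp : 1 ≤ p)
    {u : EuclideanSpace ℝ (Fin 2) → V} (hu : MemSobolev (omegaDomain q) s p u) :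
    ∃ φ : ℕ → EuclideanSpace ℝ (Fin 2) → V, (∀ n, ContDiff ℝ ∞ (φ n)) ∧
      Tendsto (fun n => sobolevNorm (omegaDomain q) s p (fun x => φ n x - u x)) atTop (𝓝 0) := by
  set a : ℕ → ℝ := fun n => 1 - 1 / ((n : ℝ) + 2) with ha
  have hn : ∀ n : ℕ, (0 : ℝ) < (n : ℝ) + 2 := fun n => by positivity
  have ha0 : ∀ n, 0 < a n := fun n => by
    have : 1 / ((n : ℝ) + 2) < 1 := by
      rw [div_lt_one (hn n)]
      have : (0 : ℝ) ≤ n := n.cast_nonneg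
      linarith
    simp only [ha]
    linarith
  have ha1 : ∀ n, a n < 1 := fun n => by
    have : 0 < 1 / ((n : ℝ) + 2) := by have := hn n; positivity
    simp only [ha]
    linarith
  have hlim : Tendsto (fun n : ℕ => 1 / ((n : ℝ) + 2)) atTop (𝓝 0) := by
    have := (tendsto_const_nhds (x := (1 : ℝ))).div_atTop
      (tendsto_atTop_add_const_right _ (2 : ℝ) (tendsto_natCast_atTop_atTop (R := ℝ)))
    exact this
  choose δ hδ0 hδ using fun n => exists_forall_closedBall_smul_subset_omegaDomain hq (ha0 n) (ha1 n)
  have hr : ∀ n, 0 < min (δ n) (1 / ((n : ℝ) + 2)) := fun n =>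
    lt_min (hδ0 n) (by have := hn n; positivity)
  set ψ : ℕ → ContDiffBump (0 : EuclideanSpace ℝ (Fin 2)) := fun n =>
    ⟨min (δ n) (1 / ((n : ℝ) + 2)) / 2, min (δ n) (1 / ((n : ℝ) + 2)), half_pos (hr n),
      half_lt_self (hr n)⟩ with hψ
  have hψr : Tendsto (fun n => (ψ n).rOut) atTop (𝓝 0) :=
    squeeze_zero (fun n => (hr n).le) (fun n => min_le_right _ _) hlim
  have : IsFiniteMeasure (volume.restrict (omegaDomain q)) :=
    ⟨by simpa using (volume_omegaDomain_ne_top hq).lt_top⟩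
  have hui : IntegrableOn u (omegaDomain q) volume :=
    MemLp.integrable (q := ENNReal.ofReal p) (by simpa using hp)
      ⟨hu.1, (eLpNorm_le_sobolevNormAux ⌊s⌋₊ u).trans_lt hu.2⟩
  refine ⟨fun n => mollify (omegaDomain q) (a n) (ψ n) u,
    fun n => mollify_contDiff (omegaDomain_isOpen hq) hui _ _, ?_⟩
  have := tendsto_sobolevNormAux_mollify_sub (σ := s - ⌊s⌋₊) (omegaDomain_isOpen hq)
    (volume_omegaDomain_ne_top hq) hp ha0 (by simpa [ha] using hlim.const_sub 1) hψr
    (fun n x hx => (Metric.closedBall_subset_closedBall (min_le_left _ _)).trans (hδ n x hx))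
    ⌊s⌋₊ u (fun _ => 1) hu.1 hu.2 tendsto_const_nhds
  simp only [one_smul] at this
  exact this

theorem stripPoint_periodic (hq : 8 ≤ q) (ρ : ℝ) :
    Function.Periodic (stripPoint q ρ) (2 * π) := by
  intro θ
  simp [stripPoint, radiusFun_periodic hq θ]

theorem stripPoint_continuous (hq : 8 ≤ q) :
    Continuous fun z : ℝ × ℝ => stripPoint q z.1 z.2 := by
  have := radiusFun_continuous hq
  unfold stripPoint
  fun_prop

/-- Integrals over the collar of width `1/4` are controlled by integrals over the domain. -/
theorem lintegral_stripPoint_le (hq : 8 ≤ q) {H : EuclideanSpace ℝ (Fin 2) → ℝ≥0∞}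
    (hH : Measurable H) :
    ∫⁻ ρ in Ioo 0 (1 / 4), ∫⁻ θ, H (stripPoint q ρ θ) ∂angleMeasure
      ≤ 4 * ∫⁻ x in omegaDomain q, H x := by
  have hF := radiusFun_continuous hq
  set H' := (omegaDomain q).indicator H with hH'
  have hm' : Measurable H' := hH.indicator (omegaDomain_isOpen hq).measurableSet
  have hms : Measurable fun z : ℝ × ℝ => H (stripPoint q z.1 z.2) :=
    hH.comp (stripPoint_continuous hq).measurable
  have hK : Measurable fun z : ℝ × ℝ =>
      ENNReal.ofReal z.1 • H' (planePoint (polarCoord.symm z)) := by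
    refine (measurable_fst.ennreal_ofReal).smul (hm'.comp (planePoint_continuous.measurable.comp ?_))
    exact (continuous_polarCoord_symm).measurable
  have e1 : ∫⁻ x in omegaDomain q, H x = ∫⁻ θ in Ioo (-π) π, ∫⁻ r in Ioi (0 : ℝ),
      ENNReal.ofReal r • H' (planePoint (polarCoord.symm (r, θ))) := by
    rw [← lintegral_indicator (omegaDomain_isOpen hq).measurableSet,
      ← planePoint_measurePreserving.lintegral_comp hm',
      ← lintegral_comp_polarCoord_symm (fun z => H' (planePoint z)), polarCoord_target,
      Measure.volume_eq_prod, ← Measure.prod_restrict, lintegral_prod_symm' _ hK]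
  have e2 : ∫⁻ ρ in Ioo 0 (1 / 4), ∫⁻ θ, H (stripPoint q ρ θ) ∂angleMeasure
      = ∫⁻ θ in Ioo (-π) π, ∫⁻ ρ in Ioo 0 (1 / 4), H (stripPoint q ρ θ) := by
    have : ∀ ρ, ∫⁻ θ, H (stripPoint q ρ θ) ∂angleMeasure
        = ∫⁻ θ in Ioo (-π) π, H (stripPoint q ρ θ) := by
      intro ρ
      rw [lintegral_angleMeasure_eq (k := fun θ => H (stripPoint q ρ θ))
        (fun θ => congrArg H (stripPoint_periodic hq ρ θ)) (-π), show -π + 2 * π = π by ring,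
        restrict_Ioo_eq_restrict_Ioc]
    simp_rw [this]
    exact lintegral_lintegral_swap hms.aemeasurable
  rw [e1, e2, ← lintegral_const_mul' _ _ (by simp)]
  refine lintegral_mono fun θ => ?_
  have hF1 := (radiusFun_mem_Icc hq θ).1
  calc ∫⁻ ρ in Ioo 0 (1 / 4), H (stripPoint q ρ θ)
      = ∫⁻ ρ, (Ioo (0 : ℝ) (1 / 4)).indicator (fun ρ => H (stripPoint q ρ θ)) ρ :=
        (lintegral_indicator measurableSet_Ioo _).symm
    _ = ∫⁻ r, (Ioo (0 : ℝ) (1 / 4)).indicator (fun ρ => H (stripPoint q ρ θ))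
          (radiusFun q θ - r) :=
        (lintegral_sub_left_eq_self _ (radiusFun q θ)).symm
    _ ≤ ∫⁻ r, (Ioi (0 : ℝ)).indicator
          (fun r => 4 * (ENNReal.ofReal r • H' (planePoint (polarCoord.symm (r, θ))))) r := by
        refine lintegral_mono fun r => ?_
        by_cases hr : radiusFun q θ - r ∈ Ioo (0 : ℝ) (1 / 4)
        · have hr1 : 1 / 4 ≤ r := by linarith [hr.2]
          have hr0 : r ∈ Ioi (0 : ℝ) := by
            rw [mem_Ioi]
            linarith
          have hp : planePoint (polarCoord.symm (r, θ)) = stripPoint q (radiusFun q θ - r) θ := by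
            simp [planePoint, stripPoint, polarCoord_symm_apply]
          have hmem : planePoint (polarCoord.symm (r, θ)) ∈ omegaDomain q := by
            refine ⟨r, θ, by linarith, by linarith [hr.1], ?_⟩
            simp [planePoint, polarCoord_symm_apply]
          simp only [indicator_of_mem hr, indicator_of_mem hr0]
          rw [hH', indicator_of_mem hmem, hp, smul_eq_mul, ← mul_assoc]
          refine le_mul_of_one_le_left' ?_
          rw [show (4 : ℝ≥0∞) = ENNReal.ofReal 4 by simp, ← ENNReal.ofReal_mul (by norm_num)]
          rw [ENNReal.one_le_ofReal]
          linarith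
        · simp only [indicator_of_notMem hr]
          exact zero_le
    _ = 4 * ∫⁻ r in Ioi (0 : ℝ), ENNReal.ofReal r • H' (planePoint (polarCoord.symm (r, θ))) := by
        rw [lintegral_indicator measurableSet_Ioi, lintegral_const_mul' _ _ (by simp)]

end Omega

section Collar

variable {q : ℕ} {V : Type*} [NormedAddCommGroup V] {p σ : ℝ} {φ : EuclideanSpace ℝ (Fin 2) → V}

theorem norm_toLp_pair_sq (a b : ℝ) : ‖(!₂[a, b] : EuclideanSpace ℝ (Fin 2))‖ ^ 2 = a ^ 2 + b ^ 2 := by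
  rw [EuclideanSpace.norm_sq_eq]
  simp

theorem norm_cos_sin (θ : ℝ) : ‖(!₂[cos θ, sin θ] : EuclideanSpace ℝ (Fin 2))‖ = 1 := by
  rw [← sq_eq_sq₀ (norm_nonneg _) zero_le_one, norm_toLp_pair_sq, one_pow, cos_sq_add_sin_sq]

theorem norm_cos_sin_sub_le (θ θ' : ℝ) :
    ‖(!₂[cos θ, sin θ] : EuclideanSpace ℝ (Fin 2)) - !₂[cos θ', sin θ']‖ ≤ |θ - θ'| := by
  have e : (!₂[cos θ, sin θ] : EuclideanSpace ℝ (Fin 2)) - !₂[cos θ', sin θ']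
      = !₂[cos θ - cos θ', sin θ - sin θ'] := by
    ext i
    fin_cases i <;> simp
  rw [e]
  refine le_of_sq_le_sq ?_ (abs_nonneg _)
  rw [norm_toLp_pair_sq, sq_abs]
  have h1 := one_sub_sq_div_two_le_cos (x := θ - θ')
  rw [cos_sub] at h1
  nlinarith [cos_sq_add_sin_sq θ, cos_sq_add_sin_sq θ']

theorem stripPoint_eq_smul (q : ℕ) (ρ θ : ℝ) :
    stripPoint q ρ θ = (radiusFun q θ - ρ) • !₂[cos θ, sin θ] := by
  ext i
  fin_cases i <;> simp [stripPoint]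

theorem norm_stripPoint_le (hq : 8 ≤ q) {ρ : ℝ} (hρ : ρ ∈ Icc (0 : ℝ) (1 / 4)) (θ : ℝ) :
    ‖stripPoint q ρ θ‖ ≤ 3 / 2 := by
  have h := radiusFun_mem_Icc hq θ
  rw [stripPoint_eq_smul, norm_smul, norm_cos_sin, mul_one, Real.norm_eq_abs, abs_le]
  constructor <;> linarith [hρ.1, hρ.2, h.1, h.2]

theorem norm_stripPoint_sub_le (hq : 8 ≤ q) {ρ ρ' : ℝ} (hρ : ρ ∈ Icc (0 : ℝ) (1 / 4)) (θ θ' : ℝ) :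
    ‖stripPoint q ρ θ - stripPoint q ρ' θ'‖ ≤ |ρ - ρ'| + 2 * |θ - θ'| := by
  have e : stripPoint q ρ θ - stripPoint q ρ' θ'
      = (radiusFun q θ - ρ) • ((!₂[cos θ, sin θ] : EuclideanSpace ℝ (Fin 2)) - !₂[cos θ', sin θ'])
        + ((radiusFun q θ - radiusFun q θ') - (ρ - ρ')) •
          (!₂[cos θ', sin θ'] : EuclideanSpace ℝ (Fin 2)) := by
    rw [stripPoint_eq_smul, stripPoint_eq_smul]
    module
  have h := radiusFun_mem_Icc hq θ
  have h1 : |radiusFun q θ - ρ| ≤ 3 / 2 := by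
    rw [abs_le]
    constructor <;> linarith [hρ.1, hρ.2, h.1, h.2]
  have h2 := radiusFun_lipschitz hq θ' θ
  have h3 := abs_sub (radiusFun q θ - radiusFun q θ') (ρ - ρ')
  rw [e]
  refine (norm_add_le _ _).trans ?_
  rw [norm_smul, norm_smul, norm_cos_sin, mul_one, Real.norm_eq_abs, Real.norm_eq_abs]
  have h4 := mul_le_mul h1 (norm_cos_sin_sub_le θ θ') (norm_nonneg _) (by norm_num)
  have := abs_nonneg (θ - θ')
  linarith

/-- The `Lᵖ` distance of the restrictions of `φ` to two curves parallel to the boundary, one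
of them shifted. -/
noncomputable def collarDist (q : ℕ) (p : ℝ) (φ : EuclideanSpace ℝ (Fin 2) → V) (x y : ℝ × ℝ) :
    ℝ≥0∞ :=
  eLpNorm (fun θ => φ (stripPoint q x.1 (θ + x.2)) - φ (stripPoint q y.1 (θ + y.2)))
    (ENNReal.ofReal p) angleMeasure

/-- The `Lᵖ` norm of the restriction of `φ` to a curve parallel to the boundary. -/
noncomputable def collarNorm (q : ℕ) (p : ℝ) (φ : EuclideanSpace ℝ (Fin 2) → V) (ρ : ℝ) : ℝ≥0∞ :=
  eLpNorm (fun θ => φ (stripPoint q ρ θ)) (ENNReal.ofReal p) angleMeasure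

theorem continuous_comp_stripPoint (hq : 8 ≤ q) (hφ : Continuous φ) (x : ℝ × ℝ) :
    Continuous fun θ => φ (stripPoint q x.1 (θ + x.2)) :=
  hφ.comp ((stripPoint_continuous hq).comp (by fun_prop : Continuous fun θ => (x.1, θ + x.2)))

theorem collarDist_comm (x y : ℝ × ℝ) : collarDist q p φ x y = collarDist q p φ y x :=
  eLpNorm_sub_comm (fun θ => φ (stripPoint q x.1 (θ + x.2))) _ _ _

theorem collarDist_triangle (hq : 8 ≤ q) (hp : 1 ≤ p) (hφ : Continuous φ) (x y z : ℝ × ℝ) :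
    collarDist q p φ x z ≤ collarDist q p φ x y + collarDist q p φ y z := by
  have hp1 : (1 : ℝ≥0∞) ≤ ENNReal.ofReal p := by simpa using hp
  have h := fun x => continuous_comp_stripPoint hq hφ x
  refine le_trans (le_of_eq ?_) (eLpNorm_add_le ((h x).sub (h y)).aestronglyMeasurable
    ((h y).sub (h z)).aestronglyMeasurable hp1)
  unfold collarDist
  congr 1
  ext θ
  simp

theorem eLpNorm_angleMeasure_add (hp : 0 < p) {k : ℝ → V} (hk : Function.Periodic k (2 * π))
    (c : ℝ) : eLpNorm (fun θ => k (θ + c)) (ENNReal.ofReal p) angleMeasure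
      = eLpNorm k (ENNReal.ofReal p) angleMeasure := by
  rw [eLpNorm_ofReal_exponent hp, eLpNorm_ofReal_exponent hp,
    lintegral_angleMeasure_add (k := fun θ => ‖k θ‖ₑ ^ p) (fun θ => by simp only [hk θ])]

theorem collarDist_add_snd (hq : 8 ≤ q) (hp : 0 < p) (ρ b ρ' b' c : ℝ) :
    collarDist q p φ (ρ, b + c) (ρ', b' + c) = collarDist q p φ (ρ, b) (ρ', b') := by
  have h := eLpNorm_angleMeasure_add (p := p) hp
    (k := fun θ => φ (stripPoint q ρ (θ + b)) - φ (stripPoint q ρ' (θ + b'))) (fun θ => by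
      simp only [add_right_comm θ (2 * π), stripPoint_periodic hq ρ (θ + b),
        stripPoint_periodic hq ρ' (θ + b')]) c
  unfold collarDist
  rw [← h]
  simp only [add_comm b, add_comm b', add_assoc]

theorem collarNorm_le_add (hq : 8 ≤ q) (hp : 1 ≤ p) (hφ : Continuous φ) (x y : ℝ × ℝ) :
    collarNorm q p φ x.1 ≤ collarDist q p φ x y + collarNorm q p φ y.1 := by
  have hp1 : (1 : ℝ≥0∞) ≤ ENNReal.ofReal p := by simpa using hp
  have h := fun x => continuous_comp_stripPoint hq hφ x
  have e : ∀ x : ℝ × ℝ, collarNorm q p φ x.1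
      = eLpNorm (fun θ => φ (stripPoint q x.1 (θ + x.2))) (ENNReal.ofReal p) angleMeasure :=
    fun x => (eLpNorm_angleMeasure_add (by linarith)
      (fun θ => congrArg φ (stripPoint_periodic hq x.1 θ)) x.2).symm
  rw [e x, e y]
  refine le_trans (le_of_eq ?_) (eLpNorm_add_le ((h x).sub (h y)).aestronglyMeasurable
    (h y).aestronglyMeasurable hp1)
  congr 1
  ext θ
  simp

theorem measurable_collarDist (hq : 8 ≤ q) (hp : 0 < p) (hφ : Continuous φ) :
    Measurable fun z : (ℝ × ℝ) × (ℝ × ℝ) => collarDist q p φ z.1 z.2 := by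
  unfold collarDist
  simp_rw [eLpNorm_ofReal_exponent hp]
  refine Measurable.pow_const ?_ _
  have hc : Continuous fun w : ((ℝ × ℝ) × (ℝ × ℝ)) × ℝ =>
      φ (stripPoint q w.1.1.1 (w.2 + w.1.1.2)) - φ (stripPoint q w.1.2.1 (w.2 + w.1.2.2)) := by
    have h := stripPoint_continuous hq
    exact (hφ.comp (h.comp (by fun_prop : Continuous fun w : ((ℝ × ℝ) × (ℝ × ℝ)) × ℝ =>
      (w.1.1.1, w.2 + w.1.1.2)))).sub (hφ.comp (h.comp (by fun_prop :
        Continuous fun w : ((ℝ × ℝ) × (ℝ × ℝ)) × ℝ => (w.1.2.1, w.2 + w.1.2.2))))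
  exact (hc.enorm.measurable.pow_const p).lintegral_prod_right'

theorem measurable_collarNorm (hq : 8 ≤ q) (hp : 0 < p) (hφ : Continuous φ) :
    Measurable (collarNorm q p φ) := by
  unfold collarNorm
  simp_rw [eLpNorm_ofReal_exponent hp]
  refine Measurable.pow_const ?_ _
  exact ((hφ.comp (stripPoint_continuous hq)).enorm.measurable.pow_const p).lintegral_prod_right'

theorem lintegral_collarNorm_rpow_le (hq : 8 ≤ q) (hp : 0 < p) (hφ : Continuous φ) :
    ∫⁻ ρ in Ioo 0 (1 / 4), collarNorm q p φ ρ ^ p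
      ≤ 4 * eLpNorm φ (ENNReal.ofReal p) (volume.restrict (omegaDomain q)) ^ p := by
  unfold collarNorm
  simp_rw [eLpNorm_ofReal_exponent_rpow hp]
  exact lintegral_stripPoint_le hq (hφ.enorm.measurable.pow_const p)

/-- The box at the origin with which boundary values are averaged. -/
def collarBox (t : ℝ) : Set (ℝ × ℝ) := Ioo 0 t ×ˢ Ioo (-t) t

theorem measurableSet_collarBox (t : ℝ) : MeasurableSet (collarBox t) :=
  measurableSet_Ioo.prod measurableSet_Ioo

theorem volume_collarBox {t : ℝ} (ht : 0 < t) : volume (collarBox t) = ENNReal.ofReal (2 * t ^ 2) := by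
  rw [collarBox, Measure.volume_eq_prod, Measure.prod_prod, Real.volume_Ioo, Real.volume_Ioo,
    ← ENNReal.ofReal_mul (by linarith)]
  congr 1
  ring

theorem collarDist_rpow_le (hq : 8 ≤ q) (hp : 0 < p) (hσ : 0 < σ) {t : ℝ} (ht4 : t ≤ 1 / 4)
    {x y : ℝ × ℝ} (hx : x ∈ collarBox t) (hy : y ∈ collarBox t) :
    collarDist q p φ x y ^ p ≤ ENNReal.ofReal ((5 * t) ^ (2 + σ * p)) *
      ∫⁻ θ, ‖φ (stripPoint q x.1 (θ + x.2)) - φ (stripPoint q y.1 (θ + y.2))‖ₑ ^ p /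
        ‖stripPoint q x.1 (θ + x.2) - stripPoint q y.1 (θ + y.2)‖ₑ ^ (((2 : ℕ) : ℝ) + σ * p)
          ∂angleMeasure := by
  rw [collarDist, eLpNorm_ofReal_exponent_rpow hp, ← lintegral_const_mul' _ _ (by simp)]
  refine lintegral_mono fun θ => ?_
  obtain ⟨⟨hx1, hx2⟩, hx3, hx4⟩ := hx
  obtain ⟨⟨hy1, hy2⟩, hy3, hy4⟩ := hy
  have ht0 : 0 < t := hx1.trans hx2
  have hκ : 0 ≤ 2 + σ * p := by positivity
  set P := stripPoint q x.1 (θ + x.2)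
  set Q := stripPoint q y.1 (θ + y.2)
  by_cases hPQ : P = Q
  · simp [hPQ, hp]
  have hn : 0 < ‖P - Q‖ := norm_pos_iff.2 (sub_ne_zero.2 hPQ)
  have hle : ‖P - Q‖ ≤ 5 * t := by
    refine (norm_stripPoint_sub_le hq ⟨hx1.le, hx2.le.trans ht4⟩ _ _).trans ?_
    have e : θ + x.2 - (θ + y.2) = x.2 - y.2 := by ring
    have h1 : |x.1 - y.1| ≤ t := abs_le.2 ⟨by linarith, by linarith⟩
    have h2 : |x.2 - y.2| ≤ 2 * t := abs_le.2 ⟨by linarith, by linarith⟩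
    rw [e]
    linarith
  push_cast
  rw [← mul_div_assoc, ENNReal.le_div_iff_mul_le]
  · rw [mul_comm]
    gcongr
    rw [← ofReal_norm, ENNReal.ofReal_rpow_of_pos hn]
    exact ENNReal.ofReal_le_ofReal (Real.rpow_le_rpow hn.le hle hκ)
  · left
    rw [← ofReal_norm, ENNReal.ofReal_rpow_of_pos hn]
    simpa using Real.rpow_pos_of_pos hn _
  · left
    exact ENNReal.rpow_ne_top_of_nonneg hκ (by simp)

theorem lintegral_collarBox (t : ℝ) (f : ℝ × ℝ → ℝ≥0∞) (hf : Measurable f) :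
    ∫⁻ y in collarBox t, f y = ∫⁻ ρ in Ioo 0 t, ∫⁻ b in Ioo (-t) t, f (ρ, b) := by
  rw [collarBox, Measure.volume_eq_prod, ← Measure.prod_restrict, lintegral_prod _ hf.aemeasurable]

theorem lintegral_collarBox_shift_le (hq : 8 ≤ q) {t : ℝ} (ht4 : t ≤ 1 / 4)
    {H : EuclideanSpace ℝ (Fin 2) → ℝ≥0∞} (hH : Measurable H) (θ : ℝ) :
    ∫⁻ y in collarBox t, H (stripPoint q y.1 (θ + y.2)) ≤ 4 * ∫⁻ x in omegaDomain q, H x := by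
  have hm : Measurable fun y : ℝ × ℝ => H (stripPoint q y.1 (θ + y.2)) :=
    hH.comp ((stripPoint_continuous hq).comp
      (by fun_prop : Continuous fun y : ℝ × ℝ => (y.1, θ + y.2))).measurable
  rw [lintegral_collarBox t _ hm]
  refine le_trans ?_ (lintegral_stripPoint_le hq hH)
  refine (lintegral_mono_set (Ioo_subset_Ioo_right ht4)).trans (lintegral_mono fun ρ => ?_)
  have hper : Function.Periodic (fun b => H (stripPoint q ρ b)) (2 * π) :=
    fun b => congrArg H (stripPoint_periodic hq ρ b)
  have hper' : Function.Periodic (fun b => H (stripPoint q ρ (b + θ))) (2 * π) := fun b => by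
    simp only [add_right_comm b, stripPoint_periodic hq ρ (b + θ)]
  rw [← lintegral_angleMeasure_add hper θ, lintegral_angleMeasure_eq hper' (-π)]
  simp_rw [add_comm θ]
  refine lintegral_mono_set fun b hb => ?_
  constructor <;> linarith [hb.1, hb.2, pi_gt_three]

theorem lintegral_collarDist_rpow_le (hq : 8 ≤ q) (hp : 0 < p) (hσ : 0 < σ) (hφ : Continuous φ)
    {t : ℝ} (ht0 : 0 < t) (ht4 : t ≤ 1 / 4) :
    ∫⁻ x in collarBox t, ∫⁻ y in collarBox t, collarDist q p φ x y ^ p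
      ≤ ENNReal.ofReal (32 * 5 ^ (2 + σ * p) * t ^ (3 + σ * p))
        * slobodeckijSeminorm (omegaDomain q) σ p φ ^ p := by
  set K : EuclideanSpace ℝ (Fin 2) × EuclideanSpace ℝ (Fin 2) → ℝ≥0∞ := fun z =>
    ‖φ z.1 - φ z.2‖ₑ ^ p / ‖z.1 - z.2‖ₑ ^ (((2 : ℕ) : ℝ) + σ * p) with hK
  have hKm : Measurable K := by
    have h1 : Continuous fun z : EuclideanSpace ℝ (Fin 2) × EuclideanSpace ℝ (Fin 2) =>
      φ z.1 - φ z.2 := by fun_prop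
    exact (h1.enorm.measurable.pow_const _).div
      ((continuous_fst.sub continuous_snd).enorm.measurable.pow_const _)
  set G : EuclideanSpace ℝ (Fin 2) → ℝ≥0∞ := fun x => ∫⁻ y in omegaDomain q, K (x, y) with hG
  have hGm : Measurable G := hKm.lintegral_prod_right'
  have hS : slobodeckijSeminorm (omegaDomain q) σ p φ ^ p = ∫⁻ x in omegaDomain q, G x := by
    rw [slobodeckijSeminorm, ← ENNReal.rpow_mul, one_div_mul_cancel hp.ne', ENNReal.rpow_one]
  set c := ENNReal.ofReal ((5 * t) ^ (2 + σ * p)) with hc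
  have hpt : ∀ x ∈ collarBox t, ∫⁻ y in collarBox t, collarDist q p φ x y ^ p
      ≤ c * (4 * ∫⁻ θ, G (stripPoint q x.1 (θ + x.2)) ∂angleMeasure) := by
    intro x hx
    have hKm2 : Measurable fun w : (ℝ × ℝ) × ℝ =>
        K (stripPoint q x.1 (w.2 + x.2), stripPoint q w.1.1 (w.2 + w.1.2)) := by
      refine hKm.comp (Continuous.measurable ?_)
      have h := stripPoint_continuous hq
      exact (h.comp (by fun_prop : Continuous fun w : (ℝ × ℝ) × ℝ => (x.1, w.2 + x.2))).prodMk
        (h.comp (by fun_prop : Continuous fun w : (ℝ × ℝ) × ℝ => (w.1.1, w.2 + w.1.2)))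
    calc _ ≤ ∫⁻ y in collarBox t, c * ∫⁻ θ, K (stripPoint q x.1 (θ + x.2),
            stripPoint q y.1 (θ + y.2)) ∂angleMeasure :=
          setLIntegral_mono' (measurableSet_collarBox t) fun y hy =>
            collarDist_rpow_le hq hp hσ ht4 hx hy
      _ = c * ∫⁻ θ, (∫⁻ y in collarBox t, K (stripPoint q x.1 (θ + x.2),
            stripPoint q y.1 (θ + y.2))) ∂angleMeasure := by
          rw [lintegral_const_mul' _ _ (by simp [hc])]
          congr 1
          exact lintegral_lintegral_swap hKm2.aemeasurable
      _ ≤ c * ∫⁻ θ, 4 * G (stripPoint q x.1 (θ + x.2)) ∂angleMeasure := by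
          gcongr with θ
          exact lintegral_collarBox_shift_le hq ht4
            (hKm.comp (measurable_prodMk_left (x := stripPoint q x.1 (θ + x.2)))) θ
      _ = _ := by rw [lintegral_const_mul' _ _ (by simp)]
  have hGp : ∀ x : ℝ × ℝ, ∫⁻ θ, G (stripPoint q x.1 (θ + x.2)) ∂angleMeasure
      = ∫⁻ θ, G (stripPoint q x.1 θ) ∂angleMeasure := fun x =>
    lintegral_angleMeasure_add (k := fun θ => G (stripPoint q x.1 θ))
      (fun θ => congrArg G (stripPoint_periodic hq x.1 θ)) x.2
  have hGm2 : Measurable fun x : ℝ × ℝ => ∫⁻ θ, G (stripPoint q x.1 θ) ∂angleMeasure := by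
    have : Measurable fun ρ : ℝ => ∫⁻ θ, G (stripPoint q ρ θ) ∂angleMeasure :=
      (hGm.comp (stripPoint_continuous hq).measurable).lintegral_prod_right'
    exact this.comp measurable_fst
  calc _ ≤ ∫⁻ x in collarBox t, c * (4 * ∫⁻ θ, G (stripPoint q x.1 θ) ∂angleMeasure) :=
        setLIntegral_mono' (measurableSet_collarBox t) fun x hx => by
          rw [← hGp x]
          exact hpt x hx
    _ = c * (4 * (ENNReal.ofReal (2 * t) *
          ∫⁻ ρ in Ioo 0 t, ∫⁻ θ, G (stripPoint q ρ θ) ∂angleMeasure)) := by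
        rw [lintegral_const_mul' _ _ (by simp [hc]), lintegral_const_mul' _ _ (by simp),
          lintegral_collarBox t _ hGm2]
        simp only [lintegral_const, Measure.restrict_apply_univ, Real.volume_Ioo, sub_neg_eq_add]
        rw [lintegral_mul_const' _ _ (by simp), mul_comm (ENNReal.ofReal (2 * t)), two_mul]
    _ ≤ c * (4 * (ENNReal.ofReal (2 * t) * (4 * ∫⁻ x in omegaDomain q, G x))) := by
        gcongr
        exact (lintegral_mono_set (Ioo_subset_Ioo_right ht4)).trans (lintegral_stripPoint_le hq hGm)
    _ = _ := by
        rw [hS, hc]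
        have e4 : (4 : ℝ≥0∞) = ENNReal.ofReal 4 := by simp
        rw [e4]
        simp only [← mul_assoc]
        rw [← ENNReal.ofReal_mul (by positivity), ← ENNReal.ofReal_mul (by positivity),
          ← ENNReal.ofReal_mul (by positivity)]
        congr 2
        have e : t ^ (3 + σ * p) = t ^ (2 + σ * p) * t := by
          rw [show 3 + σ * p = (2 + σ * p) + 1 by ring, Real.rpow_add ht0 _ 1, Real.rpow_one]
        rw [Real.mul_rpow (by norm_num) ht0.le, e]
        ring

theorem tendsto_collarDist_zero (hq : 8 ≤ q) (hφ : Continuous φ) {ε : ℝ≥0∞} (hε : ε ≠ 0) :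
    ∃ δ : ℝ, 0 < δ ∧ ∀ t, 0 < t → t ≤ δ → ∀ x ∈ collarBox t, collarDist q p φ 0 x ≤ ε := by
  have huc : UniformContinuousOn φ (Metric.closedBall 0 (3 / 2)) :=
    (isCompact_closedBall _ _).uniformContinuousOn_of_continuous hφ.continuousOn
  set M : ℝ≥0∞ := angleMeasure univ ^ (ENNReal.ofReal p).toReal⁻¹ with hM
  have hMfin : M ≠ ⊤ := (ENNReal.rpow_lt_top_of_nonneg (by positivity) (measure_ne_top _ _)).ne
  obtain ⟨η, hη0, hη⟩ : ∃ δ : ℝ, 0 < δ ∧ M * ENNReal.ofReal δ ≤ ε := by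
    rcases eq_or_ne ε ⊤ with h | h
    · exact ⟨1, one_pos, by simp [h]⟩
    have hpos : 0 < ε.toReal := ENNReal.toReal_pos hε h
    refine ⟨ε.toReal / (M.toReal + 1), by positivity, ?_⟩
    rw [← ENNReal.ofReal_toReal hMfin, ← ENNReal.ofReal_mul (by positivity),
      ENNReal.toReal_ofReal (by positivity)]
    refine (ENNReal.ofReal_le_ofReal ?_).trans (ENNReal.ofReal_toReal h).le
    rw [mul_div_assoc', div_le_iff₀ (by positivity)]
    nlinarith [ENNReal.toReal_nonneg (a := M)]
  obtain ⟨δ, hδ0, hδ⟩ := Metric.uniformContinuousOn_iff.1 huc η hη0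
  refine ⟨min (δ / 4) (1 / 4), by positivity, fun t ht0 ht x hx => ?_⟩
  refine (eLpNorm_le_of_ae_bound (C := η) (Eventually.of_forall fun θ => ?_)).trans hη
  obtain ⟨⟨hx1, hx2⟩, hx3, hx4⟩ := hx
  have ht1 : t ≤ δ / 4 := ht.trans (min_le_left _ _)
  have ht2 : t ≤ 1 / 4 := ht.trans (min_le_right _ _)
  have m0 : (0 : ℝ) ∈ Icc (0 : ℝ) (1 / 4) := by norm_num
  rw [← dist_eq_norm]
  refine (hδ _ ?_ _ ?_ ?_).le
  · simpa using norm_stripPoint_le hq m0 (θ + 0)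
  · simpa using norm_stripPoint_le hq ⟨hx1.le, hx2.le.trans ht2⟩ (θ + x.2)
  · rw [dist_eq_norm]
    refine (norm_stripPoint_sub_le hq m0 _ _).trans_lt ?_
    have e : θ + (0 : ℝ × ℝ).2 - (θ + x.2) = - x.2 := by simp
    have h1 : |0 - x.1| < t := by
      simpa [abs_of_pos hx1] using hx2
    have h2 : |x.2| < t := abs_lt.2 ⟨hx3, hx4⟩
    rw [e, abs_neg]
    change |0 - x.1| + 2 * |x.2| < δ
    linarith

end Collar

/-- Hölder's inequality against the constant function. -/
theorem lintegral_rpow_le_measure_univ_mul {X : Type*} [MeasurableSpace X] {μ : Measure X}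
    [IsFiniteMeasure μ] {f : X → ℝ≥0∞} {p : ℝ} (hp : 1 ≤ p) (hf : AEMeasurable f μ) :
    (∫⁻ x, f x ∂μ) ^ p ≤ μ univ ^ (p - 1) * ∫⁻ x, f x ^ p ∂μ := by
  have hp0 : 0 < p := by linarith
  have h := eLpNorm_le_eLpNorm_mul_rpow_measure_univ (p := 1) (q := ENNReal.ofReal p)
    (by simpa using hp) hf.aestronglyMeasurable
  rw [eLpNorm_one_eq_lintegral_enorm,
    eLpNorm_eq_lintegral_rpow_enorm_toReal (by simpa using hp0) (by simp),
    ENNReal.toReal_ofReal hp0.le] at h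
  simp only [enorm_eq_self] at h
  have h2 := ENNReal.rpow_le_rpow h hp0.le
  refine h2.trans (le_of_eq ?_)
  rw [ENNReal.mul_rpow_of_nonneg _ _ hp0.le, ← ENNReal.rpow_mul, one_div_mul_cancel hp0.ne',
    ENNReal.rpow_one, mul_comm, ← ENNReal.rpow_mul]
  congr 2
  rw [ENNReal.toReal_one, div_one, sub_mul, one_mul, one_div_mul_cancel hp0.ne']

section Chaining

open ProbabilityTheory

theorem isProbabilityMeasure_cond_collarBox {t : ℝ} (ht : 0 < t) :
    IsProbabilityMeasure (cond volume (collarBox t)) := by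
  refine cond_isProbabilityMeasure_of_finite ?_ ?_
  · rw [volume_collarBox ht]
    simp only [ne_eq, ENNReal.ofReal_eq_zero, not_le]
    positivity
  · rw [volume_collarBox ht]
    exact ENNReal.ofReal_ne_top

theorem lintegral_cond_collarBox {t : ℝ} (ht : 0 < t) (f : ℝ × ℝ → ℝ≥0∞) :
    ∫⁻ x, f x ∂(cond volume (collarBox t))
      = (ENNReal.ofReal (2 * t ^ 2))⁻¹ * ∫⁻ x in collarBox t, f x := by
  rw [ProbabilityTheory.cond, lintegral_smul_measure, volume_collarBox ht, smul_eq_mul]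

variable {D : ℝ × ℝ → ℝ × ℝ → ℝ≥0∞} {p β : ℝ} {Q : ℝ≥0∞}

theorem lintegral_cond_collarBox_le_half (hp : 1 ≤ p)
    (hm : Measurable fun z : (ℝ × ℝ) × (ℝ × ℝ) => D z.1 z.2)
    (htri : ∀ x y z, D x z ≤ D x y + D y z)
    (hD : ∀ t, 0 < t → t ≤ 1 / 4 → ∫⁻ x in collarBox t, ∫⁻ y in collarBox t, D x y ^ p
      ≤ ENNReal.ofReal (t ^ (β * p + 4)) * Q ^ p) {t : ℝ} (ht0 : 0 < t) (ht4 : t ≤ 1 / 4) :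
    ∫⁻ x, D 0 x ∂(cond volume (collarBox t)) ≤
      ∫⁻ x, D 0 x ∂(cond volume (collarBox (t / 2))) + ENNReal.ofReal (t ^ β) * Q := by
  have hp0 : 0 < p := by linarith
  have ht2 : 0 < t / 2 := by linarith
  have := isProbabilityMeasure_cond_collarBox ht0
  have := isProbabilityMeasure_cond_collarBox ht2
  set P := cond volume (collarBox t) with hP
  set P' := cond volume (collarBox (t / 2)) with hP'
  have hm0 : Measurable fun y => D 0 y := hm.comp (measurable_prodMk_left (x := (0 : ℝ × ℝ)))
  have h1 : ∫⁻ x, D 0 x ∂P ≤ ∫⁻ y, D 0 y ∂P' + ∫⁻ y, ∫⁻ x, D y x ∂P ∂P' := by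
    calc ∫⁻ x, D 0 x ∂P = ∫⁻ y, ∫⁻ x, D 0 x ∂P ∂P' := by simp
      _ ≤ ∫⁻ y, ∫⁻ x, (D 0 y + D y x) ∂P ∂P' :=
        lintegral_mono fun y => lintegral_mono fun x => htri 0 y x
      _ = ∫⁻ y, (D 0 y + ∫⁻ x, D y x ∂P) ∂P' := by
        refine lintegral_congr fun y => ?_
        rw [lintegral_add_left measurable_const, lintegral_const, measure_univ, mul_one]
      _ = _ := lintegral_add_left hm0 _
  refine h1.trans (add_le_add_right ?_ _)
  rw [← ENNReal.rpow_le_rpow_iff hp0]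
  calc (∫⁻ y, ∫⁻ x, D y x ∂P ∂P') ^ p ≤ ∫⁻ y, (∫⁻ x, D y x ∂P) ^ p ∂P' := by
        have := lintegral_rpow_le_measure_univ_mul (μ := P') hp
          (hm.lintegral_prod_right' (ν := P)).aemeasurable
        simpa using this
    _ ≤ ∫⁻ y, ∫⁻ x, D y x ^ p ∂P ∂P' := by
        refine lintegral_mono fun y => ?_
        have := lintegral_rpow_le_measure_univ_mul (μ := P) hp
          (hm.comp (measurable_prodMk_left (x := y))).aemeasurable
        simpa using this
    _ = (ENNReal.ofReal (2 * (t / 2) ^ 2))⁻¹ * ((ENNReal.ofReal (2 * t ^ 2))⁻¹ *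
          ∫⁻ y in collarBox (t / 2), ∫⁻ x in collarBox t, D y x ^ p) := by
        simp_rw [hP, hP', lintegral_cond_collarBox ht0]
        rw [lintegral_cond_collarBox ht2, lintegral_const_mul]
        exact (hm.pow_const p).lintegral_prod_right'
    _ ≤ (ENNReal.ofReal (2 * (t / 2) ^ 2))⁻¹ * ((ENNReal.ofReal (2 * t ^ 2))⁻¹ *
          (ENNReal.ofReal (t ^ (β * p + 4)) * Q ^ p)) := by
        gcongr
        refine le_trans (lintegral_mono_set ?_) (hD t ht0 ht4)
        exact prod_mono (Ioo_subset_Ioo_right (by linarith)) (Ioo_subset_Ioo (by linarith) (by linarith))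
    _ = (ENNReal.ofReal (t ^ β) * Q) ^ p := by
        rw [← ENNReal.ofReal_inv_of_pos (by positivity), ← ENNReal.ofReal_inv_of_pos (by positivity),
          ← mul_assoc, ← mul_assoc, ← ENNReal.ofReal_mul (by positivity),
          ← ENNReal.ofReal_mul (by positivity), ENNReal.mul_rpow_of_nonneg _ _ hp0.le,
          ENNReal.ofReal_rpow_of_nonneg (by positivity) hp0.le]
        congr 2
        rw [Real.rpow_add ht0, Real.rpow_mul ht0.le, show (4 : ℝ) = ((4 : ℕ) : ℝ) by norm_num,
          Real.rpow_natCast]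
        field_simp

/-- Chaining: a pseudo-distance whose averages over small boxes are small and which is continuous at
the origin has small averages of the distance to the origin. -/
theorem lintegral_cond_collarBox_le (hp : 1 ≤ p) (hβ : 0 < β)
    (hm : Measurable fun z : (ℝ × ℝ) × (ℝ × ℝ) => D z.1 z.2)
    (htri : ∀ x y z, D x z ≤ D x y + D y z)
    (hD : ∀ t, 0 < t → t ≤ 1 / 4 → ∫⁻ x in collarBox t, ∫⁻ y in collarBox t, D x y ^ p
      ≤ ENNReal.ofReal (t ^ (β * p + 4)) * Q ^ p)
    (h0 : ∀ ε : ℝ≥0∞, ε ≠ 0 → ∃ δ : ℝ, 0 < δ ∧ ∀ t, 0 < t → t ≤ δ → ∀ x ∈ collarBox t, D 0 x ≤ ε)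
    {t : ℝ} (ht0 : 0 < t) (ht4 : t ≤ 1 / 4) :
    ∫⁻ x, D 0 x ∂(cond volume (collarBox t))
      ≤ ENNReal.ofReal ((1 - (1 / 2) ^ β)⁻¹ * t ^ β) * Q := by
  set C : ℝ := (1 - (1 / 2) ^ β)⁻¹ with hC
  have hlt : (1 / 2 : ℝ) ^ β < 1 := Real.rpow_lt_one (by norm_num) (by norm_num) hβ
  have hC0 : 0 ≤ C := inv_nonneg.2 (by linarith)
  have hC1 : C * (1 / 2) ^ β + 1 = C := by
    have : C * (1 - (1 / 2) ^ β) = 1 := inv_mul_cancel₀ (by linarith)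
    linarith
  have hiter : ∀ (n : ℕ) (t : ℝ), 0 < t → t ≤ 1 / 4 → ∫⁻ x, D 0 x ∂(cond volume (collarBox t))
      ≤ ∫⁻ x, D 0 x ∂(cond volume (collarBox (t / 2 ^ n))) + ENNReal.ofReal (C * t ^ β) * Q := by
    intro n
    induction n with
    | zero =>
      intro t _ _
      simp
    | succ n ih =>
      intro t ht0 ht4
      refine (lintegral_cond_collarBox_le_half hp hm htri hD ht0 ht4).trans ?_
      have h1 := ih (t / 2) (by linarith) (by linarith)
      rw [div_div, ← pow_succ'] at h1
      refine (add_le_add_left h1 _).trans (le_of_eq ?_)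
      rw [add_assoc, ← add_mul, ← ENNReal.ofReal_add (by positivity) (by positivity)]
      congr 3
      rw [div_eq_mul_one_div t 2, Real.mul_rpow ht0.le (by norm_num)]
      nth_rewrite 2 [← hC1]
      ring
  refine ENNReal.le_of_forall_pos_le_add fun ε hε _ => ?_
  obtain ⟨δ, hδ0, hδ⟩ := h0 ε (by simpa using hε.ne')
  obtain ⟨n, hn⟩ := exists_pow_lt_of_lt_one (div_pos hδ0 ht0) (by norm_num : (1 / 2 : ℝ) < 1)
  have htn : 0 < t / 2 ^ n := by positivity
  have htδ : t / 2 ^ n ≤ δ := by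
    rw [lt_div_iff₀ ht0, one_div, inv_pow] at hn
    rw [div_eq_inv_mul]
    exact hn.le
  have := isProbabilityMeasure_cond_collarBox htn
  refine (hiter n t ht0 ht4).trans ?_
  rw [add_comm]
  refine add_le_add_right ?_ _
  calc ∫⁻ x, D 0 x ∂(cond volume (collarBox (t / 2 ^ n)))
      ≤ ∫⁻ _, (ε : ℝ≥0∞) ∂(cond volume (collarBox (t / 2 ^ n))) := by
        refine lintegral_mono_ae ?_
        refine (ae_cond_of_forall_mem (measurableSet_collarBox _) fun x hx => ?_)
        exact hδ _ htn htδ x hx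
    _ = ε := by simp

end Chaining

section TraceFractional

variable {q : ℕ} {V : Type*} [NormedAddCommGroup V] {p σ : ℝ} {φ : EuclideanSpace ℝ (Fin 2) → V}

theorem lintegral_collarNorm_le (hq : 8 ≤ q) (hp : 1 ≤ p) (hφ : Continuous φ) :
    ∫⁻ ρ in Ioo 0 (1 / 4), collarNorm q p φ ρ
      ≤ 4 * eLpNorm φ (ENNReal.ofReal p) (volume.restrict (omegaDomain q)) := by
  have hp0 : 0 < p := by linarith
  rw [← ENNReal.rpow_le_rpow_iff hp0]
  refine (lintegral_rpow_le_measure_univ_mul hp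
    (measurable_collarNorm hq hp0 hφ).aemeasurable).trans ?_
  have h1 : (volume.restrict (Ioo (0 : ℝ) (1 / 4)) univ) ^ (p - 1) ≤ 1 := by
    refine ENNReal.rpow_le_one ?_ (by linarith)
    rw [Measure.restrict_apply_univ, Real.volume_Ioo]
    exact ENNReal.ofReal_le_one.2 (by norm_num)
  calc _ ≤ 1 * (4 * eLpNorm φ (ENNReal.ofReal p) (volume.restrict (omegaDomain q)) ^ p) := by
        gcongr
        exact lintegral_collarNorm_rpow_le hq hp0 hφ
    _ ≤ _ := by
        rw [one_mul, ENNReal.mul_rpow_of_nonneg _ _ hp0.le]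
        gcongr
        calc (4 : ℝ≥0∞) = 4 ^ (1 : ℝ) := (ENNReal.rpow_one _).symm
          _ ≤ 4 ^ p := ENNReal.rpow_le_rpow_of_exponent_le (by norm_num) hp

/-- In the averages of `D 0`, the two halves of the box give the distance of two points of the
boundary. -/
theorem collarDist_boundary_le (hq : 8 ≤ q) (hp : 1 ≤ p) (hφ : Continuous φ) {h : ℝ} (hh : 0 < h) :
    collarDist q p φ 0 (0, h)
      ≤ 4 * ∫⁻ x, collarDist q p φ 0 x ∂(ProbabilityTheory.cond volume (collarBox h)) := by
  have hp0 : 0 < p := by linarith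
  set D := collarDist q p φ with hD
  have hm := measurable_collarDist (φ := φ) hq hp0 hφ
  have hm0 : Measurable fun x => D 0 x := Measurable.of_uncurry_left (f := D) hm
  set I := ∫⁻ x in collarBox h, D 0 x with hI
  have hIe : I = ∫⁻ ρ in Ioo 0 h, ∫⁻ b in Ioo (-h) h, D 0 (ρ, b) := lintegral_collarBox h _ hm0
  have key : ENNReal.ofReal (h ^ 2) * D 0 (0, h) ≤ 2 * I := by
    have hsh : ∀ ρ b, D (ρ, b) (0, h) = D 0 (ρ, b - h) := by
      intro ρ b
      have := collarDist_add_snd (φ := φ) hq hp0 ρ (b - h) 0 0 h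
      rw [sub_add_cancel, zero_add] at this
      rw [hD, this, collarDist_comm]
      rfl
    have e1 : ENNReal.ofReal (h ^ 2) * D 0 (0, h)
        = ∫⁻ _ in Ioo 0 h, ∫⁻ _ in Ioo 0 h, D 0 (0, h) := by
      simp only [lintegral_const, Measure.restrict_apply_univ, Real.volume_Ioo, sub_zero]
      rw [mul_assoc, ← ENNReal.ofReal_mul hh.le, mul_comm, sq]
    rw [e1]
    have hmρ : ∀ ρ : ℝ, Measurable fun b : ℝ => D 0 (ρ, b) :=
      fun ρ => hm0.comp measurable_prodMk_left
    have hshift : ∀ ρ, ∫⁻ b in Ioo 0 h, D 0 (ρ, b - h) = ∫⁻ b in Ioo (-h) 0, D 0 (ρ, b) := by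
      intro ρ
      rw [← lintegral_indicator measurableSet_Ioo, ← lintegral_indicator measurableSet_Ioo,
        ← lintegral_sub_right_eq_self (fun b => (Ioo (-h) 0).indicator (fun b => D 0 (ρ, b)) b) h]
      refine lintegral_congr fun b => ?_
      have : b ∈ Ioo 0 h ↔ b - h ∈ Ioo (-h) 0 := by
        simp only [mem_Ioo]
        constructor <;> rintro ⟨h1, h2⟩ <;> constructor <;> linarith
      by_cases hb : b ∈ Ioo 0 h
      · rw [indicator_of_mem hb, indicator_of_mem (this.1 hb)]
      · rw [indicator_of_notMem hb, indicator_of_notMem (fun hh => hb (this.2 hh))]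
    calc _ ≤ ∫⁻ ρ in Ioo 0 h, ∫⁻ b in Ioo 0 h, (D 0 (ρ, b) + D 0 (ρ, b - h)) := by
          refine lintegral_mono fun ρ => lintegral_mono fun b => ?_
          rw [← hsh]
          exact collarDist_triangle hq hp hφ _ _ _
      _ = ∫⁻ ρ in Ioo 0 h, ((∫⁻ b in Ioo 0 h, D 0 (ρ, b)) + ∫⁻ b in Ioo (-h) 0, D 0 (ρ, b)) := by
          refine lintegral_congr fun ρ => ?_
          rw [lintegral_add_left (hmρ ρ), hshift]
      _ ≤ ∫⁻ ρ in Ioo 0 h, 2 * ∫⁻ b in Ioo (-h) h, D 0 (ρ, b) := by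
          refine lintegral_mono fun ρ => ?_
          rw [two_mul]
          exact add_le_add (lintegral_mono_set (Ioo_subset_Ioo_left (by linarith)))
            (lintegral_mono_set (Ioo_subset_Ioo_right hh.le))
      _ = 2 * I := by rw [lintegral_const_mul' _ _ (by simp), hIe]
  rw [lintegral_cond_collarBox hh]
  have hpos : ENNReal.ofReal (h ^ 2) ≠ 0 := by
    simp only [ne_eq, ENNReal.ofReal_eq_zero, not_le]
    positivity
  rw [← ENNReal.mul_le_mul_iff_right hpos ENNReal.ofReal_ne_top]
  refine key.trans (le_of_eq ?_)
  rw [← ENNReal.ofReal_inv_of_pos (by positivity), show (4 : ℝ≥0∞) = ENNReal.ofReal 4 by simp,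
    ← mul_assoc, ← mul_assoc, ← ENNReal.ofReal_mul (by positivity),
    ← ENNReal.ofReal_mul (by positivity)]
  congr 1
  rw [show h ^ 2 * 4 * (2 * h ^ 2)⁻¹ = 2 by field_simp; norm_num]
  simp

theorem collarNorm_zero_le (hq : 8 ≤ q) (hp : 1 ≤ p) (hφ : Continuous φ) :
    collarNorm q p φ 0
      ≤ ∫⁻ x, collarDist q p φ 0 x ∂(ProbabilityTheory.cond volume (collarBox (1 / 4)))
        + 16 * eLpNorm φ (ENNReal.ofReal p) (volume.restrict (omegaDomain q)) := by
  have hp0 : 0 < p := by linarith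
  have h4 : (0 : ℝ) < 1 / 4 := by norm_num
  have := isProbabilityMeasure_cond_collarBox h4
  have hm0 : Measurable fun x => collarDist q p φ 0 x :=
    Measurable.of_uncurry_left (f := collarDist q p φ) (measurable_collarDist hq hp0 hφ)
  have hmN := measurable_collarNorm (φ := φ) hq hp0 hφ
  calc collarNorm q p φ 0
      = ∫⁻ _, collarNorm q p φ 0 ∂(ProbabilityTheory.cond volume (collarBox (1 / 4))) := by
        rw [lintegral_const, measure_univ, mul_one]
    _ ≤ ∫⁻ x, (collarDist q p φ 0 x + collarNorm q p φ x.1)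
          ∂(ProbabilityTheory.cond volume (collarBox (1 / 4))) :=
        lintegral_mono fun x => collarNorm_le_add hq hp hφ 0 x
    _ = _ := lintegral_add_left hm0 _
    _ ≤ _ := by
        refine add_le_add_right ?_ _
        rw [lintegral_cond_collarBox h4, 
          lintegral_collarBox _ (fun x => collarNorm q p φ x.1) (hmN.comp measurable_fst)]
        simp only [lintegral_const, Measure.restrict_apply_univ, Real.volume_Ioo]
        rw [lintegral_mul_const' _ _ (by simp), mul_comm (lintegral _ _), ← mul_assoc,
          ← ENNReal.ofReal_inv_of_pos (by norm_num), ← ENNReal.ofReal_mul (by norm_num)]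
        have e : ENNReal.ofReal ((2 * (1 / 4) ^ 2)⁻¹ * (1 / 4 - -(1 / 4))) = 4 := by norm_num
        rw [e, show (16 : ℝ≥0∞) = 4 * 4 by norm_num, mul_assoc]
        gcongr
        exact lintegral_collarNorm_le hq hp hφ

/-- The trace inequality and the modulus of continuity of the trace, fractional case. -/
theorem trace_bounds_of_slobodeckij (hq : 8 ≤ q) (hp : 1 ≤ p) (hσ : 1 / p < σ) :
    ∃ C : ℝ≥0∞, C ≠ ⊤ ∧ ∀ φ : EuclideanSpace ℝ (Fin 2) → V, Continuous φ →
      collarNorm q p φ 0 ≤ C * (eLpNorm φ (ENNReal.ofReal p) (volume.restrict (omegaDomain q))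
        + slobodeckijSeminorm (omegaDomain q) σ p φ) ∧
      ∀ h, 0 < h → h ≤ 1 / 16 → collarDist q p φ 0 (0, h) ≤ C * ENNReal.ofReal (h ^ (σ - 1 / p)) *
        (eLpNorm φ (ENNReal.ofReal p) (volume.restrict (omegaDomain q))
        + slobodeckijSeminorm (omegaDomain q) σ p φ) := by
  have hp0 : 0 < p := by linarith
  have hσ0 : 0 < σ := lt_trans (by positivity) hσ
  set β := σ - 1 / p with hβ
  have hβ0 : 0 < β := by linarith
  set A : ℝ := (1 - (1 / 2) ^ β)⁻¹ with hA
  have hlt : (1 / 2 : ℝ) ^ β < 1 := Real.rpow_lt_one (by norm_num) (by norm_num) hβ0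
  have hA0 : 0 ≤ A := inv_nonneg.2 (by linarith)
  set B : ℝ := (32 * 5 ^ (2 + σ * p)) ^ (1 / p) with hB
  have hB0 : 0 ≤ B := by positivity
  refine ⟨ENNReal.ofReal (4 * A * B) + 16, by simp, fun φ hφ => ?_⟩
  set S := slobodeckijSeminorm (omegaDomain q) σ p φ with hS
  set L := eLpNorm φ (ENNReal.ofReal p) (volume.restrict (omegaDomain q))
  have hD : ∀ t, 0 < t → t ≤ 1 / 4 →
      ∫⁻ x in collarBox t, ∫⁻ y in collarBox t, collarDist q p φ x y ^ p
      ≤ ENNReal.ofReal (t ^ (β * p + 4)) * (ENNReal.ofReal B * S) ^ p := by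
    intro t ht0 ht4
    refine (lintegral_collarDist_rpow_le hq hp0 hσ0 hφ ht0 ht4).trans (le_of_eq ?_)
    rw [ENNReal.mul_rpow_of_nonneg _ _ hp0.le, ENNReal.ofReal_rpow_of_nonneg hB0 hp0.le, ← mul_assoc,
      ← ENNReal.ofReal_mul (by positivity), hB, ← Real.rpow_mul (by positivity),
      one_div_mul_cancel hp0.ne', Real.rpow_one, mul_comm (t ^ _)]
    congr 4
    rw [hβ, sub_mul, one_div_mul_cancel hp0.ne']
    ring
  have hav : ∀ t, 0 < t → t ≤ 1 / 4 →
      ∫⁻ x, collarDist q p φ 0 x ∂(ProbabilityTheory.cond volume (collarBox t))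
        ≤ ENNReal.ofReal (A * t ^ β) * (ENNReal.ofReal B * S) := fun t ht0 ht4 =>
    lintegral_cond_collarBox_le hp hβ0 (measurable_collarDist hq hp0 hφ)
      (collarDist_triangle hq hp hφ) hD (fun ε hε => tendsto_collarDist_zero hq hφ hε) ht0 ht4
  constructor
  · refine (collarNorm_zero_le hq hp hφ).trans ?_
    refine (add_le_add_left (hav (1 / 4) (by norm_num) le_rfl) _).trans ?_
    rw [← mul_assoc, ← ENNReal.ofReal_mul (by positivity), add_comm, mul_add]
    refine add_le_add ?_ ?_
    · gcongr
      exact le_add_self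
    · gcongr
      refine le_trans (ENNReal.ofReal_le_ofReal ?_) le_self_add
      have h1 : (1 / 4 : ℝ) ^ β ≤ 1 := Real.rpow_le_one (by norm_num) (by norm_num) hβ0.le
      have h2 : A * (1 / 4) ^ β * B = (A * B) * (1 / 4 : ℝ) ^ β := by ring
      have h3 : 0 ≤ A * B := by positivity
      rw [h2]
      nlinarith
  · intro h h0 h16
    refine (collarDist_boundary_le hq hp hφ h0).trans ?_
    calc _ ≤ 4 * (ENNReal.ofReal (A * h ^ β) * (ENNReal.ofReal B * S)) := by
          gcongr
          exact hav h h0 (by linarith)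
      _ = ENNReal.ofReal (4 * A * B) * ENNReal.ofReal (h ^ β) * S := by
          rw [show (4 : ℝ≥0∞) = ENNReal.ofReal 4 by simp, ← mul_assoc, ← mul_assoc,
            ← ENNReal.ofReal_mul (by positivity), ← ENNReal.ofReal_mul (by positivity),
            ← ENNReal.ofReal_mul (by positivity)]
          congr 2
          ring
      _ ≤ _ := by
          gcongr
          · exact le_self_add
          · exact le_add_self

end TraceFractional

section Gradient

variable {d : ℕ} {V : Type*} [NormedAddCommGroup V] [NormedSpace ℝ V]

theorem enorm_clm_le_sum (T : EuclideanSpace ℝ (Fin d) →L[ℝ] V) :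
    ‖T‖ₑ ≤ ∑ i, ‖T (EuclideanSpace.single i 1)‖ₑ := by
  have h : ‖T‖ ≤ ∑ i, ‖T (EuclideanSpace.single i 1)‖ := by
    refine T.opNorm_le_bound (Finset.sum_nonneg fun i _ => norm_nonneg _) fun x => ?_
    have hx : x = ∑ i, x i • EuclideanSpace.single i (1 : ℝ) := by
      ext j
      simp [Finset.sum_apply, Pi.single_apply]
    conv_lhs => rw [hx]
    rw [map_sum, Finset.sum_mul]
    refine (norm_sum_le _ _).trans (Finset.sum_le_sum fun i _ => ?_)
    rw [map_smul, norm_smul, mul_comm]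
    exact mul_le_mul_of_nonneg_left (PiLp.norm_apply_le x i) (norm_nonneg _)
  rw [← ofReal_norm]
  refine (ENNReal.ofReal_le_ofReal h).trans ?_
  rw [ENNReal.ofReal_sum_of_nonneg fun i _ => norm_nonneg _]
  simp only [ofReal_norm, le_refl]

theorem eLpNorm_clm_le_sum {X : Type*} [MeasurableSpace X] {μ : Measure X} {p : ℝ≥0∞} (hp : 1 ≤ p)
    {g : X → EuclideanSpace ℝ (Fin d) →L[ℝ] V} (hg : AEStronglyMeasurable g μ) :
    eLpNorm g p μ ≤ ∑ i, eLpNorm (fun x => g x (EuclideanSpace.single i 1)) p μ := by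
  have hm : ∀ i, AEStronglyMeasurable (fun x => g x (EuclideanSpace.single i 1)) μ := fun i =>
    (ContinuousLinearMap.apply ℝ V (EuclideanSpace.single i (1 : ℝ))).continuous.comp_aestronglyMeasurable hg
  calc eLpNorm g p μ
      ≤ eLpNorm (∑ i, fun x => ‖g x (EuclideanSpace.single i 1)‖) p μ := by
        refine eLpNorm_mono_enorm fun x => ?_
        refine (enorm_clm_le_sum (g x)).trans (le_of_eq ?_)
        rw [Finset.sum_apply, Real.enorm_of_nonneg (Finset.sum_nonneg fun i _ => norm_nonneg _),
          ENNReal.ofReal_sum_of_nonneg fun i _ => norm_nonneg _]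
        simp only [ofReal_norm]
    _ ≤ ∑ i, eLpNorm (fun x => ‖g x (EuclideanSpace.single i 1)‖) p μ :=
        eLpNorm_sum_le (fun i _ => (hm i).norm) hp
    _ = _ := by simp only [eLpNorm_norm]

end Gradient

section Boundary

variable {q : ℕ} {V : Type*} [NormedAddCommGroup V] {p : ℝ} {φ : EuclideanSpace ℝ (Fin 2) → V}

/-- The distance of two boundary values, by way of an inner point. -/
theorem collarDist_boundary_le_add (hq : 8 ≤ q) (hp : 1 ≤ p) (hφ : Continuous φ) (h : ℝ) :
    collarDist q p φ 0 (0, h) ≤ collarDist q p φ (0, 0) (0 + h / 2, 1 * (h / 2))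
      + collarDist q p φ (0, 0) (0 + h / 2, (-1) * (h / 2)) := by
  have hp0 : 0 < p := by linarith
  refine (collarDist_triangle hq hp hφ 0 (0 + h / 2, 1 * (h / 2)) (0, h)).trans (le_of_eq ?_)
  have e := collarDist_add_snd (φ := φ) hq hp0 0 0 (0 + h / 2) ((-1) * (h / 2)) h
  rw [← e, collarDist_comm (0 + h / 2, 1 * (h / 2)), zero_add h]
  congr 4
  ring

end Boundary

section TraceGradient

variable {q : ℕ} {V : Type*} [NormedAddCommGroup V] [NormedSpace ℝ V] {p σ : ℝ}
  {φ : EuclideanSpace ℝ (Fin 2) → V}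

theorem toLp_pair_eq (x y : ℝ) : (!₂[x, y] : EuclideanSpace ℝ (Fin 2))
    = x • EuclideanSpace.single 0 1 + y • EuclideanSpace.single 1 1 := by
  ext i
  fin_cases i <;> simp

/-- The velocity of the curve `s ↦ stripPoint q (ρ + s) (θ + a s)`. -/
noncomputable def stripVelocity (q : ℕ) (ρ θ a s : ℝ) : EuclideanSpace ℝ (Fin 2) :=
  (radiusFun q (θ + a * s) - (ρ + s)) • a • !₂[-sin (θ + a * s), cos (θ + a * s)] +
    (lacunary q (θ + a * s) * a - 1) • !₂[cos (θ + a * s), sin (θ + a * s)]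

theorem hasDerivAt_stripPoint (hq : 8 ≤ q) (ρ θ a s : ℝ) :
    HasDerivAt (fun s => stripPoint q (ρ + s) (θ + a * s)) (stripVelocity q ρ θ a s) s := by
  have h0 : HasDerivAt (fun s : ℝ => θ + a * s) a s := by
    simpa using ((hasDerivAt_id s).const_mul a).const_add θ
  have h1 : HasDerivAt (fun s : ℝ => radiusFun q (θ + a * s) - (ρ + s))
      (lacunary q (θ + a * s) * a - 1) s :=
    ((radiusFun_hasDerivAt hq _).comp s h0).sub ((hasDerivAt_id s).const_add ρ)
  have h2 : HasDerivAt (fun s : ℝ => (!₂[cos (θ + a * s), sin (θ + a * s)] : EuclideanSpace ℝ (Fin 2)))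
      (a • !₂[-sin (θ + a * s), cos (θ + a * s)]) s := by
    have := (h0.cos.smul_const (EuclideanSpace.single (0 : Fin 2) (1 : ℝ))).add
      (h0.sin.smul_const (EuclideanSpace.single (1 : Fin 2) (1 : ℝ)))
    simp_rw [toLp_pair_eq]
    convert! this using 1
    module
  simp_rw [stripPoint_eq_smul]
  exact h1.smul h2

theorem norm_stripVelocity_le (hq : 8 ≤ q) {ρ θ a s : ℝ} (hρ : ρ + s ∈ Icc (0 : ℝ) (1 / 4))
    (ha : |a| ≤ 1) : ‖stripVelocity q ρ θ a s‖ ≤ 3 := by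
  have hF := radiusFun_mem_Icc hq (θ + a * s)
  have hf := lacunary_abs_le hq (θ + a * s)
  have h1 : |radiusFun q (θ + a * s) - (ρ + s)| ≤ 3 / 2 := by
    rw [abs_le]
    constructor <;> linarith [hρ.1, hρ.2, hF.1, hF.2]
  have h2 : |lacunary q (θ + a * s) * a - 1| ≤ 8 / 7 := by
    refine (abs_sub _ _).trans ?_
    rw [abs_mul, abs_one]
    have := mul_le_mul hf ha (abs_nonneg _) (by norm_num)
    linarith
  have e : ‖(!₂[-sin (θ + a * s), cos (θ + a * s)] : EuclideanSpace ℝ (Fin 2))‖ = 1 := by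
    rw [← sq_eq_sq₀ (norm_nonneg _) zero_le_one, norm_toLp_pair_sq, one_pow, neg_sq,
      sin_sq_add_cos_sq]
  refine (norm_add_le _ _).trans ?_
  rw [norm_smul, norm_smul, norm_smul, norm_cos_sin, e, mul_one, mul_one, Real.norm_eq_abs,
    Real.norm_eq_abs, Real.norm_eq_abs]
  have := mul_le_mul h1 ha (abs_nonneg _) (by norm_num)
  linarith

theorem continuous_stripVelocity (hq : 8 ≤ q) (ρ θ a : ℝ) : Continuous (stripVelocity q ρ θ a) := by
  have h1 := radiusFun_continuous hq
  have h2 := lacunary_continuous hq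
  unfold stripVelocity
  fun_prop

variable [CompleteSpace V]

theorem enorm_comp_stripPoint_sub_le (hq : 8 ≤ q) (hφ : ContDiff ℝ ∞ φ) {ρ t a : ℝ} (hρ : 0 ≤ ρ)
    (ht : 0 < t) (hρt : ρ + t ≤ 1 / 4) (ha : |a| ≤ 1) (θ : ℝ) :
    ‖φ (stripPoint q ρ θ) - φ (stripPoint q (ρ + t) (θ + a * t))‖ₑ
      ≤ 3 * ∫⁻ s in Ioo 0 t, ‖fderiv ℝ φ (stripPoint q (ρ + s) (θ + a * s))‖ₑ := by
  have hd : ∀ s, HasDerivAt (fun s => φ (stripPoint q (ρ + s) (θ + a * s)))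
      (fderiv ℝ φ (stripPoint q (ρ + s) (θ + a * s)) (stripVelocity q ρ θ a s)) s := fun s =>
    ((hφ.differentiable (by simp) _).hasFDerivAt).comp_hasDerivAt s (hasDerivAt_stripPoint hq ρ θ a s)
  have hsc : Continuous fun s => stripPoint q (ρ + s) (θ + a * s) :=
    continuous_iff_continuousAt.2 fun s => (hasDerivAt_stripPoint hq ρ θ a s).continuousAt
  have hc : Continuous fun s =>
      fderiv ℝ φ (stripPoint q (ρ + s) (θ + a * s)) (stripVelocity q ρ θ a s) :=
    ((hφ.continuous_fderiv (by simp)).comp hsc).clm_apply (continuous_stripVelocity hq ρ θ a)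
  have h := intervalIntegral.integral_eq_sub_of_hasDerivAt (a := 0) (b := t) (fun s _ => hd s)
    (hc.intervalIntegrable _ _)
  simp only [add_zero, mul_zero] at h
  rw [← enorm_neg, neg_sub, ← h, intervalIntegral.integral_of_le ht.le,
    ← restrict_Ioo_eq_restrict_Ioc, ← lintegral_const_mul' _ _ (by simp)]
  refine (enorm_integral_le_lintegral_enorm _).trans
    (setLIntegral_mono' measurableSet_Ioo fun s hs => ?_)
  refine (ContinuousLinearMap.le_opENorm _ _).trans ?_
  rw [mul_comm (3 : ℝ≥0∞)]
  refine mul_le_mul_right ?_ _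
  rw [← ofReal_norm, show (3 : ℝ≥0∞) = ENNReal.ofReal 3 by simp]
  exact ENNReal.ofReal_le_ofReal
    (norm_stripVelocity_le hq ⟨by linarith [hs.1], by linarith [hs.2]⟩ ha)

theorem collarDist_slope_rpow_le (hq : 8 ≤ q) (hp : 1 ≤ p) (hφ : ContDiff ℝ ∞ φ) {ρ t a : ℝ}
    (hρ : 0 ≤ ρ) (ht : 0 < t) (hρt : ρ + t ≤ 1 / 4) (ha : |a| ≤ 1) :
    collarDist q p φ (ρ, 0) (ρ + t, a * t) ^ p ≤ ENNReal.ofReal (3 ^ p * t ^ (p - 1)) *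
      ∫⁻ r in Ioo ρ (ρ + t), collarNorm q p (fderiv ℝ φ) r ^ p := by
  have hp0 : 0 < p := by linarith
  have hfc : Continuous (fderiv ℝ φ) := hφ.continuous_fderiv (by simp)
  set g : ℝ → ℝ → ℝ≥0∞ := fun θ s => ‖fderiv ℝ φ (stripPoint q (ρ + s) (θ + a * s))‖ₑ with hg
  have hgm : Measurable (Function.uncurry g) := by
    refine Continuous.measurable (Continuous.enorm (hfc.comp ?_))
    exact (stripPoint_continuous hq).comp
      (by fun_prop : Continuous fun z : ℝ × ℝ => (ρ + z.2, z.1 + a * z.2))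
  rw [collarDist, eLpNorm_ofReal_exponent_rpow hp0]
  calc ∫⁻ θ, ‖φ (stripPoint q ρ (θ + 0)) - φ (stripPoint q (ρ + t) (θ + a * t))‖ₑ ^ p ∂angleMeasure
      ≤ ∫⁻ θ, ENNReal.ofReal (3 ^ p * t ^ (p - 1)) *
          (∫⁻ s in Ioo 0 t, g θ s ^ p) ∂angleMeasure := by
        refine lintegral_mono fun θ => ?_
        rw [add_zero]
        have h1 := ENNReal.rpow_le_rpow
          (enorm_comp_stripPoint_sub_le hq hφ hρ ht hρt ha θ) hp0.le
        refine h1.trans ?_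
        rw [ENNReal.mul_rpow_of_nonneg _ _ hp0.le, ENNReal.ofReal_mul (by positivity), mul_assoc]
        have h2 := lintegral_rpow_le_measure_univ_mul (μ := volume.restrict (Ioo 0 t)) hp
          (f := g θ) (hgm.of_uncurry_left.aemeasurable)
        rw [Measure.restrict_apply_univ, Real.volume_Ioo, sub_zero,
          ENNReal.ofReal_rpow_of_pos ht] at h2
        rw [← ENNReal.ofReal_rpow_of_pos (by norm_num : (0 : ℝ) < 3)]
        simp only [ENNReal.ofReal_ofNat]
        gcongr
    _ = ENNReal.ofReal (3 ^ p * t ^ (p - 1)) *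
          ∫⁻ s in Ioo 0 t, ∫⁻ θ, g θ s ^ p ∂angleMeasure := by
        rw [lintegral_const_mul' _ _ (by simp)]
        congr 1
        exact lintegral_lintegral_swap (hgm.pow_const p).aemeasurable
    _ = ENNReal.ofReal (3 ^ p * t ^ (p - 1)) *
          ∫⁻ s in Ioo 0 t, collarNorm q p (fderiv ℝ φ) (ρ + s) ^ p := by
        congr 1
        refine lintegral_congr fun s => ?_
        rw [collarNorm, eLpNorm_ofReal_exponent_rpow hp0]
        exact lintegral_angleMeasure_add
          (k := fun θ => ‖fderiv ℝ φ (stripPoint q (ρ + s) θ)‖ₑ ^ p)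
          (fun θ => by simp only [stripPoint_periodic hq (ρ + s) θ]) (a * s)
    _ = _ := by
        congr 1
        rw [← lintegral_indicator measurableSet_Ioo, ← lintegral_indicator measurableSet_Ioo,
          ← lintegral_add_left_eq_self
            (fun r => (Ioo ρ (ρ + t)).indicator (fun r => collarNorm q p (fderiv ℝ φ) r ^ p) r) ρ]
        refine lintegral_congr fun s => ?_
        have : s ∈ Ioo 0 t ↔ ρ + s ∈ Ioo ρ (ρ + t) := by
          simp only [mem_Ioo]
          constructor <;> rintro ⟨h1, h2⟩ <;> constructor <;> linarith
        by_cases hs : s ∈ Ioo 0 t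
        · rw [indicator_of_mem hs, indicator_of_mem (this.1 hs)]
        · rw [indicator_of_notMem hs, indicator_of_notMem (fun hh => hs (this.2 hh))]

theorem collarDist_slope_le (hq : 8 ≤ q) (hp : 1 ≤ p) (hφ : ContDiff ℝ ∞ φ) {ρ t a : ℝ}
    (hρ : 0 ≤ ρ) (ht : 0 < t) (hρt : ρ + t ≤ 1 / 4) (ha : |a| ≤ 1) :
    collarDist q p φ (ρ, 0) (ρ + t, a * t) ≤ ENNReal.ofReal (12 * t ^ (1 - 1 / p)) *
      eLpNorm (fderiv ℝ φ) (ENNReal.ofReal p) (volume.restrict (omegaDomain q)) := by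
  have hp0 : 0 < p := by linarith
  have hfc : Continuous (fderiv ℝ φ) := hφ.continuous_fderiv (by simp)
  rw [← ENNReal.rpow_le_rpow_iff hp0]
  refine (collarDist_slope_rpow_le hq hp hφ hρ ht hρt ha).trans ?_
  have h1 : ∫⁻ r in Ioo ρ (ρ + t), collarNorm q p (fderiv ℝ φ) r ^ p
      ≤ 4 * eLpNorm (fderiv ℝ φ) (ENNReal.ofReal p) (volume.restrict (omegaDomain q)) ^ p :=
    (lintegral_mono_set (Ioo_subset_Ioo hρ hρt)).trans (lintegral_collarNorm_rpow_le hq hp0 hfc)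
  refine (mul_le_mul_right h1 _).trans ?_
  rw [ENNReal.mul_rpow_of_nonneg _ _ hp0.le, ENNReal.ofReal_rpow_of_nonneg (by positivity) hp0.le,
    ← mul_assoc]
  refine mul_le_mul_left ?_ _
  rw [show (4 : ℝ≥0∞) = ENNReal.ofReal 4 by simp, ← ENNReal.ofReal_mul (by positivity)]
  refine ENNReal.ofReal_le_ofReal ?_
  rw [Real.mul_rpow (by norm_num) (by positivity), ← Real.rpow_mul ht.le, sub_mul, one_mul,
    one_div_mul_cancel hp0.ne', show (12 : ℝ) = 3 * 4 by norm_num,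
    Real.mul_rpow (by norm_num) (by norm_num)]
  have h4 : (4 : ℝ) ≤ 4 ^ p := by
    simpa using Real.rpow_le_rpow_of_exponent_le (by norm_num : (1 : ℝ) ≤ 4) hp
  have : 0 ≤ (3 : ℝ) ^ p * t ^ (p - 1) := by positivity
  nlinarith

theorem collarNorm_le_of_gradient (hq : 8 ≤ q) (hp : 1 ≤ p) (hφ : ContDiff ℝ ∞ φ) {ρ : ℝ}
    (hρ : ρ ∈ Icc (0 : ℝ) (1 / 4)) : collarNorm q p φ ρ ≤
      16 * (eLpNorm φ (ENNReal.ofReal p) (volume.restrict (omegaDomain q)) +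
        eLpNorm (fderiv ℝ φ) (ENNReal.ofReal p) (volume.restrict (omegaDomain q))) := by
  have hp0 : 0 < p := by linarith
  set L := eLpNorm φ (ENNReal.ofReal p) (volume.restrict (omegaDomain q))
  set G := eLpNorm (fderiv ℝ φ) (ENNReal.ofReal p) (volume.restrict (omegaDomain q))
  have hlt : ∀ r r', 0 ≤ r → r < r' → r' ≤ 1 / 4 → collarDist q p φ (r, 0) (r', 0) ≤ 12 * G := by
    intro r r' h0 h1 h2
    have := collarDist_slope_le (a := 0) (t := r' - r) hq hp hφ h0 (by linarith) (by linarith)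
      (by simp)
    rw [add_sub_cancel, zero_mul] at this
    refine this.trans ?_
    gcongr
    have h3 : (r' - r) ^ (1 - 1 / p) ≤ 1 := by
      refine Real.rpow_le_one (by linarith) (by linarith) ?_
      have : 1 / p ≤ 1 := by
        rw [div_le_one hp0]
        exact hp
      linarith
    calc ENNReal.ofReal (12 * (r' - r) ^ (1 - 1 / p)) ≤ ENNReal.ofReal 12 :=
          ENNReal.ofReal_le_ofReal (by linarith)
      _ = 12 := by simp
  have hall : ∀ r ∈ Ioo (0 : ℝ) (1 / 4), collarNorm q p φ ρ ≤ 12 * G + collarNorm q p φ r := by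
    intro r hr
    refine (collarNorm_le_add hq hp hφ.continuous (ρ, 0) (r, 0)).trans (add_le_add_left ?_ _)
    rcases lt_trichotomy ρ r with h | h | h
    · exact hlt ρ r hρ.1 h hr.2.le
    · subst h
      simp [collarDist]
    · rw [collarDist_comm]
      exact hlt r ρ hr.1.le h hρ.2
  have hint : collarNorm q p φ ρ * ENNReal.ofReal (1 / 4)
      ≤ 12 * G * ENNReal.ofReal (1 / 4) + 4 * L := by
    have hv : volume.restrict (Ioo (0 : ℝ) (1 / 4)) univ = ENNReal.ofReal (1 / 4) := by
      rw [Measure.restrict_apply_univ, Real.volume_Ioo, sub_zero]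
    calc _ = ∫⁻ _ in Ioo (0 : ℝ) (1 / 4), collarNorm q p φ ρ := by rw [lintegral_const, hv]
      _ ≤ ∫⁻ r in Ioo (0 : ℝ) (1 / 4), (12 * G + collarNorm q p φ r) :=
        setLIntegral_mono' measurableSet_Ioo hall
      _ = 12 * G * ENNReal.ofReal (1 / 4) + ∫⁻ r in Ioo (0 : ℝ) (1 / 4), collarNorm q p φ r := by
        rw [lintegral_add_left measurable_const, lintegral_const, hv]
      _ ≤ _ := by
        gcongr
        exact lintegral_collarNorm_le hq hp hφ.continuous
  have e4 : ENNReal.ofReal (1 / 4) * 4 = 1 := by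
    rw [show (4 : ℝ≥0∞) = ENNReal.ofReal 4 by simp, ← ENNReal.ofReal_mul (by norm_num)]
    norm_num
  calc collarNorm q p φ ρ = collarNorm q p φ ρ * ENNReal.ofReal (1 / 4) * 4 := by
        rw [mul_assoc, e4, mul_one]
    _ ≤ (12 * G * ENNReal.ofReal (1 / 4) + 4 * L) * 4 := by gcongr
    _ = 12 * G * (ENNReal.ofReal (1 / 4) * 4) + 16 * L := by ring
    _ = 12 * G + 16 * L := by rw [e4, mul_one]
    _ ≤ 16 * G + 16 * L := by
        gcongr
        norm_num
    _ = 16 * (L + G) := by ring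

end TraceGradient

section Layer

variable {q : ℕ} {V : Type*} [NormedAddCommGroup V] {σ : ℝ} {v : EuclideanSpace ℝ (Fin 2) → V}

/-- A function with a finite Slobodeckij seminorm has a small integral over a thin layer at the
boundary. -/
theorem lintegral_layer_le_of_slobodeckij (hq : 8 ≤ q) (hσ : 0 < σ) (hv : Continuous v) {h T : ℝ}
    (h0 : 0 < h) (hT : h ≤ T) (hT4 : T ≤ 1 / 4) :
    ∫⁻ ρ in Ioo 0 h, collarNorm q 1 v ρ
      ≤ ENNReal.ofReal (8 * 5 ^ (2 + σ) * T ^ σ) * slobodeckijSeminorm (omegaDomain q) σ 1 v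
        + ENNReal.ofReal (4 * (h / T)) * eLpNorm v (ENNReal.ofReal 1)
          (volume.restrict (omegaDomain q)) := by
  have hT0 : 0 < T := h0.trans_le hT
  set L := eLpNorm v (ENNReal.ofReal 1) (volume.restrict (omegaDomain q))
  set S := slobodeckijSeminorm (omegaDomain q) σ 1 v
  set B : Set (ℝ × ℝ) := Ioo 0 h ×ˢ Ioo (-T) T with hB
  have hN := measurable_collarNorm (φ := v) hq one_pos hv
  have hD := measurable_collarDist (φ := v) hq one_pos hv
  have hvB : volume B = ENNReal.ofReal (2 * T * h) := by
    rw [hB, Measure.volume_eq_prod, Measure.prod_prod, Real.volume_Ioo, Real.volume_Ioo,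
      ← ENNReal.ofReal_mul (by linarith)]
    congr 1
    ring
  have hBsub : B ⊆ collarBox T := prod_mono (Ioo_subset_Ioo_right hT) subset_rfl
  have hI : ∀ r, 0 < r → ∫⁻ x in Ioo 0 r ×ˢ Ioo (-T) T, collarNorm q 1 v x.1
      = ENNReal.ofReal (2 * T) * ∫⁻ ρ in Ioo 0 r, collarNorm q 1 v ρ := by
    intro r _
    rw [Measure.volume_eq_prod, ← Measure.prod_restrict,
      lintegral_prod (fun x : ℝ × ℝ => collarNorm q 1 v x.1) (hN.comp measurable_fst).aemeasurable]
    simp only [lintegral_const, Measure.restrict_apply_univ, Real.volume_Ioo, sub_neg_eq_add]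
    rw [lintegral_mul_const' _ _ (by simp), mul_comm, ← two_mul]
  have key : ENNReal.ofReal (4 * T ^ 3) * ∫⁻ ρ in Ioo 0 h, collarNorm q 1 v ρ
      ≤ ENNReal.ofReal (32 * 5 ^ (2 + σ) * T ^ (3 + σ)) * S
        + ENNReal.ofReal (16 * T ^ 2 * h) * L := by
    have hTT : ∫⁻ ρ in Ioo 0 T, collarNorm q 1 v ρ ≤ 4 * L :=
      (lintegral_mono_set (Ioo_subset_Ioo_right hT4)).trans (lintegral_collarNorm_le hq le_rfl hv)
    calc _ = ∫⁻ x in B, ∫⁻ y in collarBox T, collarNorm q 1 v x.1 := by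
          simp only [lintegral_const, Measure.restrict_apply_univ]
          rw [volume_collarBox hT0, lintegral_mul_const' _ _ ENNReal.ofReal_ne_top, hB, hI h h0,
            mul_right_comm, ← ENNReal.ofReal_mul (by positivity)]
          congr 2
          ring
      _ ≤ ∫⁻ x in B, ∫⁻ y in collarBox T, (collarDist q 1 v x y + collarNorm q 1 v y.1) :=
          lintegral_mono fun x => lintegral_mono fun y => collarNorm_le_add hq le_rfl hv x y
      _ = ∫⁻ x in B, ((∫⁻ y in collarBox T, collarDist q 1 v x y) +
            ENNReal.ofReal (2 * T) * ∫⁻ ρ in Ioo 0 T, collarNorm q 1 v ρ) := by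
          refine lintegral_congr fun x => ?_
          rw [lintegral_add_left (Measurable.of_uncurry_left (f := collarDist q 1 v) hD),
            collarBox, hI T hT0]
      _ = (∫⁻ x in B, ∫⁻ y in collarBox T, collarDist q 1 v x y) +
            ENNReal.ofReal (2 * T) * (∫⁻ ρ in Ioo 0 T, collarNorm q 1 v ρ)
              * ENNReal.ofReal (2 * T * h) := by
          rw [lintegral_add_right _ measurable_const, lintegral_const, Measure.restrict_apply_univ,
            hvB]
      _ ≤ ENNReal.ofReal (32 * 5 ^ (2 + σ) * T ^ (3 + σ)) * S +
            ENNReal.ofReal (2 * T) * (4 * L) * ENNReal.ofReal (2 * T * h) := by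
          gcongr
          refine (lintegral_mono_set hBsub).trans ?_
          simpa using lintegral_collarDist_rpow_le (p := 1) hq one_pos hσ hv hT0 hT4
      _ = _ := by
          congr 1
          rw [show (4 : ℝ≥0∞) = ENNReal.ofReal 4 by simp, ← mul_assoc,
            ← ENNReal.ofReal_mul (by positivity), mul_right_comm,
            ← ENNReal.ofReal_mul (by positivity)]
          congr 2
          ring
  have hpos : ENNReal.ofReal (4 * T ^ 3) ≠ 0 := by
    simp only [ne_eq, ENNReal.ofReal_eq_zero, not_le]
    positivity
  rw [← ENNReal.mul_le_mul_iff_right hpos ENNReal.ofReal_ne_top]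
  refine key.trans (le_of_eq ?_)
  rw [mul_add, ← mul_assoc, ← mul_assoc, ← ENNReal.ofReal_mul (by positivity),
    ← ENNReal.ofReal_mul (by positivity)]
  congr 3
  · rw [Real.rpow_add hT0, show (3 : ℝ) = ((3 : ℕ) : ℝ) by norm_num, Real.rpow_natCast]
    ring
  · field_simp
    norm_num

theorem lintegral_layer_le_rpow_of_slobodeckij (hq : 8 ≤ q) (hσ : 0 < σ) (hσ1 : σ ≤ 1) (hv : Continuous v) {h : ℝ} (h0 : 0 < h) (h1 : h ≤ 1 / 16) :
    ∫⁻ ρ in Ioo 0 h, collarNorm q 1 v ρ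
      ≤ ENNReal.ofReal (8 * 5 ^ (2 + σ)) * ENNReal.ofReal (h ^ (σ / 2)) *
        (eLpNorm v (ENNReal.ofReal 1) (volume.restrict (omegaDomain q))
          + slobodeckijSeminorm (omegaDomain q) σ 1 v) := by
  have hT4 : √h ≤ 1 / 4 := by
    rw [Real.sqrt_le_left (by norm_num)]
    linarith
  have hhT : h ≤ √h := Real.le_sqrt_of_sq_le (by nlinarith)
  have e1 : √h ^ σ = h ^ (σ / 2) := by
    rw [Real.sqrt_eq_rpow, ← Real.rpow_mul h0.le]
    ring_nf
  have e2 : h / √h ≤ h ^ (σ / 2) := by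
    rw [Real.div_sqrt, Real.sqrt_eq_rpow]
    exact Real.rpow_le_rpow_of_exponent_ge h0 (by linarith) (by linarith)
  have h5 : (1 : ℝ) ≤ 5 ^ (2 + σ) := Real.one_le_rpow (by norm_num) (by linarith)
  refine (lintegral_layer_le_of_slobodeckij hq hσ hv h0 hhT hT4).trans ?_
  rw [← ENNReal.ofReal_mul (by positivity), mul_add, add_comm, e1]
  gcongr
  have : 0 < h / √h := by positivity
  nlinarith

end Layer

section TraceBounds

variable {q : ℕ} {V : Type*} [NormedAddCommGroup V] [NormedSpace ℝ V] [CompleteSpace V] {p σ : ℝ}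
  {φ : EuclideanSpace ℝ (Fin 2) → V}

theorem eLpNorm_fderiv_add_le_sobolevNormAux (hq : 8 ≤ q) (hp : 1 ≤ p) (hφ : ContDiff ℝ ∞ φ) {m : ℕ}
    (hm : 1 ≤ m) : eLpNorm φ (ENNReal.ofReal p) (volume.restrict (omegaDomain q)) +
      eLpNorm (fderiv ℝ φ) (ENNReal.ofReal p) (volume.restrict (omegaDomain q))
        ≤ sobolevNormAux (omegaDomain q) σ p m φ := by
  have hp1 : (1 : ℝ≥0∞) ≤ ENNReal.ofReal p := by simpa using hp
  refine le_trans ?_ (sobolevNormAux_mono hm φ)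
  rw [sobolevNormAux_succ (omegaDomain_isOpen hq) 0 fun i => hasWeakPartial_fderiv hφ _ i]
  refine add_le_add (eLpNorm_le_sobolevNormAux 0 φ) ?_
  refine (eLpNorm_clm_le_sum hp1 (hφ.continuous_fderiv (by simp)).aestronglyMeasurable).trans ?_
  exact Finset.sum_le_sum fun i _ => eLpNorm_le_sobolevNormAux 0 _

theorem collarDist_boundary_le_of_gradient (hq : 8 ≤ q) (hp : 1 ≤ p) (hφ : ContDiff ℝ ∞ φ) {h : ℝ}
    (h0 : 0 < h) (h1 : h ≤ 1 / 4) : collarDist q p φ 0 (0, h) ≤ 24 * ENNReal.ofReal (h ^ (1 - 1 / p)) *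
      eLpNorm (fderiv ℝ φ) (ENNReal.ofReal p) (volume.restrict (omegaDomain q)) := by
  have hp0 : 0 < p := by linarith
  have hα : 0 ≤ 1 - 1 / p := by
    have : 1 / p ≤ 1 := by
      rw [div_le_one hp0]
      exact hp
    linarith
  have key : ∀ a : ℝ, |a| ≤ 1 → collarDist q p φ (0, 0) (0 + h / 2, a * (h / 2))
      ≤ 12 * ENNReal.ofReal (h ^ (1 - 1 / p)) *
        eLpNorm (fderiv ℝ φ) (ENNReal.ofReal p) (volume.restrict (omegaDomain q)) := by
    intro a ha
    refine (collarDist_slope_le hq hp hφ le_rfl (half_pos h0) (by linarith) ha).trans ?_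
    refine mul_le_mul_left ?_ _
    rw [show (12 : ℝ≥0∞) = ENNReal.ofReal 12 by simp, ← ENNReal.ofReal_mul (by norm_num)]
    gcongr
    linarith
  refine (collarDist_boundary_le_add hq hp hφ.continuous h).trans ?_
  refine (add_le_add (key 1 (by simp)) (key (-1) (by simp))).trans (le_of_eq ?_)
  ring

theorem collarDist_boundary_le_sum (hq : 8 ≤ q) (hφ : ContDiff ℝ ∞ φ) {h : ℝ}
    (h0 : 0 < h) (h1 : h ≤ 1 / 4) : collarDist q 1 φ 0 (0, h) ≤ 6 * ∑ i : Fin 2, ∫⁻ ρ in Ioo 0 h,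
      collarNorm q 1 (fun x => fderiv ℝ φ x (EuclideanSpace.single i 1)) ρ := by
  have hfc : Continuous (fderiv ℝ φ) := hφ.continuous_fderiv (by simp)
  have hs : ∫⁻ ρ in Ioo 0 h, collarNorm q 1 (fderiv ℝ φ) ρ ≤ ∑ i : Fin 2, ∫⁻ ρ in Ioo 0 h,
      collarNorm q 1 (fun x => fderiv ℝ φ x (EuclideanSpace.single i 1)) ρ := by
    rw [← lintegral_finsetSum _ fun i _ => measurable_collarNorm hq one_pos
      (contDiff_fderiv_apply hφ (EuclideanSpace.single i 1)).continuous]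
    refine lintegral_mono fun ρ => eLpNorm_clm_le_sum (by simp) ?_
    simpa using (continuous_comp_stripPoint hq hfc (ρ, 0)).aestronglyMeasurable
  have key : ∀ a : ℝ, |a| ≤ 1 → collarDist q 1 φ (0, 0) (0 + h / 2, a * (h / 2))
      ≤ 3 * ∫⁻ ρ in Ioo 0 h, collarNorm q 1 (fderiv ℝ φ) ρ := by
    intro a ha
    have := collarDist_slope_rpow_le hq le_rfl hφ le_rfl (half_pos h0) (by linarith) ha
    simp only [ENNReal.rpow_one, Real.rpow_one, sub_self, Real.rpow_zero, mul_one,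
      ENNReal.ofReal_ofNat] at this
    refine this.trans (mul_le_mul_right (lintegral_mono_set (Ioo_subset_Ioo_right ?_)) _)
    linarith
  refine (collarDist_boundary_le_add hq le_rfl hφ.continuous h).trans ?_
  refine (add_le_add (key 1 (by simp)) (key (-1) (by simp))).trans ?_
  refine le_trans (le_of_eq ?_) (mul_le_mul_right hs 6)
  ring

theorem lintegral_layer_le_of_gradient {v : EuclideanSpace ℝ (Fin 2) → V} (hq : 8 ≤ q)
    (hv : ContDiff ℝ ∞ v) {h : ℝ} (h1 : h ≤ 1 / 4) :
    ∫⁻ ρ in Ioo 0 h, collarNorm q 1 v ρ ≤ 16 * ENNReal.ofReal h *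
      (eLpNorm v (ENNReal.ofReal 1) (volume.restrict (omegaDomain q)) +
        eLpNorm (fderiv ℝ v) (ENNReal.ofReal 1) (volume.restrict (omegaDomain q))) := by
  refine (setLIntegral_mono' measurableSet_Ioo fun ρ hρ =>
    collarNorm_le_of_gradient hq le_rfl hv ⟨hρ.1.le, hρ.2.le.trans h1⟩).trans (le_of_eq ?_)
  rw [lintegral_const, Measure.restrict_apply_univ, Real.volume_Ioo, sub_zero]
  ring

/-- The trace inequality for smooth functions, together with a modulus of continuity of the trace
in `Lᵖ`. -/
theorem trace_bounds (hq : 8 ≤ q) (hp : 1 ≤ p) {ε : ℝ} (hε : 0 < ε) :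
    ∃ C : ℝ≥0∞, C ≠ ⊤ ∧ ∃ α : ℝ, 0 < α ∧ ∀ φ : EuclideanSpace ℝ (Fin 2) → V, ContDiff ℝ ∞ φ →
      collarNorm q p φ 0 ≤ C * sobolevNorm (omegaDomain q) (1 / p + ε) p φ ∧
      ∀ h, 0 < h → h ≤ 1 / 16 → collarDist q p φ 0 (0, h)
        ≤ C * ENNReal.ofReal (h ^ α) * sobolevNorm (omegaDomain q) (1 / p + ε) p φ := by
  have hp0 : 0 < p := by linarith
  have hip : 0 < 1 / p := by positivity
  unfold sobolevNorm
  set s := 1 / p + ε with hs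
  have hs0 : 0 ≤ s := by positivity
  have hfl := Nat.floor_le hs0
  have hlf := Nat.lt_floor_add_one s
  generalize hm : ⌊s⌋₊ = m at hfl hlf
  set σ := s - m with hσ
  rcases m with _ | m
  · obtain ⟨C, hC, h⟩ := trace_bounds_of_slobodeckij (V := V) hq hp (σ := σ)
      (by rw [hσ]; push_cast; linarith)
    have hσ0 : σ ≠ 0 := by
      rw [hσ]
      push_cast
      linarith
    refine ⟨C, hC, σ - 1 / p, ?_, fun φ hφ => ?_⟩
    · rw [hσ]
      push_cast
      linarith
    · rw [sobolevNormAux, if_neg hσ0]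
      exact h φ hφ.continuous
  have hB : ∀ φ : EuclideanSpace ℝ (Fin 2) → V, ContDiff ℝ ∞ φ →
      collarNorm q p φ 0 ≤ 16 * sobolevNormAux (omegaDomain q) σ p (m + 1) φ := fun φ hφ =>
    (collarNorm_le_of_gradient hq hp hφ ⟨le_rfl, by norm_num⟩).trans
      (mul_le_mul_right (eLpNorm_fderiv_add_le_sobolevNormAux hq hp hφ (by simp)) _)
  rcases hp.lt_or_eq with hp1 | rfl
  · refine ⟨24, by simp, 1 - 1 / p, ?_, fun φ hφ => ⟨(hB φ hφ).trans ?_, fun h h0 h1 => ?_⟩⟩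
    · rw [sub_pos, div_lt_one hp0]
      exact hp1
    · gcongr
      norm_num
    · refine (collarDist_boundary_le_of_gradient hq hp hφ h0 (by linarith)).trans ?_
      exact mul_le_mul_right (le_add_self.trans
        (eLpNorm_fderiv_add_le_sobolevNormAux hq hp hφ (by simp))) _
  have hsum : ∀ φ : EuclideanSpace ℝ (Fin 2) → V, ContDiff ℝ ∞ φ →
      ∑ i : Fin 2, sobolevNormAux (omegaDomain q) σ 1 m
        (fun x => fderiv ℝ φ x (EuclideanSpace.single i 1))
        ≤ sobolevNormAux (omegaDomain q) σ 1 (m + 1) φ := fun φ hφ => by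
    rw [sobolevNormAux_succ (omegaDomain_isOpen hq) m fun i => hasWeakPartial_fderiv hφ _ i]
    exact le_add_self
  obtain ⟨C, hC, α, hα, hlayer⟩ : ∃ C : ℝ≥0∞, C ≠ ⊤ ∧ ∃ α : ℝ, 0 < α ∧
      ∀ v : EuclideanSpace ℝ (Fin 2) → V, ContDiff ℝ ∞ v → ∀ h, 0 < h → h ≤ 1 / 16 →
        ∫⁻ ρ in Ioo 0 h, collarNorm q 1 v ρ
          ≤ C * ENNReal.ofReal (h ^ α) * sobolevNormAux (omegaDomain q) σ 1 m v := by
    rcases m with _ | m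
    · have hσε : σ = ε := by
        rw [hσ, hs]
        push_cast
        ring
      have hσ0 : 0 < σ := hσε ▸ hε
      have hσ1 : σ ≤ 1 := by
        rw [hσ]
        push_cast at hlf ⊢
        linarith
      refine ⟨ENNReal.ofReal (8 * 5 ^ (2 + σ)), ENNReal.ofReal_ne_top, σ / 2, half_pos hσ0,
        fun v hv h h0 h1 => ?_⟩
      rw [sobolevNormAux, if_neg hσ0.ne']
      exact lintegral_layer_le_rpow_of_slobodeckij hq hσ0 hσ1 hv.continuous h0 h1
    · refine ⟨16, by simp, 1, one_pos, fun v hv h h0 h1 => ?_⟩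
      rw [Real.rpow_one]
      exact (lintegral_layer_le_of_gradient hq hv (by linarith)).trans
        (mul_le_mul_right (eLpNorm_fderiv_add_le_sobolevNormAux hq le_rfl hv (by simp)) _)
  refine ⟨16 + 6 * C, ENNReal.add_ne_top.2 ⟨by simp, ENNReal.mul_ne_top (by simp) hC⟩, α, hα,
    fun φ hφ => ⟨(hB φ hφ).trans ?_, fun h h0 h1 => ?_⟩⟩
  · gcongr
    exact le_self_add
  · calc collarDist q 1 φ 0 (0, h) ≤ 6 * ∑ i : Fin 2, ∫⁻ ρ in Ioo 0 h,
          collarNorm q 1 (fun x => fderiv ℝ φ x (EuclideanSpace.single i 1)) ρ :=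
        collarDist_boundary_le_sum hq hφ h0 (by linarith)
      _ ≤ 6 * ∑ i : Fin 2, C * ENNReal.ofReal (h ^ α) * sobolevNormAux (omegaDomain q) σ 1 m
          (fun x => fderiv ℝ φ x (EuclideanSpace.single i 1)) := by
        gcongr with i
        exact hlayer _ (contDiff_fderiv_apply hφ _) h h0 h1
      _ ≤ 6 * (C * ENNReal.ofReal (h ^ α) * sobolevNormAux (omegaDomain q) σ 1 (m + 1) φ) := by
        rw [← Finset.mul_sum]
        gcongr
        exact hsum φ hφ
      _ = 6 * C * ENNReal.ofReal (h ^ α) * sobolevNormAux (omegaDomain q) σ 1 (m + 1) φ := by ring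
      _ ≤ _ := by
        gcongr
        exact le_add_self

end TraceBounds

section BoundaryValues

variable {q : ℕ} {V : Type*} [NormedAddCommGroup V] {p : ℝ}

theorem collarNorm_zero (φ : EuclideanSpace ℝ (Fin 2) → V) : collarNorm q p φ 0
    = eLpNorm (fun θ => φ (bdryPoint q θ)) (ENNReal.ofReal p) angleMeasure := by
  simp only [collarNorm, stripPoint_zero]

theorem continuous_bdryPoint (hq : 8 ≤ q) : Continuous (bdryPoint q) := by
  have := (stripPoint_continuous hq).comp (by fun_prop : Continuous fun θ : ℝ => ((0 : ℝ), θ))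
  simpa [Function.comp_def, stripPoint_zero] using this

theorem Continuous.memLp_angleMeasure {κ : ℝ → V} (hκ : Continuous κ) (r : ℝ≥0∞) :
    MemLp κ r angleMeasure := by
  obtain ⟨C, hC⟩ := isCompact_Icc.exists_bound_of_continuousOn (hκ.continuousOn (s := Icc 0 (2 * π)))
  refine MemLp.of_bound hκ.aestronglyMeasurable C ?_
  exact ae_restrict_of_forall_mem measurableSet_Ioc fun x hx => hC x (Ioc_subset_Icc_self hx)

theorem exists_lintegral_enorm_le_eLpNorm {X : Type*} [MeasurableSpace X] (μ : Measure X)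
    [IsFiniteMeasure μ] (hp : 1 ≤ p) : ∃ K : ℝ≥0∞, K ≠ ⊤ ∧ ∀ w : X → V, AEStronglyMeasurable w μ →
      ∫⁻ x, ‖w x‖ₑ ∂μ ≤ K * eLpNorm w (ENNReal.ofReal p) μ := by
  have hp1 : (1 : ℝ≥0∞) ≤ ENNReal.ofReal p := by simpa using hp
  have hp0 : 0 < p := by linarith
  refine ⟨μ univ ^ (1 - 1 / p), ?_, fun w hw => ?_⟩
  · refine ENNReal.rpow_ne_top_of_nonneg ?_ (measure_ne_top _ _)
    rw [sub_nonneg, div_le_one hp0]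
    exact hp
  · rw [← eLpNorm_one_eq_lintegral_enorm, mul_comm]
    refine (eLpNorm_le_eLpNorm_mul_rpow_measure_univ hp1 hw).trans (le_of_eq ?_)
    rw [ENNReal.toReal_ofReal hp0.le, ENNReal.toReal_one, one_div_one]

end BoundaryValues

section Trace

variable {q : ℕ} {V : Type*} [NormedAddCommGroup V] [NormedSpace ℝ V] [CompleteSpace V] {p ε : ℝ}
  {u : EuclideanSpace ℝ (Fin 2) → V} {g g' : ℝ → V}

theorem sobolevNorm_sub_le_of_approx (hq : 8 ≤ q) (hp : 1 ≤ p) {s : ℝ}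
    (hu : AEStronglyMeasurable u (volume.restrict (omegaDomain q)))
    {φ ψ : EuclideanSpace ℝ (Fin 2) → V} (hφ : Continuous φ) (hψ : Continuous ψ) :
    sobolevNorm (omegaDomain q) s p (fun x => φ x - ψ x)
      ≤ sobolevNorm (omegaDomain q) s p (fun x => φ x - u x)
        + sobolevNorm (omegaDomain q) s p (fun x => ψ x - u x) := by
  have e : (fun x => φ x - ψ x) = fun x => (φ x - u x) + -(ψ x - u x) := by
    ext x
    abel
  rw [e]
  exact (sobolevNormAux_add_le (omegaDomain_isOpen hq) hp _ (hφ.aestronglyMeasurable.sub hu)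
    (hψ.aestronglyMeasurable.sub hu).neg).trans (add_le_add_right (sobolevNormAux_neg_le _ _) _)

theorem sobolevNorm_le_of_approx (hq : 8 ≤ q) (hp : 1 ≤ p) {s : ℝ}
    (hu : AEStronglyMeasurable u (volume.restrict (omegaDomain q)))
    {φ : EuclideanSpace ℝ (Fin 2) → V} (hφ : Continuous φ) :
    sobolevNorm (omegaDomain q) s p φ ≤ sobolevNorm (omegaDomain q) s p (fun x => φ x - u x)
        + sobolevNorm (omegaDomain q) s p u := by
  have e : φ = fun x => (φ x - u x) + u x := by
    ext x
    abel
  conv_lhs => rw [e]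
  exact sobolevNormAux_add_le (omegaDomain_isOpen hq) hp _ (hφ.aestronglyMeasurable.sub hu) hu

theorem exists_eLpNorm_bdryPoint_sub_le (hq : 8 ≤ q) (hp : 1 ≤ p) (hε : 0 < ε)
    (hu : AEStronglyMeasurable u (volume.restrict (omegaDomain q))) :
    ∃ C : ℝ≥0∞, C ≠ ⊤ ∧ ∀ φ ψ : EuclideanSpace ℝ (Fin 2) → V, ContDiff ℝ ∞ φ → ContDiff ℝ ∞ ψ →
      eLpNorm (fun θ => φ (bdryPoint q θ) - ψ (bdryPoint q θ)) (ENNReal.ofReal p) angleMeasure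
        ≤ C * sobolevNorm (omegaDomain q) (1 / p + ε) p (fun x => φ x - u x)
          + C * sobolevNorm (omegaDomain q) (1 / p + ε) p (fun x => ψ x - u x) := by
  obtain ⟨C, hC, α, -, h⟩ := trace_bounds (V := V) hq hp hε
  refine ⟨C, hC, fun φ ψ hφ hψ => ?_⟩
  have := (h (fun x => φ x - ψ x) (hφ.sub hψ)).1
  rw [collarNorm_zero] at this
  refine this.trans ?_
  rw [← mul_add]
  exact mul_le_mul_right (sobolevNorm_sub_le_of_approx hq hp hu hφ.continuous hψ.continuous) _

theorem exists_hasTrace (hq : 8 ≤ q) (hp : 1 ≤ p) (hε : 0 < ε)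
    (hu : MemSobolev (omegaDomain q) (1 / p + ε) p u) :
    ∃ g : ℝ → V, HasTrace q (1 / p + ε) p u g := by
  have hp1 : (1 : ℝ≥0∞) ≤ ENNReal.ofReal p := by simpa using hp
  obtain ⟨C, hC, hbd⟩ := exists_eLpNorm_bdryPoint_sub_le hq hp hε hu.1
  obtain ⟨φ, hφ, hlim⟩ := exists_contDiff_tendsto_sobolevNorm hq hp hu
  have hlim' := ENNReal.Tendsto.const_mul hlim (Or.inr hC)
  rw [mul_zero] at hlim'
  have hev : ∀ n : ℕ, ∀ᶠ k in atTop, ∀ i, k ≤ i → ∀ j, k ≤ j →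
      eLpNorm (fun θ => φ i (bdryPoint q θ) - φ j (bdryPoint q θ)) (ENNReal.ofReal p) angleMeasure
        < (2⁻¹ : ℝ≥0∞) ^ n := by
    intro n
    have hpos : (0 : ℝ≥0∞) < (2⁻¹ : ℝ≥0∞) ^ n / 2 := by
      refine ENNReal.half_pos (pow_ne_zero _ ?_)
      simp
    filter_upwards [eventually_forall_ge_atTop.2 (hlim'.eventually (gt_mem_nhds hpos))]
      with k hk i hi j hj
    refine (hbd _ _ (hφ i) (hφ j)).trans_lt ?_
    rw [← ENNReal.add_halves ((2⁻¹ : ℝ≥0∞) ^ n)]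
    exact ENNReal.add_lt_add (hk i hi) (hk j hj)
  obtain ⟨k, hk, hcau⟩ := extraction_forall_of_eventually' (fun n => eventually_atTop.1 (hev n))
  obtain ⟨g, hg, hgl⟩ := Lp.cauchy_complete_eLpNorm (μ := angleMeasure) hp1
    (f := fun n θ => φ (k n) (bdryPoint q θ))
    (fun n => ((hφ (k n)).continuous.comp (continuous_bdryPoint hq)).memLp_angleMeasure _)
    (B := fun n => (2⁻¹ : ℝ≥0∞) ^ n)
    (by rw [ENNReal.tsum_geometric, ENNReal.one_sub_inv_two]; simp)
    (fun N n m hn hm => hcau N _ (hk.monotone hn) _ (hk.monotone hm))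
  exact ⟨g, hg, fun n => φ (k n), fun n => hφ _, hlim.comp hk.tendsto_atTop, hgl⟩

theorem HasTrace.ae_eq (hq : 8 ≤ q) (hp : 1 ≤ p) (hε : 0 < ε)
    (hu : MemSobolev (omegaDomain q) (1 / p + ε) p u) (hg : HasTrace q (1 / p + ε) p u g)
    (hg' : HasTrace q (1 / p + ε) p u g') : g' =ᵐ[angleMeasure] g := by
  have hp1 : (1 : ℝ≥0∞) ≤ ENNReal.ofReal p := by simpa using hp
  obtain ⟨C, hC, hbd⟩ := exists_eLpNorm_bdryPoint_sub_le hq hp hε hu.1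
  obtain ⟨hgm, φ, hφ, hφu, hφg⟩ := hg
  obtain ⟨hgm', ψ, hψ, hψu, hψg⟩ := hg'
  have hc : ∀ {χ : EuclideanSpace ℝ (Fin 2) → V}, ContDiff ℝ ∞ χ →
      AEStronglyMeasurable (fun θ => χ (bdryPoint q θ)) angleMeasure := fun hχ =>
    (hχ.continuous.comp (continuous_bdryPoint hq)).aestronglyMeasurable
  have hle : ∀ n, eLpNorm (g' - g) (ENNReal.ofReal p) angleMeasure
      ≤ eLpNorm (fun θ => ψ n (bdryPoint q θ) - g' θ) (ENNReal.ofReal p) angleMeasure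
        + (C * sobolevNorm (omegaDomain q) (1 / p + ε) p (fun x => ψ n x - u x)
          + C * sobolevNorm (omegaDomain q) (1 / p + ε) p (fun x => φ n x - u x))
        + eLpNorm (fun θ => φ n (bdryPoint q θ) - g θ) (ENNReal.ofReal p) angleMeasure := by
    intro n
    have e : g' - g = (fun θ => g' θ - ψ n (bdryPoint q θ)) +
        (fun θ => ψ n (bdryPoint q θ) - φ n (bdryPoint q θ)) +
        (fun θ => φ n (bdryPoint q θ) - g θ) := by
      ext θ
      simp only [Pi.sub_apply, Pi.add_apply]
      abel
    have h1 := hgm'.1.sub (hc (hψ n))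
    have h2 := (hc (hψ n)).sub (hc (hφ n))
    have h3 := (hc (hφ n)).sub hgm.1
    rw [e]
    refine (eLpNorm_add_le (h1.add h2) h3 hp1).trans (add_le_add_left ?_ _)
    refine (eLpNorm_add_le h1 h2 hp1).trans (add_le_add (le_of_eq ?_) (hbd _ _ (hψ n) (hφ n)))
    exact eLpNorm_sub_comm _ _ _ _
  have h0 : eLpNorm (g' - g) (ENNReal.ofReal p) angleMeasure = 0 := by
    refine le_antisymm (ge_of_tendsto' (x := atTop) ?_ hle) zero_le
    have l1 := ENNReal.Tendsto.const_mul hψu (Or.inr hC)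
    have l2 := ENNReal.Tendsto.const_mul hφu (Or.inr hC)
    simpa using (hψg.add (l1.add l2)).add hφg
  have := (eLpNorm_eq_zero_iff (hgm'.1.sub hgm.1) (by positivity)).1 h0
  filter_upwards [this] with θ hθ
  exact sub_eq_zero.1 hθ

/-- A trace is a limit in `L¹` of periodic functions with a common modulus of continuity. -/
theorem HasTrace.exists_tendsto_lintegral (hq : 8 ≤ q) (hp : 1 ≤ p) (hε : 0 < ε)
    (hu : MemSobolev (omegaDomain q) (1 / p + ε) p u) (hg : HasTrace q (1 / p + ε) p u g) :
    ∃ (κ : ℕ → ℝ → V) (C : ℝ≥0∞) (α : ℝ), C ≠ ⊤ ∧ 0 < α ∧ α ≤ 1 ∧ (∀ n, Continuous (κ n)) ∧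
      (∀ n, Function.Periodic (κ n) (2 * π)) ∧
      Tendsto (fun n => ∫⁻ θ, ‖κ n θ - g θ‖ₑ ∂angleMeasure) atTop (𝓝 0) ∧
      (∀ n, ∫⁻ θ, ‖κ n θ‖ₑ ∂angleMeasure ≤ C) ∧
      ∀ n h, 0 < h → h ≤ 1 / 16 →
        ∫⁻ θ, ‖κ n (θ + h) - κ n θ‖ₑ ∂angleMeasure ≤ C * ENNReal.ofReal (h ^ α) := by
  obtain ⟨C, hC, α, hα, htr⟩ := trace_bounds (V := V) hq hp hε
  obtain ⟨K, hK, hKle⟩ := exists_lintegral_enorm_le_eLpNorm (V := V) angleMeasure hp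
  obtain ⟨hgm, φ, hφ, hφu, hφg⟩ := hg
  obtain ⟨n₀, hn₀⟩ := eventually_atTop.1 (hφu.eventually (gt_mem_nhds one_pos))
  set M := 1 + sobolevNorm (omegaDomain q) (1 / p + ε) p u with hM
  have hMt : M ≠ ⊤ := ENNReal.add_ne_top.2 ⟨by simp, hu.2.ne⟩
  have hN : ∀ n, sobolevNorm (omegaDomain q) (1 / p + ε) p (φ (n + n₀)) ≤ M := fun n =>
    (sobolevNorm_le_of_approx hq hp hu.1 (hφ _).continuous).trans
      (add_le_add_left (hn₀ _ (Nat.le_add_left _ _)).le _)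
  have hc : ∀ n, Continuous fun θ => φ n (bdryPoint q θ) := fun n =>
    (hφ n).continuous.comp (continuous_bdryPoint hq)
  refine ⟨fun n θ => φ (n + n₀) (bdryPoint q θ), K * (C * M), min α 1,
    ENNReal.mul_ne_top hK (ENNReal.mul_ne_top hC hMt), lt_min hα one_pos, min_le_right _ _,
    fun n => hc _, fun n θ => ?_, ?_, fun n => ?_, fun n h h0 h1 => ?_⟩
  · simp only [← stripPoint_zero, stripPoint_periodic hq 0 θ]
  · have l := (ENNReal.Tendsto.const_mul hφg (Or.inr hK)).comp (tendsto_add_atTop_nat n₀)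
    rw [mul_zero] at l
    exact tendsto_of_tendsto_of_tendsto_of_le_of_le tendsto_const_nhds l (fun _ => zero_le)
      fun n => hKle _ ((hc _).aestronglyMeasurable.sub hgm.1)
  · refine (hKle _ (hc _).aestronglyMeasurable).trans ?_
    rw [← collarNorm_zero]
    gcongr
    refine (htr _ (hφ _)).1.trans ?_
    gcongr
    exact hN n
  · refine (hKle _ (((hc _).comp (continuous_add_const h)).sub (hc _)).aestronglyMeasurable).trans ?_
    have e : eLpNorm (fun θ => φ (n + n₀) (bdryPoint q (θ + h)) - φ (n + n₀) (bdryPoint q θ))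
        (ENNReal.ofReal p) angleMeasure = collarDist q p (φ (n + n₀)) 0 (0, h) := by
      rw [collarDist_comm, collarDist]
      simp [stripPoint_zero]
    rw [mul_assoc]
    refine mul_le_mul_right (e.le.trans ?_) K
    refine ((htr _ (hφ _)).2 h h0 h1).trans ?_
    rw [mul_right_comm]
    gcongr C * ?_ * ENNReal.ofReal ?_
    · exact hN n
    · exact Real.rpow_le_rpow_of_exponent_ge h0 (by linarith) (min_le_left _ _)

end Trace

section RiemannLebesgue

theorem tendsto_integral_cos_mul {a : ℝ → ℝ} (ha : Integrable a) {N : ℕ → ℝ}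
    (hN : Tendsto N atTop atTop) :
    Tendsto (fun k => ∫ x, cos (2 * (N k * x)) * a x) atTop (𝓝 0) := by
  have hw : Tendsto (fun k => N k / π) atTop (cocompact ℝ) :=
    (hN.atTop_div_const pi_pos).mono_right atTop_le_cocompact
  have h := (Real.tendsto_integral_exp_smul_cocompact (fun x => (a x : ℂ))).comp hw
  have h2 := (Complex.continuous_re.tendsto _).comp h
  rw [Complex.zero_re] at h2
  refine h2.congr fun k => ?_
  simp only [Function.comp_apply]
  have hi : Integrable fun v : ℝ => Real.fourierChar (-(v * (N k / π))) • (a v : ℂ) := by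
    refine ha.norm.mono' ?_ (Eventually.of_forall fun v => ?_)
    · have hc : Continuous fun v : ℝ => Real.fourierChar (-(v * (N k / π))) :=
        Real.continuous_fourierChar.comp (by fun_prop)
      exact hc.aestronglyMeasurable.smul ha.ofReal.1
    · rw [Circle.norm_smul, Complex.norm_real]
  rw [← RCLike.re_eq_complex_re, ← integral_re hi]
  refine integral_congr_ae (Eventually.of_forall fun v => ?_)
  simp only [RCLike.re_eq_complex_re, Circle.smul_def, Real.fourierChar_apply, smul_eq_mul,
    Complex.re_mul_ofReal]
  have e : ((2 * π * -(v * (N k / π)) : ℝ) : ℂ) * Complex.I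
      = ((-(2 * (N k * v)) : ℝ) : ℂ) * Complex.I := by
    congr 2
    field_simp
  rw [e, Complex.exp_ofReal_mul_I_re, cos_neg]

/-- A function that does not notice fast oscillations vanishes. -/
theorem ae_eq_zero_of_tendsto_lintegral_sin {S : Set ℝ} (hS : MeasurableSet S) {a : ℝ → ℝ}
    (ha : IntegrableOn a S) (ha0 : ∀ x, 0 ≤ a x) {N : ℕ → ℝ} (hN : Tendsto N atTop atTop)
    (h : Tendsto (fun k => ∫⁻ x in S, ‖sin (N k * x)‖ₑ * ‖a x‖ₑ) atTop (𝓝 0)) :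
    a =ᵐ[volume.restrict S] 0 := by
  have hcos : Tendsto (fun k => ∫ x in S, cos (2 * (N k * x)) * a x) atTop (𝓝 0) := by
    refine (tendsto_integral_cos_mul (ha.integrable_indicator hS) hN).congr fun k => ?_
    rw [← integral_indicator hS]
    congr 1
    ext x
    by_cases hx : x ∈ S <;> simp [hx]
  have hsin : Tendsto (fun k => ∫ x in S, sin (N k * x) ^ 2 * a x) atTop (𝓝 0) := by
    rw [tendsto_zero_iff_enorm_tendsto_zero]
    refine tendsto_of_tendsto_of_tendsto_of_le_of_le tendsto_const_nhds h (fun _ => zero_le)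
      fun k => (enorm_integral_le_lintegral_enorm _).trans (lintegral_mono fun x => ?_)
    rw [enorm_mul]
    gcongr
    rw [← ofReal_norm, ← ofReal_norm]
    refine ENNReal.ofReal_le_ofReal ?_
    rw [norm_pow, Real.norm_eq_abs]
    have := abs_sin_le_one (N k * x)
    have := abs_nonneg (sin (N k * x))
    nlinarith
  have hsplit : ∀ k, ∫ x in S, a x = 2 * (∫ x in S, sin (N k * x) ^ 2 * a x)
      + ∫ x in S, cos (2 * (N k * x)) * a x := by
    intro k
    have i1 : IntegrableOn (fun x => sin (N k * x) ^ 2 * a x) S :=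
      ha.bdd_mul (c := 1) (by fun_prop) (Eventually.of_forall fun x => by
        rw [norm_pow, Real.norm_eq_abs, sq_abs]
        exact sin_sq_le_one _)
    have i2 : IntegrableOn (fun x => cos (2 * (N k * x)) * a x) S :=
      ha.bdd_mul (c := 1) (by fun_prop) (Eventually.of_forall fun x => abs_cos_le_one _)
    rw [← integral_const_mul, ← integral_add (i1.const_mul 2) i2]
    refine integral_congr_ae (Eventually.of_forall fun x => ?_)
    simp only [cos_two_mul, ← sin_sq_add_cos_sq (N k * x)]
    have := sin_sq_add_cos_sq (N k * x)
    linear_combination (-a x) * this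
  have h0 : ∫ x in S, a x = 0 := by
    refine tendsto_nhds_unique (tendsto_const_nhds (f := atTop (α := ℕ))) ?_
    have := (hsin.const_mul 2).add hcos
    rw [mul_zero, add_zero] at this
    exact this.congr fun k => (hsplit k).symm
  exact (integral_eq_zero_iff_of_nonneg ha0 ha).1 h0

end RiemannLebesgue

section Direction

/-- The component of `v` in the direction `(cos ψ, sin ψ)`. -/
noncomputable def dirComponent (ψ : ℝ) (v : EuclideanSpace ℂ (Fin 2)) : ℂ :=
  (cos ψ : ℂ) * v 0 + (sin ψ : ℂ) * v 1

theorem dirComponent_sub (ψ : ℝ) (v w : EuclideanSpace ℂ (Fin 2)) :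
    dirComponent ψ (v - w) = dirComponent ψ v - dirComponent ψ w := by
  simp only [dirComponent, PiLp.sub_apply]
  ring

theorem norm_dirComponent_le (ψ : ℝ) (v : EuclideanSpace ℂ (Fin 2)) :
    ‖dirComponent ψ v‖ ≤ 2 * ‖v‖ := by
  refine (norm_add_le _ _).trans ?_
  rw [norm_mul, norm_mul, Complex.norm_real, Complex.norm_real, Real.norm_eq_abs, Real.norm_eq_abs,
    two_mul]
  exact add_le_add
    ((mul_le_of_le_one_left (norm_nonneg _) (abs_cos_le_one ψ)).trans (PiLp.norm_apply_le v 0))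
    ((mul_le_of_le_one_left (norm_nonneg _) (abs_sin_le_one ψ)).trans (PiLp.norm_apply_le v 1))

theorem norm_dirComponent_sub_le (ψ ψ' : ℝ) (v : EuclideanSpace ℂ (Fin 2)) :
    ‖dirComponent ψ' v - dirComponent ψ v‖ ≤ 2 * |ψ' - ψ| * ‖v‖ := by
  have e : dirComponent ψ' v - dirComponent ψ v
      = ((cos ψ' - cos ψ : ℝ) : ℂ) * v 0 + ((sin ψ' - sin ψ : ℝ) : ℂ) * v 1 := by
    simp only [dirComponent]
    push_cast
    ring
  have h1 : |cos ψ' - cos ψ| ≤ |ψ' - ψ| := abs_cos_sub_cos_le _ _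
  have h2 : |sin ψ' - sin ψ| ≤ |ψ' - ψ| := abs_sin_sub_sin_le _ _
  rw [e]
  refine (norm_add_le _ _).trans ?_
  rw [norm_mul, norm_mul, Complex.norm_real, Complex.norm_real, Real.norm_eq_abs, Real.norm_eq_abs,
    mul_assoc, two_mul]
  exact add_le_add
    (mul_le_mul h1 (PiLp.norm_apply_le v 0) (norm_nonneg _) (abs_nonneg _))
    (mul_le_mul h2 (PiLp.norm_apply_le v 1) (norm_nonneg _) (abs_nonneg _))

theorem continuous_dirComponent : Continuous fun z : ℝ × EuclideanSpace ℂ (Fin 2) =>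
    dirComponent z.1 z.2 := by
  unfold dirComponent
  fun_prop

theorem eq_zero_of_dirComponent {ψ : ℝ} {v : EuclideanSpace ℂ (Fin 2)} (h : dirComponent ψ v = 0)
    (h' : dirComponent (ψ - π / 2) v = 0) : v = 0 := by
  rw [dirComponent, cos_sub_pi_div_two, sin_sub_pi_div_two] at h'
  rw [dirComponent] at h
  have e : (sin ψ : ℂ) ^ 2 + (cos ψ : ℂ) ^ 2 = 1 := by
    exact_mod_cast sin_sq_add_cos_sq ψ
  rw [Complex.ofReal_neg] at h'
  ext i
  fin_cases i
  · simp only [Fin.zero_eta, PiLp.zero_apply]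
    linear_combination (cos ψ : ℂ) * h + (sin ψ : ℂ) * h' - v 0 * e
  · simp only [Fin.mk_one, PiLp.zero_apply]
    linear_combination (sin ψ : ℂ) * h - (cos ψ : ℂ) * h' - v 1 * e

end Direction

section Vanishing

variable {q : ℕ} {g : ℝ → EuclideanSpace ℂ (Fin 2)} {c : ℝ}

/-- The component of `v` along the normal at the polar angle `θ`, not normalised and rotated
by `c`. -/
noncomputable def normalComponent (q : ℕ) (c θ : ℝ) (v : EuclideanSpace ℂ (Fin 2)) : ℂ :=
  (radiusFun q θ : ℂ) * dirComponent (θ + c) v +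
    (lacunary q θ : ℂ) * dirComponent (θ + c - π / 2) v

theorem normalComponent_sub (c θ : ℝ) (v w : EuclideanSpace ℂ (Fin 2)) :
    normalComponent q c θ (v - w) = normalComponent q c θ v - normalComponent q c θ w := by
  simp only [normalComponent, dirComponent_sub]
  ring

theorem norm_normalComponent_le (hq : 8 ≤ q) (c θ : ℝ) (v : EuclideanSpace ℂ (Fin 2)) :
    ‖normalComponent q c θ v‖ ≤ 4 * ‖v‖ := by
  have hF := radiusFun_mem_Icc hq θ
  have hf := lacunary_abs_le hq θ
  have hF' : |radiusFun q θ| ≤ 3 / 2 := abs_le.2 ⟨by linarith [hF.1], hF.2⟩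
  refine (norm_add_le _ _).trans ?_
  rw [norm_mul, norm_mul, Complex.norm_real, Complex.norm_real, Real.norm_eq_abs, Real.norm_eq_abs]
  have h1 := mul_le_mul hF' (norm_dirComponent_le (θ + c) v) (norm_nonneg _) (by norm_num)
  have h2 := mul_le_mul hf (norm_dirComponent_le (θ + c - π / 2) v) (norm_nonneg _) (by norm_num)
  have := norm_nonneg v
  linarith

theorem continuous_normalComponent (hq : 8 ≤ q) {κ : ℝ → EuclideanSpace ℂ (Fin 2)}
    (hκ : Continuous κ) : Continuous fun θ => normalComponent q c θ (κ θ) := by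
  have h1 := radiusFun_continuous hq
  have h2 := lacunary_continuous hq
  have h3 := fun d : ℝ => continuous_dirComponent.comp
    (by fun_prop : Continuous fun θ : ℝ => (θ + d, κ θ))
  have h4 := fun d : ℝ => continuous_dirComponent.comp
    (by fun_prop : Continuous fun θ : ℝ => (θ + d - π / 2, κ θ))
  simp only [Function.comp_def] at h3 h4
  unfold normalComponent
  exact ((Complex.continuous_ofReal.comp h1).mul (h3 c)).add
    ((Complex.continuous_ofReal.comp h2).mul (h4 c))

theorem normalComponent_periodic {κ : ℝ → EuclideanSpace ℂ (Fin 2)}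
    (hq : 8 ≤ q) (hκ : Function.Periodic κ (2 * π)) :
    Function.Periodic (fun θ => normalComponent q c θ (κ θ)) (2 * π) := fun θ => by
  have e1 : θ + 2 * π + c = θ + c + 2 * π := by ring
  have e2 : θ + 2 * π + c - π / 2 = θ + c - π / 2 + 2 * π := by ring
  simp only [normalComponent, dirComponent, hκ θ, radiusFun_periodic hq θ, lacunary_periodic q θ, e2]
  simp only [e1, cos_add_two_pi, sin_add_two_pi]

theorem norm_lacunary_sub_mul_le (hq : 8 ≤ q) (c : ℝ) {h : ℝ} (h0 : 0 ≤ h) (θ : ℝ)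
    (v v' : EuclideanSpace ℂ (Fin 2)) :
    |lacunary q (θ + h) - lacunary q θ| * ‖dirComponent (θ + c - π / 2) v‖
      ≤ ‖normalComponent q c (θ + h) v'‖ + ‖normalComponent q c θ v‖ + 4 * ‖v' - v‖
        + 4 * h * ‖v‖ := by
  set F := radiusFun q θ
  set f := lacunary q θ
  have hF := radiusFun_mem_Icc hq θ
  have hf' := lacunary_abs_le hq (θ + h)
  have hF' : |radiusFun q θ| ≤ 3 / 2 := abs_le.2 ⟨by linarith [hF.1], hF.2⟩
  have hd := radiusFun_lipschitz hq θ (θ + h)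
  rw [add_sub_cancel_left, abs_of_nonneg h0] at hd
  have e : ((lacunary q (θ + h) - lacunary q θ : ℝ) : ℂ) * dirComponent (θ + c - π / 2) v
      = normalComponent q c (θ + h) v' - normalComponent q c θ v
        - normalComponent q c (θ + h) (v' - v)
        - (((radiusFun q (θ + h) - radiusFun q θ : ℝ) : ℂ) * dirComponent (θ + h + c) v
          + (radiusFun q θ : ℂ) * (dirComponent (θ + h + c) v - dirComponent (θ + c) v)
          + (lacunary q (θ + h) : ℂ) *
            (dirComponent (θ + h + c - π / 2) v - dirComponent (θ + c - π / 2) v)) := by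
    simp only [normalComponent, dirComponent_sub]
    push_cast
    ring
  have n1 := norm_dirComponent_le (θ + h + c) v
  have n2 := norm_dirComponent_sub_le (θ + c) (θ + h + c) v
  have n3 := norm_dirComponent_sub_le (θ + c - π / 2) (θ + h + c - π / 2) v
  rw [show θ + h + c - (θ + c) = h by ring, abs_of_nonneg h0] at n2
  rw [show θ + h + c - π / 2 - (θ + c - π / 2) = h by ring, abs_of_nonneg h0] at n3
  have m1 := mul_le_mul hd n1 (norm_nonneg _) (by positivity)
  have m2 := mul_le_mul hF' n2 (norm_nonneg _) (by norm_num)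
  have m3 := mul_le_mul hf' n3 (norm_nonneg _) (by norm_num)
  have hb : ‖((radiusFun q (θ + h) - radiusFun q θ : ℝ) : ℂ) * dirComponent (θ + h + c) v
          + (radiusFun q θ : ℂ) * (dirComponent (θ + h + c) v - dirComponent (θ + c) v)
          + (lacunary q (θ + h) : ℂ) *
            (dirComponent (θ + h + c - π / 2) v - dirComponent (θ + c - π / 2) v)‖
      ≤ 4 * h * ‖v‖ := by
    refine (norm_add₃_le).trans ?_
    rw [norm_mul, norm_mul, norm_mul, Complex.norm_real, Complex.norm_real, Complex.norm_real,
      Real.norm_eq_abs, Real.norm_eq_abs, Real.norm_eq_abs]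
    have : 0 ≤ h * ‖v‖ := by positivity
    linarith
  have hk := norm_normalComponent_le hq c (θ + h) (v' - v)
  calc _ = ‖((lacunary q (θ + h) - lacunary q θ : ℝ) : ℂ) * dirComponent (θ + c - π / 2) v‖ := by
        rw [norm_mul, Complex.norm_real, Real.norm_eq_abs]
    _ ≤ _ := by
        rw [e]
        have t1 := norm_sub_le (normalComponent q c (θ + h) v' - normalComponent q c θ v
          - normalComponent q c (θ + h) (v' - v))
          (((radiusFun q (θ + h) - radiusFun q θ : ℝ) : ℂ) * dirComponent (θ + h + c) v
          + (radiusFun q θ : ℂ) * (dirComponent (θ + h + c) v - dirComponent (θ + c) v)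
          + (lacunary q (θ + h) : ℂ) *
            (dirComponent (θ + h + c - π / 2) v - dirComponent (θ + c - π / 2) v))
        have t2 := norm_sub_le (normalComponent q c (θ + h) v' - normalComponent q c θ v)
          (normalComponent q c (θ + h) (v' - v))
        have t3 := norm_sub_le (normalComponent q c (θ + h) v') (normalComponent q c θ v)
        linarith

/-- If the normal component of a boundary function vanishes, its tangential component
annihilates the oscillations of `lacunary`, up to the modulus of continuity of the function. -/
theorem lintegral_lacunary_sub_mul_le (hq : 8 ≤ q) {κ : ℕ → ℝ → EuclideanSpace ℂ (Fin 2)}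
    {C w : ℝ≥0∞} {h : ℝ} (h0 : 0 ≤ h) (hκ : ∀ n, Continuous (κ n))
    (hper : ∀ n, Function.Periodic (κ n) (2 * π))
    (hlim : Tendsto (fun n => ∫⁻ θ, ‖κ n θ - g θ‖ₑ ∂angleMeasure) atTop (𝓝 0))
    (hC : ∀ n, ∫⁻ θ, ‖κ n θ‖ₑ ∂angleMeasure ≤ C)
    (hw : ∀ n, ∫⁻ θ, ‖κ n (θ + h) - κ n θ‖ₑ ∂angleMeasure ≤ w)
    (hg : ∀ᵐ θ ∂angleMeasure, normalComponent q c θ (g θ) = 0) :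
    ∫⁻ θ, ‖lacunary q (θ + h) - lacunary q θ‖ₑ * ‖dirComponent (θ + c - π / 2) (g θ)‖ₑ ∂angleMeasure
      ≤ 4 * w + 4 * ENNReal.ofReal h * C := by
  have hle : ∀ n, ∫⁻ θ, ‖lacunary q (θ + h) - lacunary q θ‖ₑ *
      ‖dirComponent (θ + c - π / 2) (g θ)‖ₑ ∂angleMeasure
      ≤ 9 * (∫⁻ θ, ‖κ n θ - g θ‖ₑ ∂angleMeasure) + (4 * w + 4 * ENNReal.ofReal h * C) := by
    intro n
    have hcn := continuous_normalComponent (c := c) hq (hκ n)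
    have hR : ∫⁻ θ, ‖normalComponent q c θ (κ n θ)‖ₑ ∂angleMeasure
        ≤ 4 * ∫⁻ θ, ‖κ n θ - g θ‖ₑ ∂angleMeasure := by
      rw [← lintegral_const_mul' _ _ (by simp)]
      refine lintegral_mono_ae ?_
      filter_upwards [hg] with θ hθ
      have e : normalComponent q c θ (κ n θ) = normalComponent q c θ (κ n θ - g θ) := by
        rw [normalComponent_sub, hθ, sub_zero]
      rw [e, ← ofReal_norm, ← ofReal_norm, show (4 : ℝ≥0∞) = ENNReal.ofReal 4 by simp,
        ← ENNReal.ofReal_mul (by norm_num)]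
      exact ENNReal.ofReal_le_ofReal (norm_normalComponent_le hq c θ _)
    have hR' : ∫⁻ θ, ‖normalComponent q c (θ + h) (κ n (θ + h))‖ₑ ∂angleMeasure
        = ∫⁻ θ, ‖normalComponent q c θ (κ n θ)‖ₑ ∂angleMeasure :=
      lintegral_angleMeasure_add (k := fun θ => ‖normalComponent q c θ (κ n θ)‖ₑ)
        (fun θ => by simp only [normalComponent_periodic hq (hper n) θ]) h
    have hpt : ∀ θ, ‖lacunary q (θ + h) - lacunary q θ‖ₑ * ‖dirComponent (θ + c - π / 2) (g θ)‖ₑ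
        ≤ ‖normalComponent q c (θ + h) (κ n (θ + h))‖ₑ + ‖normalComponent q c θ (κ n θ)‖ₑ
          + 4 * ‖κ n (θ + h) - κ n θ‖ₑ + 4 * ENNReal.ofReal h * ‖κ n θ‖ₑ + ‖κ n θ - g θ‖ₑ := by
      intro θ
      have t := norm_lacunary_sub_mul_le hq c h0 θ (κ n θ) (κ n (θ + h))
      have hl : |lacunary q (θ + h) - lacunary q θ| ≤ 2 / 7 := by
        have := abs_sub (lacunary q (θ + h)) (lacunary q θ)
        linarith [lacunary_abs_le hq (θ + h), lacunary_abs_le hq θ]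
      have hs : ‖dirComponent (θ + c - π / 2) (g θ)‖
          ≤ ‖dirComponent (θ + c - π / 2) (κ n θ)‖ + 2 * ‖κ n θ - g θ‖ := by
        have h1 := norm_sub_norm_le (dirComponent (θ + c - π / 2) (g θ))
          (dirComponent (θ + c - π / 2) (κ n θ))
        rw [norm_sub_rev, ← dirComponent_sub] at h1
        linarith [norm_dirComponent_le (θ + c - π / 2) (κ n θ - g θ)]
      have hb : |lacunary q (θ + h) - lacunary q θ| * ‖dirComponent (θ + c - π / 2) (g θ)‖
          ≤ ‖normalComponent q c (θ + h) (κ n (θ + h))‖ + ‖normalComponent q c θ (κ n θ)‖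
          + 4 * ‖κ n (θ + h) - κ n θ‖ + 4 * h * ‖κ n θ‖ + ‖κ n θ - g θ‖ := by
        have h2 := mul_le_mul_of_nonneg_left hs (abs_nonneg (lacunary q (θ + h) - lacunary q θ))
        have h3 := mul_le_mul_of_nonneg_right hl (norm_nonneg (κ n θ - g θ))
        have := norm_nonneg (κ n θ - g θ)
        linarith
      simp only [← ofReal_norm]
      rw [show (4 : ℝ≥0∞) = ENNReal.ofReal 4 by simp, ← ENNReal.ofReal_mul (norm_nonneg _),
        ← ENNReal.ofReal_mul (by norm_num), ← ENNReal.ofReal_mul (by norm_num),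
        ← ENNReal.ofReal_mul (by positivity), ← ENNReal.ofReal_add (by positivity) (by positivity),
        ← ENNReal.ofReal_add (by positivity) (by positivity),
        ← ENNReal.ofReal_add (by positivity) (by positivity),
        ← ENNReal.ofReal_add (by positivity) (by positivity)]
      exact ENNReal.ofReal_le_ofReal hb
    have m1 : Measurable fun θ => ‖normalComponent q c (θ + h) (κ n (θ + h))‖ₑ :=
      (hcn.comp (continuous_add_const h)).enorm.measurable
    have m2 : Measurable fun θ => ‖normalComponent q c θ (κ n θ)‖ₑ := hcn.enorm.measurable
    have m3 : Measurable fun θ => 4 * ‖κ n (θ + h) - κ n θ‖ₑ :=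
      (((hκ n).comp (continuous_add_const h)).sub (hκ n)).enorm.measurable.const_mul 4
    have m4 : Measurable fun θ => 4 * ENNReal.ofReal h * ‖κ n θ‖ₑ :=
      (hκ n).enorm.measurable.const_mul _
    refine (lintegral_mono hpt).trans ?_
    have m12 : Measurable fun θ => ‖normalComponent q c (θ + h) (κ n (θ + h))‖ₑ +
        ‖normalComponent q c θ (κ n θ)‖ₑ := m1.add m2
    have m123 : Measurable fun θ => ‖normalComponent q c (θ + h) (κ n (θ + h))‖ₑ +
        ‖normalComponent q c θ (κ n θ)‖ₑ + 4 * ‖κ n (θ + h) - κ n θ‖ₑ := m12.add m3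
    have m1234 : Measurable fun θ => ‖normalComponent q c (θ + h) (κ n (θ + h))‖ₑ +
        ‖normalComponent q c θ (κ n θ)‖ₑ + 4 * ‖κ n (θ + h) - κ n θ‖ₑ +
        4 * ENNReal.ofReal h * ‖κ n θ‖ₑ := m123.add m4
    rw [lintegral_add_left m1234, lintegral_add_left m123,
      lintegral_add_left m12, lintegral_add_left m1, hR',
      lintegral_const_mul' _ _ (by simp),
      lintegral_const_mul' _ _ (ENNReal.mul_ne_top (by simp) ENNReal.ofReal_ne_top)]
    set I := ∫⁻ θ, ‖κ n θ - g θ‖ₑ ∂angleMeasure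
    calc _ ≤ 4 * I + 4 * I + 4 * w + 4 * ENNReal.ofReal h * C + I := by
          gcongr
          · exact hw n
          · exact hC n
      _ = _ := by ring
  have l := (ENNReal.Tendsto.const_mul (a := 9) hlim (Or.inr (by simp))).add_const
    (4 * w + 4 * ENNReal.ofReal h * C)
  rw [mul_zero, zero_add] at l
  exact ge_of_tendsto' l hle

end Vanishing

section Final

variable {q : ℕ} {p ε : ℝ} {u : EuclideanSpace ℝ (Fin 2) → EuclideanSpace ℂ (Fin 2)}
  {g : ℝ → EuclideanSpace ℂ (Fin 2)}

theorem tendsto_mul_half_period_rpow (hq : 8 ≤ q) {α : ℝ} (hα : 0 < α) :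
    Tendsto (fun k : ℕ => (q : ℝ) ^ (k + 1) * (π / 2 ^ (q ^ (k + 1))) ^ α) atTop (𝓝 0) := by
  have hm : Tendsto (fun k : ℕ => q ^ (k + 1)) atTop atTop :=
    (tendsto_pow_atTop_atTop_of_one_lt (by omega)).comp (tendsto_add_atTop_nat 1)
  have hr : ((2 : ℝ) ^ α)⁻¹ < 1 := inv_lt_one_of_one_lt₀ (Real.one_lt_rpow (by norm_num) hα)
  have h := ((tendsto_self_mul_const_pow_of_lt_one (by positivity) hr).comp hm).const_mul (π ^ α)
  rw [mul_zero] at h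
  refine h.congr fun k => ?_
  have e : ((2 : ℝ) ^ (q ^ (k + 1))) ^ α = (2 ^ α) ^ (q ^ (k + 1)) := by
    rw [← Real.rpow_natCast, ← Real.rpow_mul (by norm_num), mul_comm, Real.rpow_mul (by norm_num),
      Real.rpow_natCast]
  simp only [Function.comp_apply]
  rw [Real.div_rpow pi_pos.le (by positivity), e, inv_pow]
  push_cast
  ring

theorem tendsto_mul_period_ratio (hq : 8 ≤ q) :
    Tendsto (fun k : ℕ => (q : ℝ) ^ (k + 1) * (π * (2 ^ (q ^ k) / 2 ^ (q ^ (k + 1))))) atTop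
      (𝓝 0) := by
  have hm : Tendsto (fun k : ℕ => q ^ k) atTop atTop :=
    tendsto_pow_atTop_atTop_of_one_lt (by omega)
  have h := ((tendsto_self_mul_const_pow_of_lt_one (r := 1 / 2) (by norm_num)
    (by norm_num)).comp hm).const_mul (q * π)
  rw [mul_zero] at h
  refine squeeze_zero (fun k => by positivity) (fun k => ?_) h
  have h1 : (2 : ℝ) ^ (q ^ k) / 2 ^ (q ^ (k + 1)) ≤ (1 / 2) ^ (q ^ k) := by
    rw [one_div, inv_pow, div_le_iff₀ (by positivity), inv_mul_eq_div, le_div_iff₀ (by positivity),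
      ← pow_add]
    refine pow_le_pow_right₀ (by norm_num) ?_
    rw [pow_succ]
    nlinarith [pow_pos (by omega : 0 < q) k]
  simp only [Function.comp_apply]
  push_cast
  calc _ ≤ (q : ℝ) ^ (k + 1) * (π * (1 / 2) ^ (q ^ k)) := by gcongr
    _ = _ := by ring

/-- If the normal component of a trace, rotated by a fixed angle, vanishes, then the trace
vanishes. -/
theorem HasTrace.ae_eq_zero (hq : 8 ≤ q) (hp : 1 ≤ p) (hε : 0 < ε)
    (hu : MemSobolev (omegaDomain q) (1 / p + ε) p u) (hg : HasTrace q (1 / p + ε) p u g) (c : ℝ)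
    (hz : ∀ᵐ θ ∂angleMeasure, normalComponent q c θ (g θ) = 0) : g =ᵐ[angleMeasure] 0 := by
  obtain ⟨κ, C, α, hC, hα, hα1, hκ, hper, hlim, hκC, hmod⟩ :=
    hg.exists_tendsto_lintegral hq hp hε hu
  have hgi : Integrable g angleMeasure := hg.1.integrable (by simpa using hp)
  set a : ℝ → ℝ := fun θ => ‖dirComponent (θ + c - π / 2) (g θ)‖ with ha
  have hai : Integrable a angleMeasure := by
    refine (hgi.norm.const_mul 2).mono' ?_ (Eventually.of_forall fun θ => ?_)
    · exact (continuous_dirComponent.comp_aestronglyMeasurable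
        ((by fun_prop : Continuous fun θ : ℝ => θ + c - π / 2).aestronglyMeasurable.prodMk hgi.1)).norm
    · rw [ha, norm_norm]
      exact norm_dirComponent_le _ _
  set A := ∫⁻ θ, ‖a θ‖ₑ ∂angleMeasure with hA
  have hAt : A ≠ ⊤ := hai.2.ne
  set N : ℕ → ℝ := fun k => 2 ^ (q ^ (k + 1)) with hN
  have hNlim : Tendsto N atTop atTop :=
    (tendsto_pow_atTop_atTop_of_one_lt (by norm_num)).comp
      ((tendsto_pow_atTop_atTop_of_one_lt (by omega)).comp (tendsto_add_atTop_nat 1))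
  have hbound : ∀ k, ∫⁻ θ, ‖sin (N k * θ)‖ₑ * ‖a θ‖ₑ ∂angleMeasure
      ≤ 4 * C * ENNReal.ofReal ((q : ℝ) ^ (k + 1) * (π / 2 ^ (q ^ (k + 1))) ^ α)
        + A * ENNReal.ofReal ((q : ℝ) ^ (k + 1) * (π * (2 ^ (q ^ k) / 2 ^ (q ^ (k + 1))))) := by
    intro k
    set h := π / 2 ^ (q ^ (k + 1)) with hh
    set δ := π * (2 ^ (q ^ k) / 2 ^ (q ^ (k + 1))) with hδ
    set Q := (q : ℝ) ^ (k + 1) with hQ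
    have hq0 : (0 : ℝ) < q := by
      have : 0 < q := by omega
      exact_mod_cast this
    have hQ0 : 0 < Q := by positivity
    have hδ0 : 0 ≤ δ := by positivity
    have h0 : 0 < h := by positivity
    have h1 : h ≤ 1 / 16 := by
      have h2 : (2 : ℝ) ^ 8 ≤ 2 ^ (q ^ (k + 1)) :=
        pow_le_pow_right₀ (by norm_num) (hq.trans (Nat.le_self_pow (by simp) q))
      rw [hh, div_le_iff₀ (by positivity)]
      linarith [pi_le_four]
    have hhα : h ≤ h ^ α := by
      simpa using Real.rpow_le_rpow_of_exponent_ge h0 (by linarith) hα1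
    have hmain := lintegral_lacunary_sub_mul_le (c := c) hq h0.le hκ hper hlim hκC
      (fun n => hmod n h h0 h1) hz
    have hpt : ∀ θ, ‖sin (N k * θ)‖ₑ * ‖a θ‖ₑ ≤ ENNReal.ofReal (Q / 2) *
        (‖lacunary q (θ + h) - lacunary q θ‖ₑ * ‖dirComponent (θ + c - π / 2) (g θ)‖ₑ)
          + ENNReal.ofReal (Q * δ) * ‖a θ‖ₑ := by
      intro θ
      have h2 : |sin (N k * θ)| ≤ Q / 2 * |lacunary q (θ + h) - lacunary q θ| + Q * δ := by
        have h3 := lacunary_add_half_period hq k θ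
        have h4 := abs_sub_abs_le_abs_sub (2 * Q⁻¹ * sin (N k * θ))
          (-(lacunary q (θ + h) - lacunary q θ))
        rw [sub_neg_eq_add, abs_neg, add_comm (2 * Q⁻¹ * sin (N k * θ)), abs_mul,
          abs_of_pos (by positivity : 0 < 2 * Q⁻¹)] at h4
        have h5 : 2 * Q⁻¹ * |sin (N k * θ)| ≤ |lacunary q (θ + h) - lacunary q θ| + δ := by
          linarith
        have h6 := mul_le_mul_of_nonneg_left h5 (by positivity : 0 ≤ Q / 2)
        have h7 : Q / 2 * (2 * Q⁻¹ * |sin (N k * θ)|) = |sin (N k * θ)| := by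
          field_simp
        have h8 : 0 ≤ Q * δ := by positivity
        linarith
      have e : ‖dirComponent (θ + c - π / 2) (g θ)‖ₑ = ‖a θ‖ₑ := by rw [ha, enorm_norm]
      rw [e, ← mul_assoc, ← add_mul]
      gcongr
      rw [← ofReal_norm, ← ofReal_norm, ← ENNReal.ofReal_mul (by positivity),
        ← ENNReal.ofReal_add (by positivity) (by positivity)]
      exact ENNReal.ofReal_le_ofReal h2
    refine (lintegral_mono hpt).trans ?_
    rw [lintegral_add_right' _ (hai.1.enorm.const_mul _),
      lintegral_const_mul' _ _ ENNReal.ofReal_ne_top, lintegral_const_mul' _ _ ENNReal.ofReal_ne_top,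
      mul_comm (ENNReal.ofReal (Q * δ))]
    refine add_le_add_left ?_ _
    calc _ ≤ ENNReal.ofReal (Q / 2) * (4 * (C * ENNReal.ofReal (h ^ α)) +
          4 * ENNReal.ofReal (h ^ α) * C) := by
          gcongr
          refine hmain.trans ?_
          gcongr
      _ = 4 * C * (ENNReal.ofReal (Q / 2) * 2 * ENNReal.ofReal (h ^ α)) := by ring
      _ = _ := by
          rw [show (2 : ℝ≥0∞) = ENNReal.ofReal 2 by simp, ← ENNReal.ofReal_mul (by positivity),
            ← ENNReal.ofReal_mul (by positivity), div_mul_cancel₀ _ two_ne_zero]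
  have hsin : Tendsto (fun k => ∫⁻ θ, ‖sin (N k * θ)‖ₑ * ‖a θ‖ₑ ∂angleMeasure) atTop (𝓝 0) := by
    have l1 := ENNReal.Tendsto.const_mul (a := 4 * C)
      (ENNReal.tendsto_ofReal (tendsto_mul_half_period_rpow hq hα))
      (Or.inr (ENNReal.mul_ne_top (by simp) hC))
    have l2 := ENNReal.Tendsto.const_mul (a := A)
      (ENNReal.tendsto_ofReal (tendsto_mul_period_ratio hq)) (Or.inr hAt)
    have l := l1.add l2
    rw [ENNReal.ofReal_zero, mul_zero, mul_zero, add_zero] at l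
    exact tendsto_of_tendsto_of_tendsto_of_le_of_le tendsto_const_nhds l (fun _ => zero_le) hbound
  have hzero := ae_eq_zero_of_tendsto_lintegral_sin measurableSet_Ioc hai (fun _ => norm_nonneg _)
    hNlim hsin
  filter_upwards [hzero, hz] with θ h1 h2
  have h3 : dirComponent (θ + c - π / 2) (g θ) = 0 := norm_eq_zero.1 h1
  rw [normalComponent, h3, mul_zero, add_zero] at h2
  have hF : (radiusFun q θ : ℂ) ≠ 0 := by
    have := (radiusFun_mem_Icc hq θ).1
    exact_mod_cast (by linarith : 0 < radiusFun q θ).ne'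
  exact eq_zero_of_dirComponent ((mul_eq_zero.1 h2).resolve_left hF) h3

theorem exists_bdryNormal_eq (hq : 8 ≤ q) (θ : ℝ) : ∃ r : ℝ, r ≠ 0 ∧
    bdryNormal q θ 0 = r * (radiusFun q θ * cos θ + lacunary q θ * sin θ) ∧
    bdryNormal q θ 1 = r * (radiusFun q θ * sin θ - lacunary q θ * cos θ) := by
  refine ⟨(√(radiusFun q θ ^ 2 + lacunary q θ ^ 2))⁻¹, ?_, by simp [bdryNormal], by simp [bdryNormal]⟩
  have := (radiusFun_mem_Icc hq θ).1
  have h : 0 < radiusFun q θ ^ 2 + lacunary q θ ^ 2 := by positivity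
  positivity

end Final

theorem proposition3 :
    ∃ q₀ : ℕ, ∀ q : ℕ, q₀ ≤ q → ∀ p ε : ℝ, 1 ≤ p → 0 < ε →
      ∀ u : EuclideanSpace ℝ (Fin 2) → EuclideanSpace ℂ (Fin 2),
        MemSobolev (omegaDomain q) (1 / p + ε) p u →
        (∃ g : ℝ → EuclideanSpace ℂ (Fin 2), HasTrace q (1 / p + ε) p u g ∧
          ∀ g' : ℝ → EuclideanSpace ℂ (Fin 2), HasTrace q (1 / p + ε) p u g' →
            g' =ᵐ[angleMeasure] g) ∧
        ∀ g : ℝ → EuclideanSpace ℂ (Fin 2), HasTrace q (1 / p + ε) p u g →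
          ((∀ᵐ θ ∂angleMeasure,
              (bdryNormal q θ 0 : ℂ) * g θ 0 + (bdryNormal q θ 1 : ℂ) * g θ 1 = 0) →
            g =ᵐ[angleMeasure] 0) ∧
          ((∀ᵐ θ ∂angleMeasure,
              (bdryNormal q θ 0 : ℂ) * g θ 1 - (bdryNormal q θ 1 : ℂ) * g θ 0 = 0) →
            g =ᵐ[angleMeasure] 0) := by
  refine ⟨8, fun q hq p ε hp hε u hu => ⟨?_, fun g hg => ⟨fun h => ?_, fun h => ?_⟩⟩⟩
  · obtain ⟨g, hg⟩ := exists_hasTrace hq hp hε hu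
    exact ⟨g, hg, fun g' hg' => hg.ae_eq hq hp hε hu hg'⟩
  · refine hg.ae_eq_zero hq hp hε hu 0 ?_
    filter_upwards [h] with θ hθ
    obtain ⟨r, hr, h0, h1⟩ := exists_bdryNormal_eq hq θ
    have hr' : (r : ℂ) ≠ 0 := by exact_mod_cast hr
    rw [h0, h1] at hθ
    refine (mul_eq_zero.1 (Eq.trans ?_ hθ)).resolve_left hr'
    rw [normalComponent, dirComponent, dirComponent, add_zero, cos_sub_pi_div_two,
      sin_sub_pi_div_two]
    simp only [Complex.ofReal_mul, Complex.ofReal_add, Complex.ofReal_sub, Complex.ofReal_neg]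
    ring
  · refine hg.ae_eq_zero hq hp hε hu (π / 2) ?_
    filter_upwards [h] with θ hθ
    obtain ⟨r, hr, h0, h1⟩ := exists_bdryNormal_eq hq θ
    have hr' : (r : ℂ) ≠ 0 := by exact_mod_cast hr
    rw [h0, h1] at hθ
    refine (mul_eq_zero.1 (Eq.trans ?_ hθ)).resolve_left hr'
    rw [normalComponent, dirComponent, dirComponent, add_sub_cancel_right, cos_add_pi_div_two,
      sin_add_pi_div_two]
    simp only [Complex.ofReal_mul, Complex.ofReal_add, Complex.ofReal_sub, Complex.ofReal_neg]
    ring
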